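/- **Theorem 1.** Fix integers $b,\ell,n_0\ge 0$, put $k=2^\ell$, and for every $n>n_0$ let $M_N$, $N=2^n$, be an $N\times N$ complex matrix, rows and columns indexed by $\{0,\dots,N-1\}$. Assume that for all $n>n_0$: $M_N$ is unitary; $4b<N$ and $k\mid N$; $M_N$ is $b$-band-diagonal in the cyclic sense, i.e. $(M_N)_{i,j}=0$ unless $j\equiv i+d \pmod N$ for some integer $d$ with $|d|<b$; $M_N$ is cyclic with period $k$, i.e. $(M_N)_{i+k,j+k}=(M_N)_{i,j}$ with indices taken modulo $N$; and all entries of $M_N$ are algebraic numbers. Assume also that the matrices look locally identical: for all $N,N'$ in the family and every integer $d$ with $|d|<b$, if $i\equiv i' \pmod k$, $j\equiv i+d \pmod N$ and $j'\equiv i'+d\pmod{N'}$, then $(M_N)_{i,j}=(M_{N'})_{i',j'}$. Identify the standard basis of $\mathbb C^{N}$ with the computational basis of $n$ qubits through binary expansion. An elementary gate on $n$ qubits is one of NOT, Hadamard (one qubit), controlled-NOT, or the controlled $i$-phase $\mathrm{diag}(1,1,1,i)$ (two qubits), applied to any distinct qubits among the $n$ and tensored with the identity on the others. Then there is a polynomial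 $p$ in two variables such that for every $n>n_0$ and every $\varepsilon>0$ there is a product $M'_N$ of at most $p\bigl(n,\log(1/\varepsilon)\bigr)$ elementary gates on these $n$ qubits (hence with no ancillas) and a complex number $c$ with $|c|=1$ such that $\|M_N-c\,M'_N\|<\varepsilon$ in the operator norm; that is, $M'_N$ is $\varepsilon$-close to $M_N$ up to a global phase. -/

import Mathlib

open scoped Matrix.Norms.L2Operator

namespace PolyLocal

/-- `A` is `b`-band-diagonal in the cyclic sense: `A i j = 0` unless `|j - i| < b` modulo `N`. -/
def IsCyclicallyBanded (b : ℕ) {N : ℕ} (A : Matrix (Fin N) (Fin N) ℂ) : Prop :=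
  ∀ i j : Fin N, A i j ≠ 0 →
    ∃ d : ℤ, |d| < (b : ℤ) ∧ ((j : ℕ) : ℤ) ≡ ((i : ℕ) : ℤ) + d [ZMOD (N : ℤ)]

/-- `A` is cyclic with period `k`: `A (i + k) (j + k) = A i j`, indices taken modulo `N`. -/
def IsCyclicWithPeriod (k : ℕ) {N : ℕ} (A : Matrix (Fin N) (Fin N) ℂ) : Prop :=
  ∀ i j i' j' : Fin N, (i' : ℕ) ≡ (i : ℕ) + k [MOD N] → (j' : ℕ) ≡ (j : ℕ) + k [MOD N] →
    A i' j' = A i j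

/-- Two cyclically banded matrices, possibly of different sizes, look locally identical: an entry
in the band is determined by its row index modulo `k` and its (signed, cyclic) offset `d` from the
diagonal, in the same way for both matrices. -/
def LocallyIdentical (b k : ℕ) {N N' : ℕ} (A : Matrix (Fin N) (Fin N) ℂ)
    (A' : Matrix (Fin N') (Fin N') ℂ) : Prop :=
  ∀ (i j : Fin N) (i' j' : Fin N') (d : ℤ), |d| < (b : ℤ) →
    (i : ℕ) ≡ (i' : ℕ) [MOD k] →
    ((j : ℕ) : ℤ) ≡ ((i : ℕ) : ℤ) + d [ZMOD (N : ℤ)] →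
    ((j' : ℕ) : ℤ) ≡ ((i' : ℕ) : ℤ) + d [ZMOD (N' : ℤ)] →
    A i j = A' i' j'

/-- The elementary quantum gates, indexed by the number of qubits that they act on. -/
inductive Gate : ℕ → Type
  | hadamard : Gate 1
  | not : Gate 1
  | controlledNot : Gate 2
  | controlledPhase : Gate 2

/-- The matrix of an elementary gate in the computational basis of `m` qubits: the Hadamard gate,
`|x⟩ ↦ |x + 1⟩`, `|x, y⟩ ↦ |x, y + x⟩`, and `|x, y⟩ ↦ i ^ (x y) |x, y⟩`. -/
noncomputable def Gate.matrix : {m : ℕ} → Gate m → Matrix (Fin m → Fin 2) (Fin m → Fin 2) ℂ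
  | _, .hadamard => Matrix.of fun x y =>
      ((Real.sqrt 2 : ℝ) : ℂ)⁻¹ * (if x 0 = 1 ∧ y 0 = 1 then -1 else 1)
  | _, .not => Matrix.of fun x y => if x 0 = y 0 + 1 then 1 else 0
  | _, .controlledNot => Matrix.of fun x y => if x 0 = y 0 ∧ x 1 = y 1 + y 0 then 1 else 0
  | _, .controlledPhase => Matrix.diagonal fun x =>
      if x 0 = 1 ∧ x 1 = 1 then Complex.I else 1

/-- An elementary gate together with the distinct qubits, out of `n`, to which it is applied. -/
structure PlacedGate (n : ℕ) where
  arity : ℕ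
  gate : Gate arity
  wires : Fin arity ↪ Fin n

/-- The operator on `n` qubits of a placed gate: the gate on its wires tensored with the identity
on all the other qubits. -/
noncomputable def PlacedGate.matrix {n : ℕ} (g : PlacedGate n) :
    Matrix (Fin n → Fin 2) (Fin n → Fin 2) ℂ :=
  open Classical in
  Matrix.of fun x y =>
    if ∀ q : Fin n, q ∉ Set.range g.wires → x q = y q then
      g.gate.matrix (fun a => x (g.wires a)) (fun a => y (g.wires a))
    else 0

/-- A quantum circuit on exactly `n` qubits (there are no ancillas): a list of placed gates. Its
number of gates is the length of the list. -/
abbrev Circuit (n : ℕ) := List (PlacedGate n)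

/-- The `2 ^ n × 2 ^ n` matrix of the composition of the gates of a circuit, where the basis index
`x` in `Fin (2 ^ n)` is identified with the bit string of `x` in binary. -/
noncomputable def Circuit.matrix {n : ℕ} (C : Circuit n) : Matrix (Fin (2 ^ n)) (Fin (2 ^ n)) ℂ :=
  Matrix.reindex finFunctionFinEquiv finFunctionFinEquiv (List.map PlacedGate.matrix C).prod

end PolyLocal

/-! Cut the indices into blocks of length `2 ^ l`. Band structure and periodicity give `M n = ∑ d, U
d * T ^ (d - b)`, where `U d` acts on the `l` low qubits and is the same for every `n`, and `T` is
the cyclic shift by one block, which acts on the high qubits only (`sum_place_unrollBlock`). Since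
`4 * b < N`, products of two rows do not see the wrap-around, so unitarity passes to the infinite
periodic matrix and reads `∑ d, U d * star (U (d + e)) = δ_{e,0}`: the matrix polynomial `∑ d, U d z
^ d` is unitary on the unit circle (`sum_unrollBlock_mul_star`).

Such a polynomial factors. Let `P` be the projection onto the kernel of `U 0`. The extreme
correlation, first coefficient against last, vanishes, and this allows a factor `1 - P + P z` to be
split off on the right, lowering the degree by one (`exists_generated_of_correlation`). Hence `M n`
is a constant unitary on `l` qubits, times `2 * b` factors `1 - P + P T`, times a power of the
shift, and the number of factors does not depend on `n`. A change of basis on the low qubits makes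
each factor the inverse of an increment of the high bits that is triggered by the low bits. An
increment is a cascade of multiply controlled NOTs. These cost polynomially many gates without
ancillas, because any wire that is neither control nor target can be borrowed and restored. A
unitary on the fixed `l` qubits is reached by Gaussian elimination (`exists_generated`).

Up to here everything is exact, in terms of the elementary gates and arbitrary phases on one or two
qubits (`Generated`). It remains to approximate such phases on two qubits. The controlled phase and
its conjugate by two Hadamards both act inside one plane containing `|11⟩`; there they generate a
dense subgroup of `SU(2)`, and the Solovay–Kitaev argument, carried out in unit quaternions, gives
words of polylogarithmic length (`goodFrame_of_sq_eq`). This control is transported to the planes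
spanned by `|11⟩` and each of three orthonormal vectors, and three rotations there compose to the
wanted phase up to a scalar (`phaseOn_eq_smul_mul`). Errors of unitary factors add, so with `G`
generators the precision `ε / (G + 1)` for each one suffices, and its logarithm is still bounded by
a polynomial. -/

section

open scoped Matrix.Norms.L2Operator
open Matrix

namespace PolyLocal

/-! ### Operators placed on some of the wires, and permutation matrices. -/

/-- Operators on `n` qubits. -/
abbrev Op (n : ℕ) := Matrix (Fin n → Fin 2) (Fin n → Fin 2) ℂ

open Classical in
/-- Separate the bits on the wires `w` from the others. -/
noncomputable def splitWires {m n : ℕ} (w : Fin m ↪ Fin n) :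
    (Fin n → Fin 2) ≃ (Fin m → Fin 2) × ({q : Fin n // q ∉ Set.range w} → Fin 2) :=
  (Equiv.piEquivPiSubtypeProd (fun q => q ∈ Set.range w) (fun _ => Fin 2)).trans
    (Equiv.prodCongr (Equiv.arrowCongr (Equiv.ofInjective w w.injective).symm (Equiv.refl _))
      (Equiv.refl _))

theorem splitWires_fst {m n : ℕ} (w : Fin m ↪ Fin n) (x : Fin n → Fin 2) (a : Fin m) :
    (splitWires w x).1 a = x (w a) := by
  simp [splitWires, Equiv.arrowCongr, Equiv.piEquivPiSubtypeProd]

theorem splitWires_snd {m n : ℕ} (w : Fin m ↪ Fin n) (x : Fin n → Fin 2)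
    (q : {q : Fin n // q ∉ Set.range w}) : (splitWires w x).2 q = x q := by
  simp [splitWires, Equiv.piEquivPiSubtypeProd]

open Kronecker in
/-- The action of an operator on the wires `w`, tensored with the identity on the others. -/
noncomputable def place {m n : ℕ} (w : Fin m ↪ Fin n) : Op m →⋆ₐ[ℂ] Op n where
  toFun A := (A ⊗ₖ (1 : Matrix _ _ ℂ)).submatrix (splitWires w) (splitWires w)
  map_one' := by simp
  map_zero' := by simp
  map_mul' A B := by
    rw [submatrix_mul_equiv, ← mul_kronecker_mul, one_mul]
  map_add' A B := by
    rw [add_kronecker]; rfl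
  commutes' r := by
    rw [Algebra.algebraMap_eq_smul_one, Algebra.algebraMap_eq_smul_one, smul_kronecker,
      one_kronecker_one]
    ext i j
    simp [Matrix.one_apply]
  map_star' A := by
    simp [star_eq_conjTranspose, conjTranspose_kronecker]

open Classical in
theorem place_apply {m n : ℕ} (w : Fin m ↪ Fin n) (A : Op m) (x y : Fin n → Fin 2) :
    place w A x y = if ∀ q : Fin n, q ∉ Set.range w → x q = y q then
      A (fun a => x (w a)) (fun a => y (w a)) else 0 := by
  have h1 : ∀ x, (splitWires w x).1 = fun a => x (w a) := fun x => funext (splitWires_fst w x)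
  have h2 : (splitWires w x).2 = (splitWires w y).2 ↔ ∀ q : Fin n, q ∉ Set.range w → x q = y q := by
    rw [funext_iff]
    simp only [splitWires_snd, Subtype.forall]
  show (A _ _) * (1 : Matrix _ _ ℂ) _ _ = _
  rw [Matrix.one_apply, h1, h1]
  by_cases h : ∀ q : Fin n, q ∉ Set.range w → x q = y q
  · rw [if_pos (h2.2 h), if_pos h, mul_one]
  · rw [if_neg (fun h' => h (h2.1 h')), if_neg h, mul_zero]

theorem PlacedGate.matrix_eq {n : ℕ} (g : PlacedGate n) :
    g.matrix = place g.wires g.gate.matrix := by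
  ext x y
  rw [place_apply]
  rfl

theorem place_place {l m n : ℕ} (v : Fin l ↪ Fin m) (w : Fin m ↪ Fin n) (A : Op l) :
    place w (place v A) = place (v.trans w) A := by
  ext x y
  simp only [place_apply]
  by_cases h : ∀ q : Fin n, q ∉ Set.range (v.trans w) → x q = y q
  · rw [if_pos h, if_pos, if_pos]
    · rfl
    · intro q hq
      refine h _ ?_
      rintro ⟨a, ha⟩
      exact hq ⟨a, w.injective ha⟩
    · intro q hq
      refine h _ ?_
      rintro ⟨a, ha⟩
      exact hq ⟨v a, ha⟩
  · rw [if_neg h]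
    split_ifs with h1 h2
    · exfalso
      apply h
      intro q hq
      by_cases hw : q ∈ Set.range w
      · obtain ⟨a, rfl⟩ := hw
        refine h2 a ?_
        rintro ⟨c, rfl⟩
        exact hq ⟨c, rfl⟩
      · exact h1 q hw
    · rfl
    · rfl

/-- Star homomorphisms of C*-algebras are contractive; this is why `place` is built as one. -/
theorem norm_place_le {m n : ℕ} (w : Fin m ↪ Fin n) (A : Op m) : ‖place w A‖ ≤ ‖A‖ :=
  NonUnitalStarAlgHom.norm_apply_le (place w) A

theorem norm_reindex_le {ι κ : Type*} [Fintype ι] [Fintype κ] [DecidableEq ι] [DecidableEq κ]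
    (e : ι ≃ κ) (A : Matrix ι ι ℂ) : ‖Matrix.reindex e e A‖ ≤ ‖A‖ := by
  let f : Matrix ι ι ℂ →⋆ₐ[ℂ] Matrix κ κ ℂ :=
    { (Matrix.reindexAlgEquiv ℂ ℂ e : Matrix ι ι ℂ →ₐ[ℂ] Matrix κ κ ℂ) with
      map_star' := fun A => by
        ext i j
        simp [Matrix.star_apply] }
  exact NonUnitalStarAlgHom.norm_apply_le f A

/-- The permutation-like matrix sending the basis vector `y` to `f y`. -/
noncomputable def mapMatrix {n : ℕ} (f : (Fin n → Fin 2) → Fin n → Fin 2) : Op n :=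
  Matrix.of fun x y => if x = f y then 1 else 0

section mapMatrix
variable {n : ℕ} (f g : (Fin n → Fin 2) → Fin n → Fin 2)

theorem mapMatrix_apply (x y : Fin n → Fin 2) : mapMatrix f x y = if x = f y then 1 else 0 := rfl

theorem mul_mapMatrix_apply (A : Op n) (x y : Fin n → Fin 2) :
    (A * mapMatrix f) x y = A x (f y) := by
  simp [Matrix.mul_apply, mapMatrix_apply]

theorem mapMatrix_mul_mapMatrix : mapMatrix f * mapMatrix g = mapMatrix (f ∘ g) := by
  ext x y
  rw [mul_mapMatrix_apply]; rfl

theorem mapMatrix_id : mapMatrix (fun x => x) = (1 : Op n) := by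
  ext x y
  simp [mapMatrix_apply, Matrix.one_apply]

theorem mapMatrix_conj_diagonal (h : ∀ x, f (g x) = x) (d : (Fin n → Fin 2) → ℂ) :
    mapMatrix g * diagonal d * mapMatrix f = diagonal fun x => d (f x) := by
  have h' : Function.RightInverse g f := h
  have hb : Function.Bijective g := Finite.injective_iff_bijective.1 h'.injective
  ext x y
  rw [mul_mapMatrix_apply, Matrix.mul_diagonal, mapMatrix_apply, Matrix.diagonal_apply]
  have : x = g (f y) ↔ x = y := by
    have : g (f y) = y := by
      obtain ⟨z, rfl⟩ := hb.2 y
      rw [h]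
    rw [this]
  by_cases hxy : x = y
  · subst hxy
    simp [this]
  · simp [this, hxy]

end mapMatrix

theorem diagonal_mul_diagonal_fun {n : ℕ} (d e : (Fin n → Fin 2) → ℂ) :
    (diagonal d * diagonal e : Op n) = diagonal fun x => d x * e x :=
  Matrix.diagonal_mul_diagonal _ _

end PolyLocal

end

/-! ### Exact circuits: multiply controlled NOTs and phases without ancillas. -/

section

open scoped Matrix.Norms.L2Operator
open Matrix

namespace PolyLocal

/-- The phase `exp (i α)` on the basis vectors all of whose bits in `S` are `1`. -/
noncomputable def phaseOn {n : ℕ} (S : Finset (Fin n)) (α : ℝ) : Op n :=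
  diagonal fun x => if ∀ i ∈ S, x i = 1 then Complex.exp (α * Complex.I) else 1

/-- Flip the bit `t` if all the bits in `S` are `1`. -/
def ctrlFlip {n : ℕ} (S : Finset (Fin n)) (t : Fin n) (x : Fin n → Fin 2) : Fin n → Fin 2 :=
  if ∀ i ∈ S, x i = 1 then Function.update x t (x t + 1) else x

/-- The embedding of one wire. -/
def oneWire {n : ℕ} (t : Fin n) : Fin 1 ↪ Fin n := ⟨fun _ => t, fun _ _ _ => Subsingleton.elim _ _⟩

/-- The embedding of two distinct wires. -/
def twoWires {n : ℕ} (s t : Fin n) (h : s ≠ t) : Fin 2 ↪ Fin n :=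
  ⟨![s, t], by
    intro a b hab
    fin_cases a <;> fin_cases b <;> simp_all⟩

@[simp] theorem oneWire_apply {n : ℕ} (t : Fin n) (a : Fin 1) : oneWire t a = t := rfl

@[simp] theorem twoWires_zero {n : ℕ} (s t : Fin n) (h : s ≠ t) : twoWires s t h 0 = s := rfl

@[simp] theorem twoWires_one {n : ℕ} (s t : Fin n) (h : s ≠ t) : twoWires s t h 1 = t := rfl

/-- The Hadamard gate on the wire `t`. -/
noncomputable def hadamardOn {n : ℕ} (t : Fin n) : Op n := place (oneWire t) Gate.hadamard.matrix

/-- `Generated n L U`: up to a global phase, `U` is a product of at most `L` placed gates and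
arbitrary phases on one or two qubits. -/
inductive Generated (n : ℕ) : ℕ → Op n → Prop
  | scalar (c : ℂ) (hc : ‖c‖ = 1) : Generated n 0 (c • 1)
  | gate (g : PlacedGate n) : Generated n 1 g.matrix
  | phase (p q : Fin n) (α : ℝ) : Generated n 1 (phaseOn {p, q} α)
  | mul {L L' : ℕ} {U V : Op n} : Generated n L U → Generated n L' V → Generated n (L + L') (U * V)
  | mono {L L' : ℕ} {U : Op n} : Generated n L U → L ≤ L' → Generated n L' U

theorem Generated.one {n : ℕ} : Generated n 0 1 := by
  simpa using Generated.scalar (n := n) 1 (by simp)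

theorem Generated.hadamardOn {n : ℕ} (t : Fin n) : Generated n 1 (hadamardOn t) := by
  have := Generated.gate (n := n) ⟨1, .hadamard, oneWire t⟩
  rwa [PlacedGate.matrix_eq] at this

theorem fin_two_cases (a : Fin 2) : a = 0 ∨ a = 1 := by
  revert a; decide

section gates

theorem hadamard_mul_self : Gate.hadamard.matrix * Gate.hadamard.matrix = 1 := by
  have h2 : ((Real.sqrt 2 : ℝ) : ℂ)⁻¹ * ((Real.sqrt 2 : ℝ) : ℂ)⁻¹ = 1 / 2 := by
    rw [← mul_inv, ← Complex.ofReal_mul, Real.mul_self_sqrt (by norm_num)]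
    norm_num
  ext x y
  have hsum : ∀ f : (Fin 1 → Fin 2) → ℂ, ∑ z, f z = f (fun _ => 0) + f (fun _ => 1) := by
    intro f
    rw [← (Equiv.funUnique (Fin 1) (Fin 2)).symm.sum_comp, Fin.sum_univ_two]
    rfl
  rw [Matrix.mul_apply, hsum]
  simp only [Gate.matrix, of_apply]
  have hx : x = y ↔ x 0 = y 0 := by
    rw [funext_iff, Fin.forall_fin_one]
  rw [Matrix.one_apply]
  simp only [hx]
  rcases fin_two_cases (x 0) with h | h <;> rcases fin_two_cases (y 0) with h' | h' <;>
    rw [h, h'] <;> simp <;> linear_combination (2 : ℂ) * h2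

theorem hadamard_star : star Gate.hadamard.matrix = Gate.hadamard.matrix := by
  ext x y
  simp only [Gate.matrix, star_apply, of_apply]
  rw [star_mul']
  congr 1
  · simp
  · simp only [and_comm]; split_ifs <;> simp

theorem not_star : star Gate.not.matrix = Gate.not.matrix := by
  ext x y
  simp only [Gate.matrix, star_apply, of_apply]
  rcases fin_two_cases (x 0) with h | h <;> rcases fin_two_cases (y 0) with h' | h' <;>
    simp [h, h']

theorem not_eq_mapMatrix : Gate.not.matrix = mapMatrix (ctrlFlip ∅ 0) := by
  ext x y
  simp only [Gate.matrix, mapMatrix_apply, of_apply, ctrlFlip, Finset.notMem_empty,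
    IsEmpty.forall_iff, implies_true, if_true]
  congr 1
  rw [eq_iff_iff, funext_iff, Fin.forall_fin_one]
  simp

theorem controlledNot_eq_mapMatrix : Gate.controlledNot.matrix = mapMatrix (ctrlFlip {0} 1) := by
  ext x y
  simp only [Gate.matrix, mapMatrix_apply, of_apply, ctrlFlip, Finset.mem_singleton, forall_eq]
  congr 1
  rw [eq_iff_iff]
  rcases fin_two_cases (y 0) with h' | h'
  · simp [h', funext_iff, Fin.forall_fin_two]
  · simp [h', funext_iff, Fin.forall_fin_two]

theorem controlledPhase_eq_phaseOn : Gate.controlledPhase.matrix = phaseOn {0, 1} (Real.pi / 2) := by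
  simp only [Gate.matrix, phaseOn]
  congr 1
  funext x
  have : Complex.exp ((Real.pi / 2 : ℝ) * Complex.I) = Complex.I := by
    push_cast
    exact Complex.exp_pi_div_two_mul_I
  rw [this]
  simp

end gates

section ctrlFlip
variable {n : ℕ} {S : Finset (Fin n)} {t : Fin n}

theorem ctrlFlip_of_ne (x : Fin n → Fin 2) {i : Fin n} (hi : i ≠ t) : ctrlFlip S t x i = x i := by
  unfold ctrlFlip
  split_ifs
  · rw [Function.update_of_ne hi]
  · rfl

theorem ctrlFlip_same (x : Fin n → Fin 2) :
    ctrlFlip S t x t = x t + if ∀ i ∈ S, x i = 1 then 1 else 0 := by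
  unfold ctrlFlip
  split_ifs
  · simp
  · simp

theorem forall_ctrlFlip_iff {A : Finset (Fin n)} (ht : t ∉ A) (x : Fin n → Fin 2) :
    (∀ i ∈ A, ctrlFlip S t x i = 1) ↔ ∀ i ∈ A, x i = 1 :=
  forall₂_congr fun i hi => by rw [ctrlFlip_of_ne x (ne_of_mem_of_not_mem hi ht)]

theorem fin_two_add_self (a : Fin 2) : a + a = 0 := by
  revert a; decide

theorem ctrlFlip_ctrlFlip (ht : t ∉ S) (x : Fin n → Fin 2) : ctrlFlip S t (ctrlFlip S t x) = x := by
  funext i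
  by_cases hi : i = t
  · subst hi
    rw [ctrlFlip_same, ctrlFlip_same]
    simp only [forall_ctrlFlip_iff ht]
    rw [add_assoc, fin_two_add_self, add_zero]
  · rw [ctrlFlip_of_ne _ hi, ctrlFlip_of_ne _ hi]

theorem mapMatrix_ctrlFlip_mul_self (ht : t ∉ S) :
    mapMatrix (ctrlFlip S t) * mapMatrix (ctrlFlip S t) = 1 := by
  rw [mapMatrix_mul_mapMatrix, ← mapMatrix_id]
  congr 1
  funext x
  exact ctrlFlip_ctrlFlip ht x

/-- A commutator that borrows the wire `d` in an unknown state. The bit `t` is flipped under `d ∧ B`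
once before and once after `d` is toggled by `A`; the difference is `((d ⊕ A) ∧ B) ⊕ (d ∧ B) = A ∧
B`, and `d` is restored by the second toggle. -/
theorem ctrlFlip_union {A B : Finset (Fin n)} {d t : Fin n} (hdA : d ∉ A) (hdB : d ∉ B)
    (htA : t ∉ A) (htB : t ∉ B) (hdt : d ≠ t) :
    ctrlFlip (A ∪ B) t = ctrlFlip A d ∘ ctrlFlip (insert d B) t ∘ ctrlFlip A d ∘
      ctrlFlip (insert d B) t := by
  have h1 : t ∉ insert d B := by simp [htB, hdt.symm]
  funext x i
  simp only [Function.comp]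
  by_cases hit : i = t
  · subst hit
    rw [ctrlFlip_of_ne _ hdt.symm, ctrlFlip_same, ctrlFlip_same, ctrlFlip_of_ne _ hdt.symm,
      ctrlFlip_same]
    have e1 : ∀ y : Fin n → Fin 2, (∀ j ∈ insert d B, y j = 1) ↔ (y d = 1 ∧ ∀ j ∈ B, y j = 1) := by
      intro y; simp
    have e2 : (∀ j ∈ A ∪ B, x j = 1) ↔ ((∀ j ∈ A, x j = 1) ∧ ∀ j ∈ B, x j = 1) := by
      simp only [Finset.mem_union, or_imp, forall_and]
    simp only [e1, e2, forall_ctrlFlip_iff hdB, forall_ctrlFlip_iff htB, ctrlFlip_same,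
      forall_ctrlFlip_iff htA, ctrlFlip_of_ne _ hdt]
    by_cases hA : ∀ j ∈ A, x j = 1 <;> by_cases hB : ∀ j ∈ B, x j = 1
    · simp only [eq_true hA, eq_true hB, if_true, and_true]
      rcases fin_two_cases (x d) with h | h <;> simp [h, add_assoc, fin_two_add_self]
    · simp only [eq_true hA, eq_false hB, and_false, if_false, add_zero]
    · simp only [eq_false hA, eq_true hB, false_and, if_false, add_zero, and_true]
      rw [add_assoc, fin_two_add_self, add_zero]
    · simp only [eq_false hA, eq_false hB, and_false, if_false, add_zero]
  · rw [ctrlFlip_of_ne _ hit]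
    by_cases hid : i = d
    · subst hid
      rw [ctrlFlip_same, ctrlFlip_of_ne _ hdt, ctrlFlip_same, ctrlFlip_of_ne _ hdt]
      simp only [forall_ctrlFlip_iff htA, forall_ctrlFlip_iff hdA]
      rw [add_assoc, fin_two_add_self, add_zero]
    · rw [ctrlFlip_of_ne _ hid, ctrlFlip_of_ne _ hit, ctrlFlip_of_ne _ hid, ctrlFlip_of_ne _ hit]

end ctrlFlip

section circuits
variable {n : ℕ}

theorem hadamardOn_apply (t : Fin n) (x y : Fin n → Fin 2) :
    hadamardOn t x y = if ∀ q, q ≠ t → x q = y q then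
      ((Real.sqrt 2 : ℝ) : ℂ)⁻¹ * (if x t = 1 ∧ y t = 1 then -1 else 1) else 0 := by
  rw [hadamardOn, place_apply]
  have : Set.range (oneWire t) = {t} := by
    ext q
    simp [eq_comm]
  simp only [this, Set.mem_singleton_iff]
  split_ifs <;> simp_all [Gate.matrix]

theorem hadamardOn_mul_self (t : Fin n) : hadamardOn t * hadamardOn t = 1 := by
  rw [hadamardOn, ← map_mul, hadamard_mul_self, map_one]

theorem star_hadamardOn (t : Fin n) : star (hadamardOn t) = hadamardOn t := by
  rw [hadamardOn, ← map_star, hadamard_star]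

/-- A Hadamard on the target turns a flip into a sign on `|1⟩`, and a controlled sign is symmetric
in controls and target. -/
theorem mapMatrix_ctrlFlip_eq {S : Finset (Fin n)} {t : Fin n} (ht : t ∉ S) :
    mapMatrix (ctrlFlip S t) = hadamardOn t * (phaseOn (insert t S) Real.pi * hadamardOn t) := by
  have key : hadamardOn t * mapMatrix (ctrlFlip S t) = phaseOn (insert t S) Real.pi * hadamardOn t := by
    ext x y
    rw [mul_mapMatrix_apply, phaseOn, Matrix.diagonal_mul, hadamardOn_apply, hadamardOn_apply]
    have e : (∀ q, q ≠ t → x q = ctrlFlip S t y q) ↔ ∀ q, q ≠ t → x q = y q :=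
      forall₂_congr fun q hq => by rw [ctrlFlip_of_ne _ hq]
    simp only [e]
    by_cases h : ∀ q, q ≠ t → x q = y q
    · rw [if_pos h, if_pos h, Complex.exp_pi_mul_I, ctrlFlip_same]
      have e2 : (∀ i ∈ S, y i = 1) ↔ ∀ i ∈ S, x i = 1 :=
        forall₂_congr fun i hi => by rw [h i (fun h => ht (h ▸ hi))]
      have e3 : (∀ i ∈ insert t S, x i = 1) ↔ (x t = 1 ∧ ∀ i ∈ S, x i = 1) := by simp
      simp only [e2, e3]
      by_cases hS : ∀ i ∈ S, x i = 1
      · simp only [eq_true hS, if_true, and_true]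
        rcases fin_two_cases (x t) with h | h <;> rcases fin_two_cases (y t) with h' | h' <;>
          simp [h, h']
      · simp [hS]
    · rw [if_neg h, if_neg h, mul_zero]
  rw [← key, ← mul_assoc, hadamardOn_mul_self, one_mul]

theorem star_mapMatrix_ctrlFlip {S : Finset (Fin n)} {t : Fin n} (ht : t ∉ S) :
    star (mapMatrix (ctrlFlip S t)) = mapMatrix (ctrlFlip S t) := by
  ext x y
  rw [star_apply, mapMatrix_apply, mapMatrix_apply]
  have : y = ctrlFlip S t x ↔ x = ctrlFlip S t y := by
    constructor
    · rintro rfl; rw [ctrlFlip_ctrlFlip ht]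
    · rintro rfl; rw [ctrlFlip_ctrlFlip ht]
  simp only [this]
  split_ifs <;> simp

/-- For bits, `2 p s = p + s - (p ⊕ s)`. With `s` the conjunction of `S`, multiplying by `q α / 2`
writes the phase `α p q s` as three half phases; the one on `p ⊕ s` is a two-qubit phase conjugated
by a controlled flip of `p`. -/
theorem phaseOn_insert_insert {S : Finset (Fin n)} {p q : Fin n} (hp : p ∉ S)
    (hpq : p ≠ q) (α : ℝ) :
    phaseOn (insert p (insert q S)) α = phaseOn (insert q S) (α / 2) * phaseOn {p, q} (α / 2) *
      (mapMatrix (ctrlFlip S p) * phaseOn {p, q} (-(α / 2)) * mapMatrix (ctrlFlip S p)) := by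
  unfold phaseOn
  rw [mapMatrix_conj_diagonal _ _ (ctrlFlip_ctrlFlip hp), diagonal_mul_diagonal_fun,
    diagonal_mul_diagonal_fun]
  congr 1
  funext x
  have h1 : Complex.exp (((α / 2 : ℝ) : ℂ) * Complex.I) * Complex.exp (((α / 2 : ℝ) : ℂ) * Complex.I) =
      Complex.exp (α * Complex.I) := by
    rw [← Complex.exp_add]; congr 1; push_cast; ring
  have h2 : Complex.exp (((α / 2 : ℝ) : ℂ) * Complex.I) * Complex.exp (((-(α / 2) : ℝ) : ℂ) * Complex.I) = 1 := by
    rw [← Complex.exp_add, ← Complex.exp_zero]; congr 1; push_cast; ring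
  simp only [Finset.forall_mem_insert, Finset.mem_singleton, forall_eq, ctrlFlip_same,
    ctrlFlip_of_ne _ hpq.symm]
  by_cases hS : ∀ i ∈ S, x i = 1
  · simp only [eq_true hS]
    rcases fin_two_cases (x p) with h | h <;>
      rcases fin_two_cases (x q) with h' | h' <;>
      simp only [h, h', if_true, and_true, zero_ne_one, false_and, and_false, if_false, zero_add,
        mul_one, fin_two_add_self, h1, h2]
  · simp only [eq_false hS]
    rcases fin_two_cases (x p) with h | h <;>
      rcases fin_two_cases (x q) with h' | h' <;>
      simp only [h, h', if_true, and_true, zero_ne_one, false_and, and_false, if_false, zero_add,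
        add_zero, mul_one, one_mul, fin_two_add_self, h1, h2]

theorem place_phaseOn {m : ℕ} (w : Fin m ↪ Fin n) (S : Finset (Fin m)) (α : ℝ) :
    place w (phaseOn S α) = phaseOn (S.map w) α := by
  ext x y
  rw [place_apply, phaseOn, phaseOn, Matrix.diagonal_apply, Matrix.diagonal_apply]
  simp only [Finset.mem_map, forall_exists_index, and_imp, forall_apply_eq_imp_iff₂]
  by_cases h : x = y
  · subst h
    simp
  · rw [if_neg h]
    split_ifs with h1 h2 h3
    · exact absurd (funext fun q => by
        by_cases hq : q ∈ Set.range w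
        · obtain ⟨a, rfl⟩ := hq
          exact congrFun h2 a
        · exact h1 q hq) h
    · exact absurd (funext fun q => by
        by_cases hq : q ∈ Set.range w
        · obtain ⟨a, rfl⟩ := hq
          exact congrFun h2 a
        · exact h1 q hq) h
    · rfl
    · rfl

theorem place_mapMatrix_ctrlFlip {m : ℕ} (w : Fin m ↪ Fin n) {S : Finset (Fin m)} {t : Fin m}
    (ht : t ∉ S) :
    place w (mapMatrix (ctrlFlip S t)) = mapMatrix (ctrlFlip (S.map w) (w t)) := by
  have h1 : ∀ t, place w (hadamardOn t) = hadamardOn (w t) := by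
    intro t
    rw [hadamardOn, place_place]
    rfl
  rw [mapMatrix_ctrlFlip_eq ht, mapMatrix_ctrlFlip_eq (by simpa using ht), map_mul, map_mul, h1,
    place_phaseOn, Finset.map_insert]

theorem Generated.place {m L : ℕ} (w : Fin m ↪ Fin n) {U : Op m} (h : Generated m L U) :
    Generated n L (place w U) := by
  induction h with
  | scalar c hc => rw [map_smul, map_one]; exact .scalar c hc
  | gate g =>
    rw [PlacedGate.matrix_eq, place_place]
    have := Generated.gate (n := n) ⟨g.arity, g.gate, g.wires.trans w⟩
    rwa [PlacedGate.matrix_eq] at this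
  | phase p q α =>
    rw [place_phaseOn]
    simpa using Generated.phase (w p) (w q) α
  | mul _ _ h1 h2 => rw [map_mul]; exact .mul h1 h2
  | mono _ hL h => exact .mono h hL

theorem star_phaseOn (S : Finset (Fin n)) (α : ℝ) : star (phaseOn S α) = phaseOn S (-α) := by
  rw [star_eq_conjTranspose, phaseOn, diagonal_conjTranspose, phaseOn]
  congr 1
  funext x
  simp only [Pi.star_apply]
  split_ifs
  · rw [Complex.star_def, ← Complex.exp_conj]
    congr 1
    simp
  · simp

theorem phaseOn_add (S : Finset (Fin n)) (α β : ℝ) :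
    phaseOn S (α + β) = phaseOn S α * phaseOn S β := by
  rw [phaseOn, phaseOn, phaseOn, diagonal_mul_diagonal_fun]
  congr 1
  funext x
  split_ifs
  · rw [← Complex.exp_add]; congr 1; push_cast; ring
  · simp

theorem phaseOn_zero (S : Finset (Fin n)) : phaseOn S 0 = 1 := by
  rw [phaseOn]
  simp

theorem Generated.flip (t : Fin n) : Generated n 1 (mapMatrix (ctrlFlip ∅ t)) := by
  have := Generated.gate (n := n) ⟨1, .not, oneWire t⟩
  rw [PlacedGate.matrix_eq, not_eq_mapMatrix, place_mapMatrix_ctrlFlip _ (by simp)] at this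
  simpa using this

theorem Generated.controlledNot {s t : Fin n} (h : s ≠ t) :
    Generated n 1 (mapMatrix (ctrlFlip {s} t)) := by
  have := Generated.gate (n := n) ⟨2, .controlledNot, twoWires s t h⟩
  rw [PlacedGate.matrix_eq, controlledNot_eq_mapMatrix, place_mapMatrix_ctrlFlip _ (by simp)] at this
  simpa using this

/-- Three of the gates are self-adjoint. The inverse of the controlled phase is not an elementary
gate, but it is an admitted phase. -/
theorem star_gate_matrix_generated (g : PlacedGate n) : Generated n 1 (star g.matrix) := by
  obtain ⟨m, g, w⟩ := g
  rw [PlacedGate.matrix_eq, ← map_star]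
  cases g with
  | hadamard =>
    simp only [hadamard_star]
    rw [← PlacedGate.matrix_eq ⟨1, .hadamard, w⟩]
    exact .gate _
  | not =>
    simp only [not_star]
    rw [← PlacedGate.matrix_eq ⟨1, .not, w⟩]
    exact .gate _
  | controlledNot =>
    simp only [controlledNot_eq_mapMatrix]
    rw [star_mapMatrix_ctrlFlip (by simp), ← controlledNot_eq_mapMatrix,
      ← PlacedGate.matrix_eq ⟨2, .controlledNot, w⟩]
    exact .gate _
  | controlledPhase =>
    simp only [controlledPhase_eq_phaseOn]
    rw [star_phaseOn, place_phaseOn]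
    simpa using Generated.phase (w 0) (w 1) (-(Real.pi / 2))

theorem Generated.star {L : ℕ} {U : Op n} (h : Generated n L U) : Generated n L (star U) := by
  induction h with
  | scalar c hc => rw [star_smul, star_one]; exact .scalar _ (by simpa using hc)
  | gate g => exact star_gate_matrix_generated g
  | phase p q α => rw [star_phaseOn]; exact .phase p q _
  | mul _ _ h1 h2 => rw [star_mul, add_comm]; exact .mul h2 h1
  | mono _ hL h => exact .mono h hL

theorem phaseOn_mem_unitary (S : Finset (Fin n)) (α : ℝ) : phaseOn S α ∈ unitary (Op n) := by
  rw [Unitary.mem_iff, star_phaseOn, ← phaseOn_add, ← phaseOn_add]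
  simp [phaseOn_zero]

theorem PlacedGate.matrix_mem_unitary (g : PlacedGate n) : g.matrix ∈ unitary (Op n) := by
  obtain ⟨m, g, w⟩ := g
  rw [PlacedGate.matrix_eq]
  have : g.matrix ∈ unitary (Op m) := by
    cases g with
    | hadamard => rw [Unitary.mem_iff, hadamard_star, hadamard_mul_self]; simp
    | not =>
      rw [Unitary.mem_iff, not_eq_mapMatrix, star_mapMatrix_ctrlFlip (by simp),
        mapMatrix_ctrlFlip_mul_self (by simp)]
      simp
    | controlledNot =>
      rw [Unitary.mem_iff, controlledNot_eq_mapMatrix, star_mapMatrix_ctrlFlip (by simp),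
        mapMatrix_ctrlFlip_mul_self (by simp)]
      simp
    | controlledPhase => rw [controlledPhase_eq_phaseOn]; exact phaseOn_mem_unitary _ _
  exact Unitary.map_mem (PolyLocal.place w) this

theorem Generated.mem_unitary {L : ℕ} {U : Op n} (h : Generated n L U) : U ∈ unitary (Op n) := by
  induction h with
  | scalar c hc =>
    have : c * starRingEnd ℂ c = 1 := by
      rw [Complex.mul_conj, Complex.normSq_eq_norm_sq, hc]; simp
    rw [Unitary.mem_iff, star_smul, star_one]
    simp only [smul_mul_assoc, one_mul, smul_smul, Complex.star_def]
    rw [this, mul_comm, this]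
    simp
  | gate g => exact g.matrix_mem_unitary
  | phase p q α => exact phaseOn_mem_unitary _ _
  | mul _ _ h1 h2 => exact mul_mem h1 h2
  | mono _ hL h => exact h

/-- The cost recursion of `ctrlFlip_union`: four flips with about `s / 2` controls each, one control
being the borrowed wire. A fourth power leaves room for the rounding. For `s = 2` the value `s / 2 +
1` would not be smaller than `s`. -/
theorem four_pow_halves {s : ℕ} (hs : 3 ≤ s) :
    2 * (7 * (s - s / 2) ^ 4 + 1) + 2 * (7 * (s / 2 + 1) ^ 4 + 1) ≤ 7 * s ^ 4 + 1 := by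
  obtain ⟨h, rfl | rfl⟩ : ∃ h, s = 2 * h ∨ s = 2 * h + 1 := ⟨s / 2, by omega⟩
  · have e1 : 2 * h - 2 * h / 2 = h := by omega
    have e2 : 2 * h / 2 = h := by omega
    rw [e1, e2]
    obtain ⟨k, rfl⟩ : ∃ k, h = k + 2 := ⟨h - 2, by omega⟩
    ring_nf
    nlinarith [Nat.zero_le k]
  · have e1 : 2 * h + 1 - (2 * h + 1) / 2 = h + 1 := by omega
    have e2 : (2 * h + 1) / 2 = h := by omega
    rw [e1, e2]
    obtain ⟨k, rfl⟩ : ∃ k, h = k + 1 := ⟨h - 1, by omega⟩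
    ring_nf
    nlinarith [Nat.zero_le k]

/-- A multiply controlled NOT with an idle qubit `d`. -/
theorem Generated.ctrlFlip_of_idle (S : Finset (Fin n)) : ∀ {d t : Fin n}, d ∉ S → t ∉ S → d ≠ t →
    Generated n (7 * S.card ^ 4 + 1) (mapMatrix (ctrlFlip S t)) := by
  induction hs : S.card using Nat.strong_induction_on generalizing S with
  | _ s ih =>
    intro d t hd ht hdt
    by_cases h3 : 3 ≤ s
    · obtain ⟨A, hAS, hA⟩ := Finset.exists_subset_card_eq (s := S) (n := s - s / 2) (by omega)
      set B := S \ A with hB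
      have hBc : B.card = s / 2 := by
        rw [hB, Finset.card_sdiff_of_subset hAS]; omega
      have hAB : A ∪ B = S := Finset.union_sdiff_of_subset hAS
      have hdA : d ∉ A := fun h => hd (hAS h)
      have htA : t ∉ A := fun h => ht (hAS h)
      have hdB : d ∉ B := fun h => hd (Finset.sdiff_subset h)
      have htB : t ∉ B := fun h => ht (Finset.sdiff_subset h)
      have hdBc : (insert d B).card = s / 2 + 1 := by
        rw [Finset.card_insert_of_notMem hdB, hBc]
      obtain ⟨a, ha⟩ : A.Nonempty := Finset.card_pos.1 (by omega)
      have haB : a ∉ B := fun h => (Finset.mem_sdiff.1 h).2 ha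
      -- Each half again has an idle wire: `t` while `d` is the target, and some `a ∈ A` while `t`
      -- is the target.
      have g1 := ih _ (by omega) A hA (d := t) (t := d) htA hdA hdt.symm
      have g2 := ih _ (by omega) (insert d B) hdBc (d := a) (t := t)
        (by simp only [Finset.mem_insert, not_or]; exact ⟨fun h => hdA (h ▸ ha), haB⟩)
        (by simp only [Finset.mem_insert, not_or]; exact ⟨hdt.symm, htB⟩)
        (fun h => htA (h ▸ ha))
      rw [← hAB, ctrlFlip_union hdA hdB htA htB hdt, ← mapMatrix_mul_mapMatrix,
        ← mapMatrix_mul_mapMatrix, ← mapMatrix_mul_mapMatrix]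
      refine (g1.mul (g2.mul (g1.mul g2))).mono ?_
      have := four_pow_halves h3
      omega
    · obtain h | h | h : s = 0 ∨ s = 1 ∨ s = 2 := by omega
      · rw [h] at hs
        rw [Finset.card_eq_zero.1 hs, h]
        exact (Generated.flip t).mono (by norm_num)
      · rw [h] at hs
        obtain ⟨a, rfl⟩ := Finset.card_eq_one.1 hs
        rw [h]
        exact (Generated.controlledNot (by rintro rfl; simp at ht)).mono (by norm_num)
      · rw [h] at hs
        obtain ⟨a, b, hab, rfl⟩ := Finset.card_eq_two.1 hs
        simp only [Finset.mem_insert, Finset.mem_singleton, not_or] at ht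
        have e : insert t ({a, b} : Finset (Fin n)) = insert t (insert a {b}) := rfl
        rw [mapMatrix_ctrlFlip_eq (by simpa using ht), e,
          phaseOn_insert_insert (by simpa using ht.2) ht.1, h]
        have hc := Generated.controlledNot (s := b) (t := t) (fun h => ht.2 h.symm)
        exact ((Generated.hadamardOn t).mul ((((Generated.phase a b _).mul
          (Generated.phase t a _)).mul ((hc.mul (Generated.phase t a _)).mul hc)).mul
          (Generated.hadamardOn t))).mono (by norm_num)

/-- Remove one qubit at a time by `phaseOn_insert_insert`. The flip of `p` controlled by the
remaining set has `q` as idle wire, so `S` may consist of all the qubits. Each removal costs two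
flips and two phases, that is `14 s ^ 4 + 4`. -/
theorem Generated.phaseOn (S : Finset (Fin n)) (α : ℝ) :
    Generated n (S.card * (14 * S.card ^ 4 + 4)) (phaseOn S α) := by
  induction hs : S.card generalizing S α with
  | zero =>
    rw [Finset.card_eq_zero.1 hs]
    have : PolyLocal.phaseOn (∅ : Finset (Fin n)) α = Complex.exp (α * Complex.I) • 1 := by
      simp only [PolyLocal.phaseOn, Finset.notMem_empty, IsEmpty.forall_iff, implies_true, if_true]
      rw [Matrix.smul_one_eq_diagonal]
    rw [this]
    exact (Generated.scalar _ (Complex.norm_exp_ofReal_mul_I α)).mono (by simp)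
  | succ s ih =>
    cases s with
    | zero =>
      obtain ⟨a, rfl⟩ := Finset.card_eq_one.1 hs
      have := Generated.phase a a α
      rw [Finset.pair_eq_singleton] at this
      exact this.mono (by norm_num)
    | succ s =>
      obtain ⟨p, T, hpT, rfl, hT⟩ := Finset.card_eq_succ.1 hs
      obtain ⟨q, R, hqR, rfl, hR⟩ := Finset.card_eq_succ.1 hT
      simp only [Finset.mem_insert, not_or] at hpT
      rw [phaseOn_insert_insert hpT.2 hpT.1]
      have hc := Generated.ctrlFlip_of_idle R hqR hpT.2 (Ne.symm hpT.1)
      refine (((ih _ _ hT).mul (Generated.phase p q _)).mul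
        ((hc.mul (Generated.phase p q _)).mul hc)).mono ?_
      rw [hR]
      have h1 : s ^ 4 ≤ (s + 2) ^ 4 := Nat.pow_le_pow_left (by omega) 4
      have h2 : (s + 1) ^ 4 ≤ (s + 2) ^ 4 := Nat.pow_le_pow_left (by omega) 4
      have h3 : (s + 1) * (14 * (s + 1) ^ 4 + 4) ≤ (s + 1) * (14 * (s + 2) ^ 4 + 4) :=
        Nat.mul_le_mul_left _ (by omega)
      have h4 : (s + 1 + 1) * (14 * (s + 2) ^ 4 + 4) = (s + 1) * (14 * (s + 2) ^ 4 + 4) + (14 * (s + 2) ^ 4 + 4) := by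
        ring
      show _ ≤ (s + 1 + 1) * (14 * (s + 2) ^ 4 + 4)
      omega

theorem Generated.phaseOn' (S : Finset (Fin n)) (α : ℝ) :
    Generated n (n * (14 * n ^ 4 + 4)) (PolyLocal.phaseOn S α) := by
  have h : S.card ≤ n := by simpa using S.card_le_univ
  exact (Generated.phaseOn S α).mono (by gcongr)

/-- In contrast to `Generated.ctrlFlip_of_idle`, no idle wire is required: the passage through a
phase removes that condition. -/
theorem Generated.ctrlFlip {S : Finset (Fin n)} {t : Fin n} (ht : t ∉ S) :
    Generated n (n * (14 * n ^ 4 + 4) + 2) (mapMatrix (ctrlFlip S t)) := by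
  rw [mapMatrix_ctrlFlip_eq ht]
  exact ((Generated.hadamardOn t).mul ((Generated.phaseOn' _ _).mul (Generated.hadamardOn t))).mono
    (by omega)

end circuits

end PolyLocal

end

/-! ### Gaussian elimination: every unitary is exactly generated. -/

section

open scoped Matrix.Norms.L2Operator
open Matrix

namespace PolyLocal

section elimination
variable {ι : Type*} [Fintype ι] [DecidableEq ι]

/-- The complex reflection with eigenvalue `c` on the line of `e x - e y`. -/
noncomputable def pairReflection (x y : ι) (c : ℂ) : Matrix ι ι ℂ :=
  1 + ((c - 1) / 2) • vecMulVec (Pi.single x 1 - Pi.single y 1) (Pi.single x 1 - Pi.single y 1)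

/-- The diagonal matrix with entry `c` at `x` and `1` elsewhere. -/
noncomputable def phaseAt (x : ι) (c : ℂ) : Matrix ι ι ℂ :=
  1 + (c - 1) • vecMulVec (Pi.single x 1) (Pi.single x 1)

theorem pairReflection_comm (x y : ι) (c : ℂ) : pairReflection x y c = pairReflection y x c := by
  unfold pairReflection
  rw [← neg_sub (Pi.single y 1 : ι → ℂ), vecMulVec_neg, neg_vecMulVec, neg_neg]

/-- The matrix agrees with the identity in the rows and columns in `T`. -/
def FixesOn (T : Finset ι) (A : Matrix ι ι ℂ) : Prop :=
  ∀ z ∈ T, ∀ w, A z w = (1 : Matrix ι ι ℂ) z w ∧ A w z = (1 : Matrix ι ι ℂ) w z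

theorem FixesOn.mul {T : Finset ι} {A B : Matrix ι ι ℂ} (hA : FixesOn T A) (hB : FixesOn T B) :
    FixesOn T (A * B) := by
  intro z hz w
  constructor
  · rw [Matrix.mul_apply, Finset.sum_congr rfl fun v _ => by rw [(hA z hz v).1], ← Matrix.mul_apply,
      one_mul, (hB z hz w).1]
  · rw [Matrix.mul_apply, Finset.sum_congr rfl fun v _ => by rw [(hB z hz v).2], ← Matrix.mul_apply,
      mul_one, (hA z hz w).2]

theorem fixesOn_pairReflection {T : Finset ι} {x y : ι} (hx : x ∉ T) (hy : y ∉ T) (c : ℂ) :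
    FixesOn T (pairReflection x y c) := by
  intro z hz w
  have h1 : z ≠ x := ne_of_mem_of_not_mem hz hx
  have h2 : z ≠ y := ne_of_mem_of_not_mem hz hy
  simp [pairReflection, vecMulVec_apply, h1, h2]

theorem fixesOn_phaseAt {T : Finset ι} {x : ι} (hx : x ∉ T) (c : ℂ) : FixesOn T (phaseAt x c) := by
  intro z hz w
  have h1 : z ≠ x := ne_of_mem_of_not_mem hz hx
  simp [phaseAt, vecMulVec_apply, h1]

theorem phaseAt_mul_apply (x : ι) (c : ℂ) (V : Matrix ι ι ℂ) (z w : ι) :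
    (phaseAt x c * V) z w = if z = x then c * V x w else V z w := by
  rw [phaseAt, Matrix.add_mul, one_mul, Matrix.smul_mul, vecMulVec_mul]
  by_cases h : z = x
  · subst h
    simp [vecMulVec_apply]
    ring
  · simp [vecMulVec_apply, h]

theorem pairReflection_mul_apply {x y : ι} (c : ℂ) (V : Matrix ι ι ℂ) (z w : ι) :
    (pairReflection x y c * V) z w = V z w +
      (c - 1) / 2 * ((Pi.single x 1 - Pi.single y 1 : ι → ℂ) z * (V x w - V y w)) := by
  rw [pairReflection, Matrix.add_mul, one_mul, Matrix.smul_mul, vecMulVec_mul]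
  simp [vecMulVec_apply, Matrix.sub_vecMul]

theorem exists_unit_mul_eq_norm (a : ℂ) : ∃ c : ℂ, ‖c‖ = 1 ∧ c * a = ‖a‖ := by
  by_cases h : a = 0
  · exact ⟨1, by simp, by simp [h]⟩
  · have h' : (‖a‖ : ℂ) ≠ 0 := by exact_mod_cast norm_ne_zero_iff.2 h
    refine ⟨‖a‖ / a, ?_, by field_simp⟩
    rw [norm_div, Complex.norm_real, norm_norm, div_self (norm_ne_zero_iff.2 h)]

variable (S : Submonoid (Matrix ι ι ℂ))
  (hphase : ∀ (x : ι) (c : ℂ), ‖c‖ = 1 → phaseAt x c ∈ S)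
  (hpair : ∀ (x y : ι) (c : ℂ), x ≠ y → ‖c‖ = 1 → pairReflection x y c ∈ S)

include hphase hpair in
-- Phases first bring the two entries to `r` and `i s` with `r, s ≥ 0`. The reflection then
-- annihilates the second one exactly when `c (r - i s) = r + i s`, and this `c` has modulus one
-- because the two numbers are conjugate.
theorem exists_eliminate_entry {T : Finset ι} {x y : ι} (hx : x ∉ T) (hy : y ∉ T) (hxy : x ≠ y)
    (V : Matrix ι ι ℂ) (w : ι) : ∃ g ∈ S, FixesOn T g ∧ (g * V) y w = 0 ∧
      ∀ z, z ≠ x → z ≠ y → (g * V) z w = V z w := by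
  obtain ⟨c₁, hc₁, h₁⟩ := exists_unit_mul_eq_norm (V x w)
  obtain ⟨c₂, hc₂, h₂⟩ := exists_unit_mul_eq_norm (V y w)
  obtain ⟨c, hc, hcc⟩ : ∃ c : ℂ, ‖c‖ = 1 ∧
      c * (‖V x w‖ - Complex.I * ‖V y w‖) = ‖V x w‖ + Complex.I * ‖V y w‖ := by
    set d : ℂ := ‖V x w‖ - Complex.I * ‖V y w‖ with hd
    have hd' : (‖V x w‖ + Complex.I * ‖V y w‖ : ℂ) = starRingEnd ℂ d := by
      rw [hd]; simp
    rw [hd']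
    by_cases h : d = 0
    · exact ⟨1, by simp, by simp [h]⟩
    · refine ⟨starRingEnd ℂ d / d, ?_, by field_simp⟩
      rw [norm_div, RCLike.norm_conj, div_self (norm_ne_zero_iff.2 h)]
  refine ⟨pairReflection x y c * (phaseAt x c₁ * phaseAt y (Complex.I * c₂)),
    S.mul_mem (hpair x y c hxy hc) (S.mul_mem (hphase x c₁ hc₁) (hphase y _ (by simp [hc₂]))),
    (fixesOn_pairReflection hx hy c).mul ((fixesOn_phaseAt hx _).mul (fixesOn_phaseAt hy _)), ?_, ?_⟩
  · rw [mul_assoc, mul_assoc, pairReflection_mul_apply]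
    simp only [phaseAt_mul_apply, hxy, hxy.symm, if_true, if_false, mul_assoc, h₁, h₂]
    simp [hxy, hxy.symm]
    linear_combination (1 / 2 : ℂ) * (-hcc)
  · intro z hzx hzy
    rw [mul_assoc, mul_assoc, pairReflection_mul_apply]
    simp [phaseAt_mul_apply, hzx, hzy]

include hphase hpair in
theorem exists_eliminate_column {T : Finset ι} {x : ι} (hx : x ∉ T) (V : Matrix ι ι ℂ)
    (R : Finset ι) (hR : ∀ y ∈ R, y ∉ T ∧ x ≠ y) :
    ∃ g ∈ S, FixesOn T g ∧ ∀ y ∈ R, (g * V) y x = 0 := by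
  induction R using Finset.induction_on with
  | empty => exact ⟨1, S.one_mem, fun z _ w => ⟨rfl, rfl⟩, by simp⟩
  | insert y R hy ih =>
    obtain ⟨g, hg, hgT, hgR⟩ := ih fun z hz => hR z (Finset.mem_insert_of_mem hz)
    have hy' := hR y (Finset.mem_insert_self _ _)
    obtain ⟨k, hk, hkT, hk1, hk2⟩ :=
      exists_eliminate_entry S hphase hpair hx hy'.1 hy'.2 (g * V) x
    refine ⟨k * g, S.mul_mem hk hg, hkT.mul hgT, fun z hz => ?_⟩
    rw [mul_assoc]
    rcases Finset.mem_insert.1 hz with rfl | hz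
    · exact hk1
    · rw [hk2 z (hR z (Finset.mem_insert_of_mem hz)).2.symm (fun h => hy (h ▸ hz))]
      exact hgR z hz

include hphase hpair in
theorem exists_mul_fixesOn (hS : ∀ g ∈ S, g ∈ unitary (Matrix ι ι ℂ)) {V : Matrix ι ι ℂ}
    (hV : V ∈ unitary (Matrix ι ι ℂ)) (T : Finset ι) : ∃ g ∈ S, FixesOn T (g * V) := by
  induction T using Finset.induction_on with
  | empty => exact ⟨1, S.one_mem, by intro z hz; simp at hz⟩
  | insert x T hx ih =>
    obtain ⟨g, hg, hgT⟩ := ih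
    obtain ⟨k, hk, hkT, hkx⟩ := exists_eliminate_column S hphase hpair hx (g * V)
      (Finset.univ.filter fun y => y ∉ T ∧ x ≠ y) (by simp)
    set W := k * (g * V) with hW
    have hWT : FixesOn T W := hkT.mul hgT
    have hWx : ∀ y, y ≠ x → W y x = 0 := by
      intro y hy
      by_cases hyT : y ∈ T
      · rw [(hWT y hyT x).1, Matrix.one_apply_ne hy]
      · exact hkx y (by simp [hyT, hy.symm])
    obtain ⟨c, hc, hcW⟩ := exists_unit_mul_eq_norm (W x x)
    have hWu : W ∈ unitary (Matrix ι ι ℂ) := mul_mem (hS k hk) (mul_mem (hS g hg) hV)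
    -- The diagonal entry is the only nonzero one in its column, and columns have norm one.
    have hn : ‖W x x‖ = 1 := by
      have h := congrFun (congrFun (Unitary.mem_iff.1 hWu).1 x) x
      rw [Matrix.mul_apply, Finset.sum_eq_single x (fun y _ hy => by rw [hWx y hy, mul_zero])
        (by simp), star_apply, Matrix.one_apply_eq, Complex.star_def, mul_comm, Complex.mul_conj,
        Complex.normSq_eq_norm_sq] at h
      have h' : ‖W x x‖ ^ 2 = 1 := by exact_mod_cast h
      nlinarith [norm_nonneg (W x x)]
    rw [hn] at hcW
    set Z := phaseAt x c * W with hZ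
    have hZu : Z ∈ unitary (Matrix ι ι ℂ) := mul_mem (hS _ (hphase x c hc)) hWu
    have hZT : FixesOn T Z := (fixesOn_phaseAt hx c).mul hWT
    have hcol : ∀ y, Z y x = (1 : Matrix ι ι ℂ) y x := by
      intro y
      rw [hZ, phaseAt_mul_apply]
      by_cases hy : y = x
      · subst hy
        simpa using hcW
      · rw [if_neg hy, hWx y hy, Matrix.one_apply_ne hy]
    -- Column `x` of `Z` is a basis vector, so the entry `(x, y)` of `star Z * Z = 1` is just `Z x
    -- y`.
    have hrow : ∀ y, Z x y = (1 : Matrix ι ι ℂ) x y := by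
      intro y
      have h := congrFun (congrFun (Unitary.mem_iff.1 hZu).1 x) y
      rw [Matrix.mul_apply, Finset.sum_congr rfl fun v _ => by rw [star_apply, hcol v]] at h
      rw [← h]
      simp [Matrix.one_apply]
    refine ⟨phaseAt x c * (k * g), S.mul_mem (hphase x c hc) (S.mul_mem hk hg), ?_⟩
    rw [mul_assoc, mul_assoc, ← hW, ← hZ]
    intro z hz w
    rcases Finset.mem_insert.1 hz with rfl | hz
    · exact ⟨hrow w, hcol w⟩
    · exact hZT z hz w

include hphase hpair in
theorem mem_of_mem_unitary (hS : ∀ g ∈ S, g ∈ unitary (Matrix ι ι ℂ)) (hstar : ∀ g ∈ S, star g ∈ S)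
    {V : Matrix ι ι ℂ} (hV : V ∈ unitary (Matrix ι ι ℂ)) : V ∈ S := by
  obtain ⟨g, hg, h⟩ := exists_mul_fixesOn S hphase hpair hS hV Finset.univ
  have h1 : g * V = 1 := by
    ext z w
    exact (h z (Finset.mem_univ z) w).1
  have h2 : V = star g := by
    calc V = star g * g * V := by rw [(Unitary.mem_iff.1 (hS g hg)).1, one_mul]
      _ = star g := by rw [mul_assoc, h1, mul_one]
  rw [h2]
  exact hstar g hg

end elimination

/-- The reflection with eigenvalue `-1` is the transposition of `y` and `z`, which carries `e x - e
y` to `e x - e z`. -/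
theorem pairReflection_conj {ι : Type*} [Fintype ι] [DecidableEq ι] {x y z : ι} (hxy : x ≠ y)
    (hyz : y ≠ z) (hxz : x ≠ z) (c : ℂ) :
    pairReflection y z (-1) * pairReflection x y c * pairReflection y z (-1) =
      pairReflection x z c := by
  have hb : pairReflection y z (-1) =
      1 - vecMulVec (Pi.single y 1 - Pi.single z 1) (Pi.single y 1 - Pi.single z 1) := by
    rw [pairReflection]
    norm_num [sub_eq_add_neg]
  have hbb : pairReflection y z (-1) * pairReflection y z (-1) = 1 := by
    rw [hb, mul_sub, sub_mul, sub_mul, vecMulVec_mul_vecMulVec]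
    simp [sub_dotProduct, dotProduct_sub, hyz, hyz.symm]
    norm_num [two_smul, ← sub_eq_add_neg]
  have h1 : pairReflection y z (-1) *ᵥ (Pi.single x 1 - Pi.single y 1) = Pi.single x 1 - Pi.single z 1 := by
    rw [hb, sub_mulVec, vecMulVec_mulVec]
    simp [dotProduct_sub, sub_dotProduct, hyz, hyz.symm, hxz, hxz.symm, hxy, hxy.symm]
  have h2 : (Pi.single x 1 - Pi.single y 1) ᵥ* pairReflection y z (-1) = Pi.single x 1 - Pi.single z 1 := by
    rw [hb, vecMul_sub, vecMul_vecMulVec]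
    simp [dotProduct_sub, sub_dotProduct, hyz, hyz.symm, hxz, hxz.symm, hxy, hxy.symm]
  nth_rewrite 2 [pairReflection]
  rw [mul_add, add_mul, mul_one, hbb, Matrix.mul_smul, Matrix.smul_mul, mul_vecMulVec,
    vecMulVec_mul, h1, h2]
  rfl

section qubits
variable {n : ℕ}

theorem ctrlFlip_empty (t : Fin n) (x : Fin n → Fin 2) : ctrlFlip ∅ t x = x + Pi.single t 1 := by
  funext i
  by_cases h : i = t
  · subst h
    rw [ctrlFlip_same]
    simp
  · rw [ctrlFlip_of_ne _ h]
    simp [h]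

/-- Flipping a fixed set of bits. -/
theorem Generated.translate (m : Fin n → Fin 2) : Generated n n (mapMatrix fun x => x + m) := by
  have key : ∀ S : Finset (Fin n),
      Generated n S.card (mapMatrix fun x => x + ∑ t ∈ S, Pi.single t (m t)) := by
    intro S
    induction S using Finset.induction_on with
    | empty => simpa [mapMatrix_id] using Generated.one
    | insert t S ht ih =>
      rw [Finset.card_insert_of_notMem ht]
      rcases fin_two_cases (m t) with h | h
      · refine Generated.mono (L := S.card) ?_ (by omega)
        simpa [Finset.sum_insert ht, h] using ih
      · have := ih.mul (Generated.flip t)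
        rw [mapMatrix_mul_mapMatrix] at this
        convert this using 2
        funext x
        rw [Function.comp, ctrlFlip_empty, Finset.sum_insert ht, h, add_assoc]
  have h := key Finset.univ
  rw [Finset.card_univ, Fintype.card_fin] at h
  rwa [Finset.univ_sum_single] at h

theorem translate_translate (m x : Fin n → Fin 2) : x + m + m = x := by
  funext i
  simp only [Pi.add_apply]
  rw [add_assoc, fin_two_add_self, add_zero]

theorem exists_exp_eq {c : ℂ} (hc : ‖c‖ = 1) : ∃ α : ℝ, Complex.exp (α * Complex.I) = c :=
  ⟨c.arg, by simpa [hc] using Complex.norm_mul_exp_arg_mul_I c⟩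

theorem phaseAt_eq_diagonal {ι : Type*} [Fintype ι] [DecidableEq ι] (x : ι) (c : ℂ) :
    phaseAt x c = diagonal fun y => if y = x then c else 1 := by
  ext y z
  by_cases hyz : y = z
  · subst hyz
    by_cases hy : y = x
    · subst hy; simp [phaseAt, vecMulVec_apply]
    · simp [phaseAt, vecMulVec_apply, hy]
  · by_cases hy : y = x
    · subst hy; simp [phaseAt, vecMulVec_apply, hyz, Ne.symm hyz]
    · simp [phaseAt, vecMulVec_apply, hyz, hy]

theorem exists_generated_phaseAt (x : Fin n → Fin 2) {c : ℂ} (hc : ‖c‖ = 1) :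
    ∃ L, Generated n L (phaseAt x c) := by
  obtain ⟨α, rfl⟩ := exists_exp_eq hc
  -- Adding `x + 1` bitwise carries `x` to the all-ones string, where `phaseOn Finset.univ` acts.
  have ht := Generated.translate (x + 1)
  obtain ⟨L, hm⟩ := Exists.intro (p := fun L => Generated n L _) _
    ((ht.mul (Generated.phaseOn Finset.univ α)).mul ht)
  refine ⟨L, ?_⟩
  convert hm using 1
  rw [phaseOn, mapMatrix_conj_diagonal _ _ (translate_translate (x + 1)), phaseAt_eq_diagonal]
  congr 1
  funext y
  congr 1
  rw [eq_iff_iff, funext_iff]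
  simp only [Finset.mem_univ, true_imp_iff, Pi.add_apply, Pi.one_apply]
  refine forall_congr' fun i => ?_
  generalize y i = a
  generalize x i = b
  revert a b
  decide

/-- The Hadamard gate on `j` sends `e x` to a multiple of the difference of the two basis vectors,
so it conjugates a phase at `x` into the reflection. -/
theorem exists_generated_pairReflection_adjacent (x : Fin n → Fin 2) (j : Fin n) (hx : x j = 1)
    {c : ℂ} (hc : ‖c‖ = 1) : ∃ L, Generated n L (pairReflection (Function.update x j 0) x c) := by
  obtain ⟨L, hL⟩ := exists_generated_phaseAt x hc
  obtain ⟨L', hm⟩ := Exists.intro (p := fun L => Generated n L _) _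
    (((Generated.hadamardOn j).mul hL).mul (Generated.hadamardOn j))
  refine ⟨L', ?_⟩
  convert hm using 1
  have hne : x ≠ Function.update x j 0 := by
    intro h
    have := congrFun h j
    simp [hx] at this
  have e1 : ∀ a : Fin n → Fin 2, hadamardOn j a x = ((Real.sqrt 2 : ℝ) : ℂ)⁻¹ *
      (Pi.single (Function.update x j 0) 1 - Pi.single x 1 : (Fin n → Fin 2) → ℂ) a := by
    intro a
    rw [hadamardOn_apply]
    by_cases ha : ∀ q, q ≠ j → a q = x q
    · rw [if_pos ha]
      rcases fin_two_cases (a j) with h | h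
      · have : a = Function.update x j 0 := by
          funext q
          by_cases hq : q = j
          · subst hq; simp [h]
          · simp [hq, ha q hq]
        subst this
        simp [hne]
      · have : a = x := by
          funext q
          by_cases hq : q = j
          · subst hq; simp [h, hx]
          · simp [ha q hq]
        subst this
        simp [hne, hx]
    · have h1 : a ≠ x := by rintro rfl; simp at ha
      have h2 : a ≠ Function.update x j 0 := by rintro rfl; simp +contextual at ha
      simp [ha, h1, h2]
  have e2 : ∀ a : Fin n → Fin 2, hadamardOn j x a = hadamardOn j a x := by
    intro a
    rw [hadamardOn_apply, hadamardOn_apply]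
    simp only [eq_comm, and_comm]
  have h2 : ((Real.sqrt 2 : ℝ) : ℂ)⁻¹ * ((Real.sqrt 2 : ℝ) : ℂ)⁻¹ = 1 / 2 := by
    rw [← mul_inv, ← Complex.ofReal_mul, Real.mul_self_sqrt (by norm_num)]
    norm_num
  rw [phaseAt, mul_add, add_mul, mul_one, hadamardOn_mul_self, Matrix.mul_smul, Matrix.smul_mul,
    mul_vecMulVec, vecMulVec_mul, pairReflection]
  congr 1
  ext a b
  simp only [Matrix.smul_apply, vecMulVec_apply, mulVec_single_one, single_one_vecMul,
    Matrix.col_apply, Matrix.row_apply, e2, e1, smul_eq_mul]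
  linear_combination (-(c - 1) * (Pi.single (Function.update x j 0) 1 - Pi.single x 1 : (Fin n → Fin 2) → ℂ) a * (Pi.single (Function.update x j 0) 1 - Pi.single x 1 : (Fin n → Fin 2) → ℂ) b) * h2

theorem exists_generated_pairReflection_of_ne_at {x y : Fin n → Fin 2} (j : Fin n)
    (h : ∀ q, q ≠ j → x q = y q) (hxy : x ≠ y) {c : ℂ} (hc : ‖c‖ = 1) :
    ∃ L, Generated n L (pairReflection x y c) := by
  have hj : x j ≠ y j := fun h' => hxy (funext fun q => by
    by_cases hq : q = j
    · rw [hq, h']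
    · exact h q hq)
  rcases fin_two_cases (x j) with h0 | h0
  · have h1 : y j = 1 := (fin_two_cases (y j)).resolve_left fun h' => hj (h0.trans h'.symm)
    have : x = Function.update y j 0 := by
      funext q
      by_cases hq : q = j
      · subst hq; simp [h0]
      · simp [hq, h q hq]
    rw [this]
    exact exists_generated_pairReflection_adjacent y j h1 hc
  · have h1 : y j = 0 := (fin_two_cases (y j)).resolve_right fun h' => hj (h0.trans h'.symm)
    have : y = Function.update x j 0 := by
      funext q
      by_cases hq : q = j
      · subst hq; simp [h1]
      · simp [hq, h q hq]
    rw [this, pairReflection_comm]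
    exact exists_generated_pairReflection_adjacent x j h0 hc

/-- Walk from `x` to `y` along edges of the hypercube, transporting the reflection by
`pairReflection_conj`. -/
theorem exists_generated_pairReflection {x y : Fin n → Fin 2} (hxy : x ≠ y) {c : ℂ} (hc : ‖c‖ = 1) :
    ∃ L, Generated n L (pairReflection x y c) := by
  have key : ∀ (D : Finset (Fin n)) (x y : Fin n → Fin 2), (∀ q ∉ D, x q = y q) → x ≠ y →
      ∃ L, Generated n L (pairReflection x y c) := by
    intro D
    induction D using Finset.induction_on with
    | empty => intro x y h hne; exact absurd (funext fun q => h q (by simp)) hne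
    | insert j D hj ih =>
      intro x y h hne
      set y' := Function.update y j (x j) with hy'
      have h1 : ∀ q ∉ D, x q = y' q := by
        intro q hq
        by_cases hqj : q = j
        · subst hqj; simp [hy']
        · rw [hy', Function.update_of_ne hqj]
          exact h q (by simp [hqj, hq])
      have h2 : ∀ q, q ≠ j → y' q = y q := by
        intro q hq
        rw [hy', Function.update_of_ne hq]
      by_cases hyy : y' = y
      · rw [hyy] at h1; exact ih x y h1 hne
      by_cases hxy' : x = y'
      · rw [← hxy'] at h2
        exact exists_generated_pairReflection_of_ne_at j h2 hne hc
      · obtain ⟨L, hL⟩ := ih x y' h1 hxy'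
        obtain ⟨L', hL'⟩ := exists_generated_pairReflection_of_ne_at (c := -1) j h2 hyy (by simp)
        exact ⟨_, pairReflection_conj hxy' hyy hne c ▸ (hL'.mul hL).mul hL'⟩
  exact key Finset.univ x y (by simp) hxy

/-- Every unitary operator on `n` qubits is generated. -/
theorem exists_generated {V : Op n} (hV : V ∈ unitary (Op n)) : ∃ L, Generated n L V := by
  let S : Submonoid (Op n) :=
    { carrier := {V | ∃ L, Generated n L V}
      one_mem' := ⟨0, Generated.one⟩
      mul_mem' := by
        rintro a b ⟨L, hL⟩ ⟨L', hL'⟩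
        exact ⟨_, hL.mul hL'⟩ }
  have : V ∈ S := mem_of_mem_unitary S (fun x c hc => exists_generated_phaseAt x hc)
    (fun x y c hxy hc => exists_generated_pairReflection hxy hc)
    (fun g ⟨L, hg⟩ => hg.mem_unitary) (fun g ⟨L, hg⟩ => ⟨L, hg.star⟩) hV
  exact this

end qubits

end PolyLocal

end

/-! ### Binary expansions and shifts by multiples of `2 ^ l`. -/

section

open scoped Matrix.Norms.L2Operator
open Matrix

namespace PolyLocal

/-- The number whose binary expansion is `x`. -/
def binVal {n : ℕ} (x : Fin n → Fin 2) : ℕ := finFunctionFinEquiv x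

theorem binVal_lt {n : ℕ} (x : Fin n → Fin 2) : binVal x < 2 ^ n := (finFunctionFinEquiv x).2

theorem binVal_injective {n : ℕ} : Function.Injective (binVal (n := n)) :=
  fun _ _ h => finFunctionFinEquiv.injective (Fin.ext h)

/-- The binary expansion of the residue of `z` modulo `2 ^ n`. -/
def binOfInt (n : ℕ) (z : ℤ) : Fin n → Fin 2 :=
  finFunctionFinEquiv.symm ⟨(z % (2 ^ n : ℕ)).toNat, by
    have h1 := Int.emod_lt_of_pos z (b := ((2 ^ n : ℕ) : ℤ)) (by positivity)
    have h2 := Int.emod_nonneg z (b := ((2 ^ n : ℕ) : ℤ)) (by positivity)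
    omega⟩

theorem binVal_binOfInt (n : ℕ) (z : ℤ) : (binVal (binOfInt n z) : ℤ) = z % (2 ^ n : ℕ) := by
  have h2 := Int.emod_nonneg z (b := ((2 ^ n : ℕ) : ℤ)) (by positivity)
  simp only [binVal, binOfInt, Equiv.apply_symm_apply]
  omega

theorem binOfInt_eq_iff {n : ℕ} (z : ℤ) (x : Fin n → Fin 2) :
    binOfInt n z = x ↔ z ≡ binVal x [ZMOD (2 ^ n : ℕ)] := by
  have h1 := binVal_lt x
  have h3 : (binVal x : ℤ) % (2 ^ n : ℕ) = binVal x := by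
    apply Int.emod_eq_of_lt <;> omega
  rw [← binVal_injective.eq_iff, ← Nat.cast_inj (R := ℤ), binVal_binOfInt, Int.ModEq, h3]

theorem binOfInt_eq_binOfInt {n : ℕ} {z z' : ℤ} (h : z ≡ z' [ZMOD (2 ^ n : ℕ)]) :
    binOfInt n z = binOfInt n z' := by
  rw [binOfInt_eq_iff, binVal_binOfInt]
  exact h.trans (Int.mod_modEq _ _).symm

theorem binOfInt_binVal {n : ℕ} (x : Fin n → Fin 2) : binOfInt n (binVal x) = x := by
  rw [binOfInt_eq_iff]

/-- The bit `i`, extended by zero. -/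
def bitAt {n : ℕ} (x : Fin n → Fin 2) (i : ℕ) : ℕ := if h : i < n then (x ⟨i, h⟩ : ℕ) else 0

theorem binVal_eq_sum {n : ℕ} (x : Fin n → Fin 2) :
    binVal x = ∑ i ∈ Finset.range n, bitAt x i * 2 ^ i := by
  rw [binVal, finFunctionFinEquiv_apply, ← Fin.sum_univ_eq_sum_range fun i => bitAt x i * 2 ^ i]
  refine Finset.sum_congr rfl fun i _ => ?_
  simp [bitAt]

section low
variable {l n : ℕ} (hl : l ≤ n)

/-- The bits with index less than `l`. -/
def lowBits (x : Fin n → Fin 2) : Fin l → Fin 2 := fun a => x (Fin.castLEEmb hl a)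

theorem notMem_range_castLEEmb (q : Fin n) : q ∉ Set.range (Fin.castLEEmb hl) ↔ l ≤ q := by
  constructor
  · intro h
    by_contra hq
    exact h ⟨⟨q, by omega⟩, rfl⟩
  · rintro h ⟨a, rfl⟩
    have := a.2
    simp at h
    omega

theorem binVal_eq_low_add (x : Fin n → Fin 2) :
    binVal x = binVal (lowBits hl x) + 2 ^ l * ∑ i ∈ Finset.range (n - l), bitAt x (l + i) * 2 ^ i := by
  rw [binVal_eq_sum, binVal_eq_sum]
  nth_rewrite 1 [← Nat.add_sub_of_le hl]
  rw [Finset.sum_range_add, Finset.mul_sum]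
  congr 1
  · refine Finset.sum_congr rfl fun i hi => ?_
    have : i < l := Finset.mem_range.1 hi
    simp [bitAt, lowBits, this, this.trans_le hl]
  · refine Finset.sum_congr rfl fun i _ => ?_
    ring

theorem binVal_mod (x : Fin n → Fin 2) : binVal x % 2 ^ l = binVal (lowBits hl x) := by
  rw [binVal_eq_low_add hl, Nat.add_mul_mod_self_left, Nat.mod_eq_of_lt (binVal_lt _)]

theorem binVal_div_eq_of_high (hl : l ≤ n) {x y : Fin n → Fin 2} (h : ∀ q : Fin n, l ≤ q → x q = y q) :
    binVal x / 2 ^ l = binVal y / 2 ^ l := by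
  have hp : 0 < 2 ^ l := by positivity
  rw [binVal_eq_low_add hl x, binVal_eq_low_add hl y, Nat.add_mul_div_left _ _ hp,
    Nat.add_mul_div_left _ _ hp, Nat.div_eq_of_lt (binVal_lt _), Nat.div_eq_of_lt (binVal_lt _)]
  congr 1
  refine Finset.sum_congr rfl fun i hi => ?_
  have : l + i < n := by have := Finset.mem_range.1 hi; omega
  simp [bitAt, this, h]

theorem high_eq_iff (x y : Fin n → Fin 2) :
    (∀ q : Fin n, q ∉ Set.range (Fin.castLEEmb hl) → x q = y q) ↔
      binVal x / 2 ^ l = binVal y / 2 ^ l := by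
  simp only [notMem_range_castLEEmb]
  refine ⟨binVal_div_eq_of_high hl, fun h => ?_⟩
  set y' : Fin n → Fin 2 := fun q => if (q : ℕ) < l then x q else y q with hy'
  have h1 : binVal y' / 2 ^ l = binVal y / 2 ^ l :=
    binVal_div_eq_of_high hl fun q hq => by simp [hy', not_lt.2 hq]
  have h2 : lowBits hl y' = lowBits hl x := by
    funext a
    simp [lowBits, hy']
  have h3 : binVal y' = binVal x := by
    rw [← Nat.div_add_mod (binVal y') (2 ^ l), ← Nat.div_add_mod (binVal x) (2 ^ l), h1, h,
      binVal_mod hl, binVal_mod hl, h2]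
  intro q hq
  rw [← binVal_injective h3]
  simp [hy', not_lt.2 hq]

theorem lowBits_eq_iff (x y : Fin n → Fin 2) :
    lowBits hl x = lowBits hl y ↔ (binVal x : ℤ) ≡ binVal y [ZMOD (2 ^ l : ℕ)] := by
  rw [← binVal_injective.eq_iff, ← binVal_mod hl, ← binVal_mod hl, Int.natCast_modEq_iff]
  rfl

variable (l) in
/-- Add `e * 2 ^ l` modulo `2 ^ n`. -/
def shiftBy (e : ℤ) (x : Fin n → Fin 2) : Fin n → Fin 2 := binOfInt n (binVal x + e * 2 ^ l)

theorem binVal_shiftBy (e : ℤ) (x : Fin n → Fin 2) :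
    (binVal (shiftBy l e x) : ℤ) ≡ binVal x + e * 2 ^ l [ZMOD (2 ^ n : ℕ)] := by
  rw [shiftBy, binVal_binOfInt]
  exact Int.mod_modEq _ _

theorem shiftBy_shiftBy (e e' : ℤ) (x : Fin n → Fin 2) :
    shiftBy l e (shiftBy l e' x) = shiftBy l (e + e') x := by
  have := binVal_shiftBy (l := l) e' x
  apply binOfInt_eq_binOfInt
  refine (Int.ModEq.add_right _ this).trans ?_
  rw [add_mul, add_assoc, add_comm (e * _)]

theorem shiftBy_zero (x : Fin n → Fin 2) : shiftBy l 0 x = x := by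
  rw [shiftBy, zero_mul, add_zero, binOfInt_binVal]

theorem shiftBy_eq_iff (e : ℤ) (x y : Fin n → Fin 2) :
    x = shiftBy l e y ↔ (binVal x : ℤ) ≡ binVal y + e * 2 ^ l [ZMOD (2 ^ n : ℕ)] := by
  rw [eq_comm, shiftBy, binOfInt_eq_iff]
  exact ⟨Int.ModEq.symm, Int.ModEq.symm⟩

theorem lowBits_shiftBy (e : ℤ) (x : Fin n → Fin 2) :
    lowBits hl (shiftBy l e x) = lowBits hl x := by
  rw [lowBits_eq_iff]
  refine ((binVal_shiftBy e x).of_dvd ?_).trans ?_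
  · exact_mod_cast pow_dvd_pow 2 hl
  · have : e * 2 ^ l ≡ 0 [ZMOD (2 ^ l : ℕ)] := by
      rw [Int.modEq_zero_iff_dvd]
      exact ⟨e, by push_cast; ring⟩
    simpa using this.add_left (binVal x : ℤ)

theorem mapMatrix_shiftBy_mul (e e' : ℤ) : mapMatrix (n := n) (shiftBy l e) * mapMatrix (shiftBy l e') =
    mapMatrix (shiftBy l (e + e')) := by
  rw [mapMatrix_mul_mapMatrix]
  congr 1
  funext x
  exact shiftBy_shiftBy e e' x

theorem mapMatrix_shiftBy_pow (e : ℤ) (d : ℕ) : mapMatrix (n := n) (shiftBy l e) ^ d =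
    mapMatrix (shiftBy l (d * e)) := by
  induction d with
  | zero =>
    rw [pow_zero, ← mapMatrix_id]
    congr 1
    funext x
    simp [shiftBy_zero]
  | succ d ih =>
    rw [pow_succ, ih, mapMatrix_shiftBy_mul]
    congr 2
    push_cast
    ring

variable (l) in
-- Adding a multiple of `2 ^ l` changes the high bits only, and by a rule independent of the low
-- bits. This lets the blocks be treated as coefficients of polynomials in a central variable.
theorem place_mul_shiftBy_comm (w : Op l) :
    mapMatrix (shiftBy l (-1)) * place (Fin.castLEEmb hl) w =
      place (Fin.castLEEmb hl) w * mapMatrix (shiftBy l (-1)) := by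
  ext x y
  rw [mul_mapMatrix_apply, Matrix.mul_apply,
    Finset.sum_eq_single (shiftBy l 1 x)]
  · rw [mapMatrix_apply, if_pos, one_mul, place_apply, place_apply]
    · simp only [high_eq_iff]
      have e1 : ∀ z : Fin n → Fin 2, (fun a => z (Fin.castLEEmb hl a)) = lowBits hl z := fun z => rfl
      have e2 : binVal (shiftBy l 1 x) / 2 ^ l = binVal y / 2 ^ l ↔
          binVal x / 2 ^ l = binVal (shiftBy l (-1) y) / 2 ^ l := by
        -- Equal quotients stay equal under a shift: `2 ^ l` times the quotient is the number minus
        -- its unchanged low part, so the shifted values agree modulo `2 ^ n`, and both lie below `2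
        -- ^ n`.
        have key : ∀ (e : ℤ) (z w : Fin n → Fin 2), binVal z / 2 ^ l = binVal w / 2 ^ l →
            binVal (shiftBy l e z) / 2 ^ l = binVal (shiftBy l e w) / 2 ^ l := by
          intro e z w h
          have hz := Nat.div_add_mod (binVal z) (2 ^ l)
          have hw := Nat.div_add_mod (binVal w) (2 ^ l)
          rw [binVal_mod hl] at hz hw
          have hz' := Nat.div_add_mod (binVal (shiftBy l e z)) (2 ^ l)
          have hw' := Nat.div_add_mod (binVal (shiftBy l e w)) (2 ^ l)
          rw [binVal_mod hl, lowBits_shiftBy] at hz' hw'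
          have h1 := binVal_shiftBy (l := l) e z
          have h2 := binVal_shiftBy (l := l) e w
          have h3 : (2 ^ l * (binVal (shiftBy l e z) / 2 ^ l) : ℤ) ≡
              2 ^ l * (binVal (shiftBy l e w) / 2 ^ l) [ZMOD (2 ^ n : ℕ)] := by
            have f1 : (2 ^ l * (binVal (shiftBy l e z) / 2 ^ l) : ℤ) =
                binVal (shiftBy l e z) - binVal (lowBits hl z) := by
              rw [eq_sub_iff_add_eq]; exact_mod_cast hz'
            have f2 : (2 ^ l * (binVal (shiftBy l e w) / 2 ^ l) : ℤ) =
                binVal (shiftBy l e w) - binVal (lowBits hl w) := by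
              rw [eq_sub_iff_add_eq]; exact_mod_cast hw'
            rw [f1, f2]
            refine (h1.sub_right _).trans (Int.ModEq.trans ?_ (h2.sub_right _).symm)
            rw [← hz, ← hw, h]
            push_cast
            ring_nf
            rfl
          have h4 : 2 ^ l * (binVal (shiftBy l e z) / 2 ^ l) ≡
              2 ^ l * (binVal (shiftBy l e w) / 2 ^ l) [MOD 2 ^ n] := by
            rw [← Int.natCast_modEq_iff]; exact_mod_cast h3
          have g1 := Nat.mul_div_le (binVal (shiftBy l e z)) (2 ^ l)
          have g2 := Nat.mul_div_le (binVal (shiftBy l e w)) (2 ^ l)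
          have g3 := binVal_lt (shiftBy l e z)
          have g4 := binVal_lt (shiftBy l e w)
          have h5 := Nat.ModEq.eq_of_lt_of_lt h4 (by omega) (by omega)
          exact Nat.eq_of_mul_eq_mul_left (by positivity) h5
        constructor
        · intro h
          have := key (-1) _ _ h
          rwa [shiftBy_shiftBy, neg_add_cancel, shiftBy_zero] at this
        · intro h
          have := key 1 _ _ h
          rwa [shiftBy_shiftBy, add_neg_cancel, shiftBy_zero] at this
      simp only [e1, e2, lowBits_shiftBy]
    · rw [shiftBy_shiftBy, neg_add_cancel, shiftBy_zero]
  · intro z _ hz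
    rw [mapMatrix_apply, if_neg, zero_mul]
    rintro rfl
    apply hz
    rw [shiftBy_shiftBy, add_neg_cancel, shiftBy_zero]
  · simp

end low

/-! ### Increments of the high bits, triggered by the low bits. -/

section increment
variable {n : ℕ}

/-- Add with carry `1` from the bit `m` on when all the lower bits agree with `r`. -/
def carryAdd (m : ℕ) (r x : Fin n → Fin 2) : Fin n → Fin 2 := fun i =>
  if m ≤ i then x i + (if ∀ j < i, x j = r j then 1 else 0) else x i

/-- Higher bits are processed before lower ones, because the lower bits serve as controls and must
still hold their old values. -/
theorem carryAdd_succ_step {m : ℕ} (hm : m < n) :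
    carryAdd m 1 = ctrlFlip (Finset.Iio (⟨m, hm⟩ : Fin n)) ⟨m, hm⟩ ∘ carryAdd (m + 1) (1 : Fin n → Fin 2) := by
  funext x i
  have h0 : ∀ j : Fin n, (j : ℕ) ≤ m → carryAdd (m + 1) 1 x j = x j := by
    intro j hj
    rw [carryAdd, if_neg (by omega)]
  by_cases hi : i = ⟨m, hm⟩
  · subst hi
    rw [Function.comp, ctrlFlip_same, h0 _ le_rfl]
    have : (∀ j ∈ Finset.Iio (⟨m, hm⟩ : Fin n), carryAdd (m + 1) 1 x j = 1) ↔
        ∀ j < (⟨m, hm⟩ : Fin n), x j = (1 : Fin n → Fin 2) j := by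
      simp only [Finset.mem_Iio, Pi.one_apply]
      refine forall₂_congr fun j hj => ?_
      rw [h0 j (le_of_lt hj)]
    simp only [this]
    simp [carryAdd]
  · rw [Function.comp, ctrlFlip_of_ne _ hi]
    have hi' : (i : ℕ) ≠ m := fun h => hi (Fin.ext h)
    simp only [carryAdd]
    have : m ≤ (i : ℕ) ↔ m + 1 ≤ (i : ℕ) := by omega
    simp only [this]

theorem Generated.carryAdd_one (m : ℕ) (hm : m ≤ n) :
    Generated n ((n - m) * (n * (14 * n ^ 4 + 4) + 2)) (mapMatrix (carryAdd m (1 : Fin n → Fin 2))) := by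
  induction hm using Nat.decreasingInduction with
  | self =>
    have : carryAdd n (1 : Fin n → Fin 2) = fun x => x := by
      funext x i
      rw [carryAdd, if_neg (by omega)]
    rw [this, mapMatrix_id]
    exact Generated.one.mono (by simp)
  | of_succ m hm ih =>
    have hm' : m < n := hm
    rw [carryAdd_succ_step hm', ← mapMatrix_mul_mapMatrix]
    refine ((Generated.ctrlFlip (by simp)).mul ih).mono ?_
    have : n - m = (n - (m + 1)) + 1 := by omega
    rw [this, add_mul, one_mul, add_comm]

theorem Generated.carryAdd {m : ℕ} (hm : m ≤ n) (r : Fin n → Fin 2) :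
    Generated n (n * (n * (14 * n ^ 4 + 4) + 2) + 2 * n) (mapMatrix (carryAdd m r)) := by
  -- Translation by `r + 1` turns agreement with `r` into agreement with all ones.
  have h := ((Generated.translate (r + 1)).mul (Generated.carryAdd_one m hm)).mul
    (Generated.translate (r + 1))
  rw [mapMatrix_mul_mapMatrix, mapMatrix_mul_mapMatrix] at h
  have e : ((fun x => x + (r + 1)) ∘ PolyLocal.carryAdd m 1) ∘ (fun x => x + (r + 1)) =
      PolyLocal.carryAdd m r := by
    funext x i
    simp only [Function.comp, PolyLocal.carryAdd, Pi.add_apply, Pi.one_apply]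
    have e1 : ∀ j, x j + (r j + 1) = 1 ↔ x j = r j := by
      intro j
      generalize x j = a
      generalize r j = b
      revert a b
      decide
    simp only [e1]
    have e2 : ∀ a b c : Fin 2, a + b + c + b = a + c := by decide
    have e3 : ∀ a b : Fin 2, a + b + b = a := by decide
    split_ifs
    · rw [e2]
    · rw [e2]
    · rw [e3]
  rw [e] at h
  refine h.mono ?_
  have : (n - m) * (n * (14 * n ^ 4 + 4) + 2) ≤ n * (n * (14 * n ^ 4 + 4) + 2) :=
    Nat.mul_le_mul_right _ (Nat.sub_le _ _)
  omega

/-- The invariant of ripple-carry addition: the new low part plus the outgoing carry at `m` equals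
the old low part plus the carry fed in at `l`. -/
theorem sum_carryAdd {l : ℕ} {r : Fin n → Fin 2} (hr : ∀ i : Fin n, l ≤ i → r i = 1)
    (x : Fin n → Fin 2) {m : ℕ} (hlm : l ≤ m) (hmn : m ≤ n) :
    (∑ i ∈ Finset.range m, bitAt (carryAdd l r x) i * 2 ^ i) +
        (if ∀ j : Fin n, (j : ℕ) < m → x j = r j then 2 ^ m else 0) =
      (∑ i ∈ Finset.range m, bitAt x i * 2 ^ i) +
        (if ∀ j : Fin n, (j : ℕ) < l → x j = r j then 2 ^ l else 0) := by
  induction m, hlm using Nat.le_induction with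
  | base =>
    congr 1
    refine Finset.sum_congr rfl fun i hi => ?_
    have : ¬ l ≤ i := by have := Finset.mem_range.1 hi; omega
    simp [bitAt, carryAdd, this]
  | succ m hlm ih =>
    have ih := ih (by omega)
    have hm : m < n := hmn
    rw [Finset.sum_range_succ, Finset.sum_range_succ]
    have e1 : bitAt x m = (x ⟨m, hm⟩ : ℕ) := by simp [bitAt, hm]
    have e2 : bitAt (carryAdd l r x) m =
        ((x ⟨m, hm⟩ + (if ∀ j : Fin n, (j : ℕ) < m → x j = r j then 1 else 0) : Fin 2) : ℕ) := by
      simp [bitAt, hm, carryAdd, hlm, Fin.lt_def]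
    have e3 : (∀ j : Fin n, (j : ℕ) < m + 1 → x j = r j) ↔
        ((∀ j : Fin n, (j : ℕ) < m → x j = r j) ∧ x ⟨m, hm⟩ = 1) := by
      rw [← hr ⟨m, hm⟩ hlm]
      constructor
      · exact fun h => ⟨fun j hj => h j (by omega), h ⟨m, hm⟩ (by simp)⟩
      · rintro ⟨h1, h2⟩ j hj
        by_cases hjm : (j : ℕ) = m
        · have : j = ⟨m, hm⟩ := Fin.ext hjm
          rw [this, h2]
        · exact h1 j (by omega)
    rw [e1, e2]
    simp only [e3]
    by_cases hc : ∀ j : Fin n, (j : ℕ) < m → x j = r j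
    · simp only [eq_true hc, if_true, true_and] at ih ⊢
      rcases fin_two_cases (x ⟨m, hm⟩) with h | h
      · simp [h]
        omega
      · simp [h, fin_two_add_self, pow_succ]
        omega
    · simp only [eq_false hc, if_false, false_and] at ih ⊢
      simp only [add_zero] at ih ⊢
      omega

variable {l : ℕ} (hl : l ≤ n)

/-- Add `2 ^ l` modulo `2 ^ n` when the low bits belong to `E`. -/
def incOn (E : Finset (Fin l → Fin 2)) (x : Fin n → Fin 2) : Fin n → Fin 2 :=
  if lowBits hl x ∈ E then shiftBy l 1 x else x

/-- At `m = n` the outgoing carry in `sum_carryAdd` is `2 ^ n`, which vanishes modulo `2 ^ n`. -/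
theorem carryAdd_eq_incOn (r : Fin l → Fin 2) :
    carryAdd l (fun i : Fin n => if h : (i : ℕ) < l then r ⟨i, h⟩ else 1) = incOn hl {r} := by
  funext x
  set r' : Fin n → Fin 2 := fun i => if h : (i : ℕ) < l then r ⟨i, h⟩ else 1 with hr'
  have h := sum_carryAdd (l := l) (r := r') (fun i hi => by simp [hr', not_lt.2 hi]) x hl le_rfl
  rw [← binVal_eq_sum, ← binVal_eq_sum] at h
  have e : (∀ j : Fin n, (j : ℕ) < l → x j = r' j) ↔ lowBits hl x = r := by
    rw [funext_iff]
    constructor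
    · intro h a
      have := h (Fin.castLE hl a) a.2
      simpa [hr', lowBits] using this
    · intro h j hj
      have := h ⟨j, hj⟩
      simpa [hr', hj, lowBits] using this
  simp only [e] at h
  have h' : (binVal (carryAdd l r' x) : ℤ) ≡ binVal x + (if lowBits hl x = r then 2 ^ l else 0)
      [ZMOD (2 ^ n : ℕ)] := by
    have h2 : ((if ∀ j : Fin n, (j : ℕ) < n → x j = r' j then 2 ^ n else 0 : ℕ) : ℤ) ≡ 0
        [ZMOD (2 ^ n : ℕ)] := by
      split_ifs
      · exact Int.emod_self
      · rfl
    have h3 := (Int.ModEq.refl (n := ((2 ^ n : ℕ) : ℤ)) (binVal (carryAdd l r' x) : ℤ)).add h2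
    rw [add_zero] at h3
    refine h3.symm.trans ?_
    rw [← Nat.cast_add, h]
    push_cast
    rfl
  rw [incOn]
  simp only [Finset.mem_singleton]
  split_ifs with hx
  · rw [if_pos hx] at h'
    rw [shiftBy_eq_iff, one_mul]
    exact h'
  · rw [if_neg hx, add_zero] at h'
    rw [← binOfInt_binVal (carryAdd l r' x), binOfInt_eq_iff]
    exact h'

/-- A shift preserves the low bits, so the increments for the single elements of `E` are triggered
independently and may be composed. -/
theorem Generated.incOn (E : Finset (Fin l → Fin 2)) :
    Generated n (E.card * (n * (n * (14 * n ^ 4 + 4) + 2) + 2 * n)) (mapMatrix (incOn hl E)) := by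
  induction E using Finset.induction_on with
  | empty =>
    have : PolyLocal.incOn hl ∅ = fun x => x := by
      funext x
      simp [PolyLocal.incOn]
    rw [this, mapMatrix_id]
    exact Generated.one.mono (by simp)
  | insert r E hr ih =>
    have h1 := Generated.carryAdd hl (fun i : Fin n => if h : (i : ℕ) < l then r ⟨i, h⟩ else 1)
    rw [carryAdd_eq_incOn hl] at h1
    have h2 := h1.mul ih
    rw [mapMatrix_mul_mapMatrix] at h2
    have e : PolyLocal.incOn hl {r} ∘ PolyLocal.incOn hl E = PolyLocal.incOn hl (insert r E) := by
      funext x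
      simp only [Function.comp, PolyLocal.incOn, Finset.mem_singleton, Finset.mem_insert]
      by_cases h1 : lowBits hl x ∈ E
      · have : lowBits hl x ≠ r := fun h => hr (h ▸ h1)
        simp [h1, lowBits_shiftBy, this]
      · simp [h1]
    rw [e] at h2
    refine h2.mono ?_
    rw [Finset.card_insert_of_notMem hr, add_mul, one_mul, add_comm]

/-- The partial shift `1 - P + P T`, for the projection `P` onto the low bits in `E`. -/
theorem star_mapMatrix_incOn (E : Finset (Fin l → Fin 2)) :
    star (mapMatrix (incOn hl E)) =
      place (Fin.castLEEmb hl) (1 - diagonal fun r => if r ∈ E then 1 else 0) +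
        place (Fin.castLEEmb hl) (diagonal fun r => if r ∈ E then 1 else 0) *
          mapMatrix (shiftBy l (-1)) := by
  have hd : ∀ d : (Fin l → Fin 2) → ℂ, place (Fin.castLEEmb hl) (diagonal d) =
      diagonal fun x => d (lowBits hl x) := by
    intro d
    ext x y
    rw [place_apply, diagonal_apply, diagonal_apply]
    by_cases hxy : x = y
    · subst hxy
      simp only [implies_true, if_true]
      rfl
    · rw [if_neg hxy]
      split_ifs with h1 h2
      · exfalso
        apply hxy
        funext q
        by_cases hq : q ∈ Set.range (Fin.castLEEmb hl)
        · obtain ⟨a, rfl⟩ := hq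
          exact congrFun h2 a
        · exact h1 q hq
      · rfl
      · rfl
  rw [map_sub, map_one, hd]
  ext x y
  rw [star_apply, mapMatrix_apply, Matrix.add_apply, mul_mapMatrix_apply, Matrix.sub_apply,
    diagonal_apply, diagonal_apply, one_apply]
  have e : y = shiftBy l 1 x ↔ x = shiftBy l (-1) y := by
    constructor
    · rintro rfl; rw [shiftBy_shiftBy, neg_add_cancel, shiftBy_zero]
    · rintro rfl; rw [shiftBy_shiftBy, add_neg_cancel, shiftBy_zero]
  by_cases hE : lowBits hl x ∈ E
  · simp only [incOn, hE, if_true, e]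
    split_ifs <;> simp
  · simp only [incOn, hE, if_false, eq_comm (a := y)]
    split_ifs <;> simp

end increment

end PolyLocal

end

/-! ### Factorization of matrix polynomials that are unitary on the circle. -/

section

open scoped Matrix.Norms.L2Operator
open Matrix

namespace PolyLocal

open scoped ComplexOrder in
/-- The projection onto the kernel of a matrix, in diagonal form. -/
theorem exists_kernel_projection {ι : Type*} [Fintype ι] [DecidableEq ι] (A : Matrix ι ι ℂ) :
    ∃ (V P : Matrix ι ι ℂ) (E : Finset ι), V ∈ unitary (Matrix ι ι ℂ) ∧
      P = V * (diagonal fun i => if i ∈ E then 1 else 0) * star V ∧ A * P = 0 ∧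
      ∀ B : Matrix ι ι ℂ, A * B = 0 → P * B = B := by
  -- `A` and `Aᴴ * A` have the same kernel, and the latter is diagonalized by a unitary; `E`
  -- collects its zero eigenvalues.
  have hH : (Aᴴ * A).IsHermitian := isHermitian_conjTranspose_mul_self A
  set V : Matrix ι ι ℂ := (hH.eigenvectorUnitary : Matrix ι ι ℂ) with hV
  have hVu : V ∈ unitary (Matrix ι ι ℂ) := hH.eigenvectorUnitary.2
  obtain ⟨hV1, hV2⟩ := Unitary.mem_iff.1 hVu
  have hspec : Aᴴ * A = V * diagonal (RCLike.ofReal ∘ hH.eigenvalues) * star V := by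
    conv_lhs => rw [hH.spectral_theorem]
    rw [Unitary.conjStarAlgAut_apply]
  set E : Finset ι := Finset.univ.filter fun i => hH.eigenvalues i = 0 with hE
  set d : ι → ℂ := fun i => if i ∈ E then 1 else 0 with hd
  refine ⟨V, V * diagonal d * star V, E, hVu, rfl, ?_, ?_⟩
  · have h1 : Aᴴ * A * (V * diagonal d * star V) = 0 := by
      rw [hspec]
      have : V * diagonal (RCLike.ofReal ∘ hH.eigenvalues) * star V * (V * diagonal d * star V) =
          V * diagonal (RCLike.ofReal ∘ hH.eigenvalues) * (star V * V) * diagonal d * star V := by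
        simp only [mul_assoc]
      rw [this, hV1, mul_one, mul_assoc V, diagonal_mul_diagonal]
      have hz : (fun i => (RCLike.ofReal ∘ hH.eigenvalues) i * d i : ι → ℂ) = 0 := by
        funext i
        by_cases hi : hH.eigenvalues i = 0 <;> simp [hd, hE, hi]
      rw [hz]
      simp
    have h2 : (A * (V * diagonal d * star V))ᴴ * (A * (V * diagonal d * star V)) = 0 := by
      rw [conjTranspose_mul, mul_assoc, ← mul_assoc Aᴴ, h1, mul_zero]
    exact conjTranspose_mul_self_eq_zero.1 h2
  · intro B hB
    have h1 : diagonal (RCLike.ofReal ∘ hH.eigenvalues) * (star V * B) = 0 := by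
      have : star V * (Aᴴ * A) * B = 0 := by rw [mul_assoc, mul_assoc, hB, mul_zero, mul_zero]
      rw [hspec] at this
      rw [← this, ← mul_assoc, ← mul_assoc, ← mul_assoc, hV1, one_mul]
    have h2 : diagonal d * (star V * B) = star V * B := by
      ext i j
      have := congrFun (congrFun h1 i) j
      rw [diagonal_mul] at this ⊢
      by_cases hi : hH.eigenvalues i = 0
      · simp [hd, hE, hi]
      · have h0 : (star V * B) i j = 0 := by
          simpa [hi] using this
        rw [h0, mul_zero]
    rw [mul_assoc, mul_assoc, h2, ← mul_assoc, hV2, one_mul]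

section factorization
variable {l : ℕ}

/-- The number of gates that suffices for one elementary shift. -/
def shiftCost (n : ℕ) : ℕ := n * (n * (14 * n ^ 4 + 4) + 2) + 2 * n + 1

/-- In the eigenbasis of `P` the operator is the inverse of `incOn hl E`; the change of basis `V`
commutes with the shift. `L` is chosen before `n`, since `V` lives on `l` qubits. -/
theorem Generated.partialShift {V P : Op l} {E : Finset (Fin l → Fin 2)} (hV : V ∈ unitary (Op l))
    (hP : P = V * (diagonal fun i => if i ∈ E then 1 else 0) * Star.star V) :
    ∃ L, ∀ (n : ℕ) (hl : l ≤ n), Generated n (L * shiftCost n)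
      (PolyLocal.place (Fin.castLEEmb hl) (1 - P) +
        PolyLocal.place (Fin.castLEEmb hl) P * mapMatrix (shiftBy l (-1))) := by
  obtain ⟨L, hL⟩ := exists_generated hV
  refine ⟨2 * L + E.card, fun n hl => ?_⟩
  have h1 := (Generated.incOn hl E).star
  rw [star_mapMatrix_incOn] at h1
  have h2 := ((hL.place (Fin.castLEEmb hl)).mul h1).mul (hL.star.place (Fin.castLEEmb hl))
  set Q : Op l := diagonal fun i => if i ∈ E then 1 else 0 with hQ
  have hV2 := (Unitary.mem_iff.1 hV).2
  have e : PolyLocal.place (Fin.castLEEmb hl) V * (PolyLocal.place (Fin.castLEEmb hl) (1 - Q) +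
      PolyLocal.place (Fin.castLEEmb hl) Q * mapMatrix (shiftBy l (-1))) *
        PolyLocal.place (Fin.castLEEmb hl) (Star.star V) =
      PolyLocal.place (Fin.castLEEmb hl) (1 - P) +
        PolyLocal.place (Fin.castLEEmb hl) P * mapMatrix (shiftBy l (-1)) := by
    have hc := place_mul_shiftBy_comm l hl (Star.star V)
    rw [mul_add, add_mul]
    simp only [mul_assoc, hc]
    simp only [← mul_assoc, ← map_mul, ← hP]
    congr 2
    rw [mul_sub, sub_mul, mul_one, hV2, ← hP]
  rw [e] at h2
  refine h2.mono ?_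
  unfold shiftCost
  set c := n * (n * (14 * n ^ 4 + 4) + 2) + 2 * n
  nlinarith [Nat.zero_le (L * c)]

/-- The second hypothesis says `U(z) * star (U(z)) = 1` on `|z| = 1`, coefficient by coefficient.
Dividing on the right by `1 - P + P z`, with `P` the projection onto the kernel of `U 0`, preserves
it. The division creates no term of degree `-1` because `U 0 * P = 0`, and it removes the top term
because `U (D + 1) * (1 - P) = 0`. -/
theorem exists_generated_of_correlation (D : ℕ) : ∀ (U : ℕ → Op l), (∀ d, D < d → U d = 0) →
    (∀ e : ℕ, ∑ d ∈ Finset.range (D + 1), U d * star (U (d + e)) = if e = 0 then 1 else 0) →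
    ∃ L, ∀ (n : ℕ) (hl : l ≤ n), Generated n (L * shiftCost n)
      (∑ d ∈ Finset.range (D + 1), place (Fin.castLEEmb hl) (U d) * mapMatrix (shiftBy l (-1)) ^ d) := by
  induction D with
  | zero =>
    intro U _ hcorr
    have h0 := hcorr 0
    simp only [zero_add, Finset.range_one, Finset.sum_singleton, if_true] at h0
    have hU : U 0 ∈ unitary (Op l) := Unitary.mem_iff.2 ⟨mul_eq_one_comm.1 h0, h0⟩
    obtain ⟨L, hL⟩ := exists_generated hU
    refine ⟨L, fun n hl => ?_⟩
    simp only [zero_add, Finset.range_one, Finset.sum_singleton, pow_zero, mul_one]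
    refine (hL.place _).mono ?_
    unfold shiftCost
    nlinarith [Nat.zero_le (L * (n * (n * (14 * n ^ 4 + 4) + 2) + 2 * n))]
  | succ D ih =>
    intro U hU hcorr
    obtain ⟨V, P, E, hV, hP, hUP, hker⟩ := exists_kernel_projection (U 0)
    have hP1 : star P = P := by
      rw [hP, star_mul, star_mul, star_star, mul_assoc]
      congr 2
      rw [star_eq_conjTranspose, diagonal_conjTranspose]
      congr 1
      funext i
      simp only [Pi.star_apply]
      split_ifs <;> simp
    have hP2 : P * P = P := hker P hUP
    -- The correlation at distance `D + 1` has the single term `U 0 * star (U (D + 1))`, so the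
    -- range of `star (U (D + 1))` lies in the kernel of `U 0`.
    have hlast : U (D + 1) * P = U (D + 1) := by
      have h := hcorr (D + 1)
      rw [Finset.sum_range_succ', Finset.sum_eq_zero, zero_add, if_neg (by omega)] at h
      · rw [zero_add] at h
        have h2 := congrArg star (hker _ h)
        rwa [star_mul, star_star, hP1] at h2
      · intro d _
        rw [hU (d + 1 + (D + 1)) (by omega), star_zero, mul_zero]
    set Q := 1 - P with hQ
    have hQ1 : star Q = Q := by rw [hQ, star_sub, star_one, hP1]
    have hPQ : P * Q = 0 := by rw [hQ, mul_sub, mul_one, hP2, sub_self]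
    have hQP : Q * P = 0 := by rw [hQ, sub_mul, one_mul, hP2, sub_self]
    have hQ2 : Q * Q = Q := by rw [hQ, sub_mul, one_mul, ← hQ, hPQ, sub_zero]
    have hlastQ : U (D + 1) * Q = 0 := by rw [hQ, mul_sub, mul_one, hlast, sub_self]
    -- The coefficients of `U(z) * (Q + P z⁻¹)`.
    set U' : ℕ → Op l := fun d => U d * Q + U (d + 1) * P with hU'
    have hU'0 : ∀ d, D < d → U' d = 0 := by
      intro d hd
      have h1 : U (d + 1) = 0 := hU _ (by omega)
      rcases Nat.lt_or_ge (D + 1) d with h | h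
      · simp [hU', h1, hU d h]
      · have : d = D + 1 := by omega
        subst this
        simp [hU', h1, hlastQ]
    have hcorr' : ∀ e : ℕ, ∑ d ∈ Finset.range (D + 1), U' d * star (U' (d + e)) =
        if e = 0 then 1 else 0 := by
      intro e
      have hterm : ∀ d, U' d * star (U' (d + e)) =
          U d * Q * star (U (d + e)) + U (d + 1) * P * star (U (d + 1 + e)) := by
        intro d
        simp only [hU', star_add, star_mul, hQ1, hP1]
        have h1 : U d * Q * (Q * star (U (d + e))) = U d * Q * star (U (d + e)) := by
          rw [← mul_assoc, mul_assoc (U d), hQ2]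
        have h2 : U d * Q * (P * star (U (d + e + 1))) = 0 := by
          rw [← mul_assoc, mul_assoc (U d), hQP, mul_zero, zero_mul]
        have h3 : U (d + 1) * P * (Q * star (U (d + e))) = 0 := by
          rw [← mul_assoc, mul_assoc (U (d + 1)), hPQ, mul_zero, zero_mul]
        have h4 : U (d + 1) * P * (P * star (U (d + e + 1))) = U (d + 1) * P * star (U (d + 1 + e)) := by
          rw [← mul_assoc, mul_assoc (U (d + 1)), hP2, add_right_comm]
        rw [add_mul, mul_add, mul_add, h1, h2, h3, h4, add_zero, zero_add]
      rw [Finset.sum_congr rfl fun d _ => hterm d, Finset.sum_add_distrib, ← hcorr e]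
      have hsplit : ∀ d, U d * star (U (d + e)) = U d * Q * star (U (d + e)) +
          U d * P * star (U (d + e)) := by
        intro d
        rw [← add_mul, ← mul_add, hQ, sub_add_cancel, mul_one]
      rw [Finset.sum_congr rfl fun d _ => hsplit d, Finset.sum_add_distrib]
      congr 1
      · rw [Finset.sum_range_succ _ (D + 1), hlastQ, zero_mul, add_zero]
      · rw [Finset.sum_range_succ' _ (D + 1), hUP, zero_mul, add_zero]
    obtain ⟨L₁, hL₁⟩ := ih U' hU'0 hcorr'
    obtain ⟨L₂, hL₂⟩ := Generated.partialShift hV hP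
    refine ⟨L₁ + L₂, fun n hl => ?_⟩
    have h := (hL₁ n hl).mul (hL₂ n hl)
    rw [← add_mul] at h
    set w := place (Fin.castLEEmb hl)
    set T : Op n := mapMatrix (shiftBy l (-1)) with hT
    have hcomm : ∀ (A : Op l) (d : ℕ), T ^ d * w A = w A * T ^ d := by
      intro A d
      exact (Commute.pow_left (place_mul_shiftBy_comm l hl A : Commute T (w A)) d)
    convert h using 1
    rw [Finset.sum_mul]
    have hterm : ∀ d, w (U' d) * T ^ d * (w (1 - P) + w P * T) =
        w (U d * Q) * T ^ d + w (U (d + 1) * P) * T ^ (d + 1) := by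
      intro d
      have h1 : U' d * Q = U d * Q := by
        rw [hU', add_mul, mul_assoc, hQ2, mul_assoc, hPQ, mul_zero, add_zero]
      have h2 : U' d * P = U (d + 1) * P := by
        rw [hU', add_mul, mul_assoc, hQP, mul_assoc, hP2, mul_zero, zero_add]
      rw [mul_add, mul_assoc, hcomm, ← mul_assoc, ← map_mul, h1, mul_assoc (w (U' d)),
        ← mul_assoc (T ^ d), hcomm, mul_assoc (w P), ← pow_succ, ← mul_assoc, ← map_mul, h2]
    rw [Finset.sum_congr rfl fun d _ => hterm d, Finset.sum_add_distrib]
    have hsplit : ∀ d, w (U d) * T ^ d = w (U d * Q) * T ^ d + w (U d * P) * T ^ d := by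
      intro d
      rw [← add_mul, ← map_add, ← mul_add, hQ, sub_add_cancel, mul_one]
    rw [Finset.sum_congr rfl fun d _ => hsplit d, Finset.sum_add_distrib]
    congr 1
    · rw [Finset.sum_range_succ _ (D + 1), hlastQ, map_zero, zero_mul, add_zero]
    · rw [Finset.sum_range_succ' _ (D + 1), hUP, map_zero, zero_mul, add_zero]

end factorization

end PolyLocal

end

/-! ### Unrolling a cyclic band matrix to an infinite periodic one. -/

section

open scoped Matrix.Norms.L2Operator
open Matrix

namespace PolyLocal

section unroll
variable {N : ℕ} [NeZero N]

/-- The residue of an integer as an element of `Fin N`. -/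
def residue (N : ℕ) [NeZero N] (z : ℤ) : Fin N :=
  ⟨(z % (N : ℤ)).toNat, by
    have h0 : (0 : ℤ) < N := by exact_mod_cast Nat.pos_of_ne_zero (NeZero.ne N)
    have h1 := Int.emod_lt_of_pos z h0
    have h2 := Int.emod_nonneg z h0.ne'
    omega⟩

theorem residue_val (z : ℤ) : ((residue N z : ℕ) : ℤ) = z % N := by
  have h0 : (0 : ℤ) < N := by exact_mod_cast Nat.pos_of_ne_zero (NeZero.ne N)
  have h2 := Int.emod_nonneg z h0.ne'
  simp only [residue]
  omega

theorem residue_modEq (z : ℤ) : ((residue N z : ℕ) : ℤ) ≡ z [ZMOD N] := by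
  rw [residue_val]
  exact Int.mod_modEq _ _

theorem residue_eq_iff (z : ℤ) (i : Fin N) : residue N z = i ↔ z ≡ (i : ℕ) [ZMOD N] := by
  have h := i.2
  have h3 : ((i : ℕ) : ℤ) % N = (i : ℕ) := by
    apply Int.emod_eq_of_lt <;> omega
  rw [Fin.ext_iff, ← Nat.cast_inj (R := ℤ), residue_val, Int.ModEq, h3]

theorem residue_eq_residue_iff (z z' : ℤ) : residue N z = residue N z' ↔ z ≡ z' [ZMOD N] := by
  rw [residue_eq_iff]
  exact ⟨fun h => h.trans (residue_modEq _), fun h => h.trans (residue_modEq _).symm⟩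

theorem eq_of_modEq_of_abs_lt {N a c : ℤ} (h : a ≡ c [ZMOD N]) (hlt : |a - c| < N) : a = c := by
  obtain ⟨t, ht⟩ := h.symm.dvd
  by_contra hne
  have h1 : a - c ≠ 0 := sub_ne_zero.2 hne
  have := Int.le_of_dvd (abs_pos.2 h1) ((dvd_abs _ _).2 ⟨t, ht⟩)
  omega

/-- The infinite banded matrix that locally looks like `B`. -/
noncomputable def unroll (b : ℕ) (B : Matrix (Fin N) (Fin N) ℂ) (i j : ℤ) : ℂ :=
  if |j - i| < b then B (residue N i) (residue N j) else 0

theorem unroll_add_mul {b k : ℕ} {B : Matrix (Fin N) (Fin N) ℂ} (hB : IsCyclicWithPeriod k B)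
    (i j e : ℤ) : unroll b B (i + e * k) (j + e * k) = unroll b B i j := by
  have step : ∀ i j : ℤ, unroll b B (i + k) (j + k) = unroll b B i j := by
    intro i j
    unfold unroll
    rw [add_sub_add_right_eq_sub]
    split_ifs
    · apply hB <;> rw [← Int.natCast_modEq_iff] <;> push_cast
      · exact (residue_modEq _).trans ((residue_modEq i).add_right _).symm
      · exact (residue_modEq _).trans ((residue_modEq j).add_right _).symm
    · rfl
  induction e using Int.induction_on with
  | zero => simp
  | succ e ih => rw [← ih, ← step (i + e * k)]; congr 1 <;> push_cast <;> ring
  | pred e ih => rw [← ih, ← step]; congr 1 <;> push_cast <;> ring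

/-- Rows at distance at least `2 * b` have disjoint supports. For closer rows the sum is an inner
product of rows of `B`, because reduction modulo `N` is injective on the window. -/
theorem sum_unroll_mul_star {b : ℕ} {B : Matrix (Fin N) (Fin N) ℂ}
    (hu : B ∈ Matrix.unitaryGroup (Fin N) ℂ) (hw : 4 * b < N) (hb : IsCyclicallyBanded b B)
    (i i' : ℤ) : ∑ j ∈ Finset.Ioo (i - b) (i + b), unroll b B i j * star (unroll b B i' j) =
      if i = i' then 1 else 0 := by
  have hmem : ∀ j : ℤ, j ∈ Finset.Ioo (i - b) (i + b) ↔ |j - i| < b := by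
    intro j
    rw [Finset.mem_Ioo, abs_lt]
    constructor <;> rintro ⟨h1, h2⟩ <;> constructor <;> omega
  by_cases hii : |i - i'| < 2 * b
  · have h1 := congrFun (congrFun (Unitary.mem_iff.1 hu).2 (residue N i)) (residue N i')
    rw [Matrix.mul_apply] at h1
    have h2 : ((1 : Matrix (Fin N) (Fin N) ℂ) (residue N i) (residue N i')) =
        if i = i' then 1 else 0 := by
      rw [Matrix.one_apply]
      congr 1
      rw [eq_iff_iff, residue_eq_residue_iff]
      exact ⟨fun h => eq_of_modEq_of_abs_lt h (by omega), fun h => h ▸ Int.ModEq.refl _⟩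
    rw [← h2, ← h1]
    refine Finset.sum_of_injOn (residue N) ?_ (by intro _ _; simp) ?_ ?_
    · intro x hx y hy hxy
      rw [Finset.mem_coe, hmem] at hx hy
      refine eq_of_modEq_of_abs_lt ((residue_eq_residue_iff _ _).1 hxy) ?_
      rw [abs_lt] at hx hy ⊢
      omega
    · intro J _ hJ
      by_contra hne
      obtain ⟨d, hd, hJd⟩ := hb _ _ (left_ne_zero_of_mul hne)
      apply hJ
      refine ⟨i + d, ?_, ?_⟩
      · rw [Finset.mem_coe, hmem]
        simpa using hd
      · rw [residue_eq_iff]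
        exact (hJd.trans ((residue_modEq i).add_right d)).symm
    · intro j hj
      rw [hmem] at hj
      have e1 : unroll b B i j = B (residue N i) (residue N j) := if_pos hj
      have e2 : unroll b B i' j = B (residue N i') (residue N j) := by
        unfold unroll
        split_ifs with h
        · rfl
        · by_contra hne
          obtain ⟨d, hd, hJd⟩ := hb _ _ (Ne.symm hne)
          have h3 : j ≡ i' + d [ZMOD N] :=
            (residue_modEq j).symm.trans (hJd.trans ((residue_modEq i').add_right d))
          -- The distance is below `b + 2 * b + b`, from `j` to `i`, `i` to `i'`, and the offset
          -- `d`; here the full strength of `4 * b < N` is needed.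
          have h4 := eq_of_modEq_of_abs_lt h3 (by rw [abs_lt] at *; omega)
          apply h
          rw [h4]
          simpa using hd
      rw [e1, e2, Matrix.star_apply]
  -- Needed to exclude `i = i'`; an empty band would make `B` zero.
  · have hb0 : 0 < b := by
      rcases Nat.eq_zero_or_pos b with rfl | h
      · have hB : B = 0 := by
          ext x y
          by_contra hne
          obtain ⟨d, hd, -⟩ := hb x y hne
          exact absurd hd (by simp)
        have h1 := congrFun (congrFun (Unitary.mem_iff.1 hu).2 (residue N 0)) (residue N 0)
        rw [hB] at h1
        simp at h1
      · exact h
    rw [if_neg (by rintro rfl; apply hii; simpa using hb0)]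
    refine Finset.sum_eq_zero fun j hj => ?_
    rw [hmem] at hj
    have : unroll b B i' j = 0 := if_neg (by rw [abs_lt] at *; omega)
    rw [this, star_zero, mul_zero]

end unroll

/-! ### Block coefficients and reassembly of the matrices. -/

section blocks
variable {l : ℕ}

/-- The block of `unroll b B` at block offset `e`. -/
noncomputable def unrollBlock (l b : ℕ) {N : ℕ} [NeZero N] (B : Matrix (Fin N) (Fin N) ℂ) (e : ℤ) : Op l :=
  Matrix.of fun r t => unroll b B (binVal r) (e * 2 ^ l + binVal t)

theorem unrollBlock_eq_zero {b N : ℕ} [NeZero N] (B : Matrix (Fin N) (Fin N) ℂ) {e : ℤ}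
    (he : (b : ℤ) < |e|) : unrollBlock l b B e = 0 := by
  ext r t
  refine if_neg ?_
  have h1 := binVal_lt r
  have h2 := binVal_lt t
  zify at h1 h2
  rw [lt_abs] at he
  rw [abs_lt, not_and_or]
  have hk : (1 : ℤ) ≤ 2 ^ l := by exact_mod_cast Nat.one_le_two_pow
  rcases he with he | he
  · right
    nlinarith
  · left
    nlinarith

theorem exists_eq_mul_add (l : ℕ) (z : ℤ) : ∃ (e : ℤ) (t : Fin l → Fin 2), z = e * 2 ^ l + binVal t :=
  ⟨z / (2 ^ l : ℕ), binOfInt l z, by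
    rw [binVal_binOfInt]
    have := Int.mul_ediv_add_emod z (2 ^ l : ℕ)
    push_cast at this ⊢
    linarith⟩

theorem eq_of_mul_add_eq {e e' : ℤ} {t t' : Fin l → Fin 2}
    (h : e * 2 ^ l + binVal t = e' * 2 ^ l + binVal t') : e = e' ∧ t = t' := by
  have h1 := binVal_lt t
  have h2 := binVal_lt t'
  zify at h1 h2
  have hk : (1 : ℤ) ≤ 2 ^ l := by exact_mod_cast Nat.one_le_two_pow
  have he : e = e' := by
    rcases lt_trichotomy e e' with h3 | h3 | h3
    · nlinarith
    · exact h3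
    · nlinarith
  subst he
  exact ⟨rfl, binVal_injective (by omega)⟩

/-- By periodicity this is the inner product of row `r` of block `0` with row `r'` of block `-e` of
the unrolled matrix. The index `d` stands for block offset `d - b`, which covers all nonzero blocks.
-/
theorem sum_unrollBlock_mul_star {b N : ℕ} [NeZero N] {B : Matrix (Fin N) (Fin N) ℂ}
    (hu : B ∈ Matrix.unitaryGroup (Fin N) ℂ) (hw : 4 * b < N) (hb : IsCyclicallyBanded b B)
    (hc : IsCyclicWithPeriod (2 ^ l) B) (e : ℕ) :
    ∑ d ∈ Finset.range (2 * b + 1), unrollBlock l b B ((d : ℤ) - b) *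
      star (unrollBlock l b B (((d + e : ℕ) : ℤ) - b)) = if e = 0 then 1 else 0 := by
  ext r r'
  rw [Matrix.sum_apply]
  simp only [Matrix.mul_apply, Matrix.star_apply]
  rw [← Finset.sum_product']
  set i' : ℤ := binVal r' - e * 2 ^ l with hi'
  have key : ∀ p : ℕ × (Fin l → Fin 2), unrollBlock l b B ((p.1 : ℤ) - b) r p.2 *
      star (unrollBlock l b B (((p.1 + e : ℕ) : ℤ) - b) r' p.2) =
      unroll b B (binVal r) (((p.1 : ℤ) - b) * 2 ^ l + binVal p.2) *
        star (unroll b B i' (((p.1 : ℤ) - b) * 2 ^ l + binVal p.2)) := by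
    intro p
    congr 2
    have := unroll_add_mul (b := b) hc i' (((p.1 : ℤ) - b) * 2 ^ l + binVal p.2) e
    rw [← this]
    show unroll b B _ _ = _
    congr 1 <;> push_cast <;> ring
  rw [Finset.sum_congr rfl fun p _ => key p]
  have hsum : ∑ p ∈ Finset.range (2 * b + 1) ×ˢ (Finset.univ : Finset (Fin l → Fin 2)),
      unroll b B (binVal r) (((p.1 : ℤ) - b) * 2 ^ l + binVal p.2) *
        star (unroll b B i' (((p.1 : ℤ) - b) * 2 ^ l + binVal p.2)) =
      ∑ j ∈ Finset.Ioo ((binVal r : ℤ) - b) (binVal r + b),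
        unroll b B (binVal r) j * star (unroll b B i' j) := by
    symm
    set f : ℕ × (Fin l → Fin 2) → ℤ := fun p => ((p.1 : ℤ) - b) * 2 ^ l + binVal p.2 with hf
    have hinj : Function.Injective f := by
      intro p q hpq
      obtain ⟨h1, h2⟩ := eq_of_mul_add_eq hpq
      exact Prod.ext (by omega) h2
    rw [← Finset.sum_image (s := Finset.range (2 * b + 1) ×ˢ Finset.univ) (g := f)
      (f := fun j => unroll b B (binVal r) j * star (unroll b B i' j)) hinj.injOn]
    refine Finset.sum_subset ?_ ?_
    · intro j hj
      rw [Finset.mem_Ioo] at hj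
      obtain ⟨e, t, rfl⟩ := exists_eq_mul_add l j
      have h1 := binVal_lt r
      have h2 := binVal_lt t
      zify at h1 h2
      have hk : (1 : ℤ) ≤ 2 ^ l := by exact_mod_cast Nat.one_le_two_pow
      have he1 : -(b : ℤ) ≤ e := by nlinarith
      have he2 : e ≤ b := by nlinarith
      rw [Finset.mem_image]
      refine ⟨((e + b).toNat, t), ?_, ?_⟩
      · simp
        omega
      · simp only [hf]
        rw [Int.toNat_of_nonneg (by omega)]
        ring
    · intro j _ hj
      have : unroll b B (binVal r) j = 0 := by
        refine if_neg fun h => hj ?_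
        rw [Finset.mem_Ioo]
        rw [abs_lt] at h
        omega
      rw [this, zero_mul]
  rw [hsum, sum_unroll_mul_star hu hw hb]
  have h1 := binVal_lt r
  have h2 := binVal_lt r'
  by_cases he : e = 0
  · subst he
    simp only [if_true, Matrix.one_apply, hi']
    congr 1
    rw [eq_iff_iff]
    simp [binVal_injective.eq_iff]
  · rw [if_neg he, if_neg]
    · rfl
    · intro h
      have h3 : (0 : ℤ) * 2 ^ l + binVal r' = e * 2 ^ l + binVal r := by
        rw [h, hi']; ring
      have := (eq_of_mul_add_eq h3).1
      omega

theorem div_eq_div_iff_modEq {n : ℕ} (hl : l ≤ n) (x z : Fin n → Fin 2) :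
    binVal x / 2 ^ l = binVal z / 2 ^ l ↔
      (binVal z : ℤ) ≡ binVal x - binVal (lowBits hl x) + binVal (lowBits hl z) [ZMOD (2 ^ n : ℕ)] := by
  have hx := Nat.div_add_mod (binVal x) (2 ^ l)
  have hz := Nat.div_add_mod (binVal z) (2 ^ l)
  rw [binVal_mod hl] at hx hz
  have f1 : (2 ^ l * ((binVal x / 2 ^ l : ℕ) : ℤ) : ℤ) = binVal x - binVal (lowBits hl x) := by
    rw [eq_sub_iff_add_eq]; exact_mod_cast hx
  have f2 : (2 ^ l * ((binVal z / 2 ^ l : ℕ) : ℤ) : ℤ) = binVal z - binVal (lowBits hl z) := by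
    rw [eq_sub_iff_add_eq]; exact_mod_cast hz
  constructor
  · intro h
    rw [← h, f1] at f2
    rw [f2]
    simp
  · intro h
    have h3 : ((2 ^ l * (binVal x / 2 ^ l) : ℕ) : ℤ) ≡ ((2 ^ l * (binVal z / 2 ^ l) : ℕ) : ℤ) [ZMOD (2 ^ n : ℕ)] := by
      push_cast at f1 f2 ⊢
      rw [f1, f2]
      have := (h.sub_right (binVal (lowBits hl z) : ℤ)).symm
      rwa [add_sub_cancel_right] at this
    rw [Int.natCast_modEq_iff] at h3
    have g1 := Nat.mul_div_le (binVal x) (2 ^ l)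
    have g2 := Nat.mul_div_le (binVal z) (2 ^ l)
    have g3 := binVal_lt x
    have g4 := binVal_lt z
    exact Nat.eq_of_mul_eq_mul_left (by positivity)
      (Nat.ModEq.eq_of_lt_of_lt h3 (by omega) (by omega))

/-- The blocks come from one reference matrix `B`, and `LocallyIdentical` transfers them to `A`. The
final power of the opposite shift undoes the index translation by `b`. -/
theorem sum_place_unrollBlock {b n n' : ℕ} (hl : l ≤ n) (hl' : l ≤ n')
    {A : Matrix (Fin (2 ^ n)) (Fin (2 ^ n)) ℂ} {B : Matrix (Fin (2 ^ n')) (Fin (2 ^ n')) ℂ}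
    (hw : 4 * b < 2 ^ n) (hb : IsCyclicallyBanded b A) (hloc : LocallyIdentical b (2 ^ l) A B) :
    (∑ d ∈ Finset.range (2 * b + 1), place (Fin.castLEEmb hl) (unrollBlock l b B ((d : ℤ) - b)) *
      mapMatrix (shiftBy l (-1)) ^ d) * mapMatrix (shiftBy l 1) ^ b =
      A.submatrix finFunctionFinEquiv finFunctionFinEquiv := by
  have hkn : ((2 ^ l : ℕ) : ℤ) ∣ ((2 ^ n : ℕ) : ℤ) := by exact_mod_cast pow_dvd_pow 2 hl
  have hkn' : ((2 ^ l : ℕ) : ℤ) ∣ ((2 ^ n' : ℕ) : ℤ) := by exact_mod_cast pow_dvd_pow 2 hl'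
  ext x y
  rw [Finset.sum_mul, Matrix.sum_apply, submatrix_apply]
  -- The signed offset from row `x` to column `y` if `y` lies `d - b` blocks after `x`. The `d`-th
  -- term contributes exactly when this is the true cyclic offset and lies in the band.
  set δ : ℕ → ℤ := fun d => ((d : ℤ) - b) * 2 ^ l + binVal (lowBits hl y) - binVal (lowBits hl x) with hδ
  have hlow : ∀ z : Fin n → Fin 2, (binVal z : ℤ) ≡ binVal (lowBits hl z) [ZMOD (2 ^ l : ℕ)] := by
    intro z
    rw [Int.natCast_modEq_iff, ← binVal_mod hl]
    exact (Nat.mod_modEq _ _).symm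
  have hterm : ∀ d : ℕ, (place (Fin.castLEEmb hl) (unrollBlock l b B ((d : ℤ) - b)) *
      mapMatrix (shiftBy l (-1)) ^ d * mapMatrix (shiftBy l 1) ^ b : Op n) x y =
      if |δ d| < b ∧ (binVal y : ℤ) ≡ binVal x + δ d [ZMOD (2 ^ n : ℕ)] then
        A (finFunctionFinEquiv x) (finFunctionFinEquiv y) else 0 := by
    intro d
    rw [mul_assoc, mapMatrix_shiftBy_pow, mapMatrix_shiftBy_pow, mapMatrix_shiftBy_mul,
      mul_mapMatrix_apply, place_apply]
    simp only [high_eq_iff, div_eq_div_iff_modEq hl, lowBits_shiftBy]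
    have hact : ((binVal (shiftBy l ((d : ℤ) * -1 + b * 1) y) : ℤ) ≡
        binVal x - binVal (lowBits hl x) + binVal (lowBits hl y) [ZMOD (2 ^ n : ℕ)]) ↔
        (binVal y : ℤ) ≡ binVal x + δ d [ZMOD (2 ^ n : ℕ)] := by
      have h1 := binVal_shiftBy (l := l) ((d : ℤ) * -1 + b * 1) y
      constructor
      · intro h
        have h2 := (h1.symm.trans h).add_right (((d : ℤ) - b) * 2 ^ l)
        convert h2 using 1
        · ring
        · simp only [hδ]
          ring
      · intro h
        refine h1.trans ?_
        have h2 := h.add_right (((d : ℤ) * -1 + b * 1) * 2 ^ l)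
        convert h2 using 1
        simp only [hδ]
        ring
    by_cases hA : (binVal y : ℤ) ≡ binVal x + δ d [ZMOD (2 ^ n : ℕ)]
    · rw [if_pos (hact.2 hA)]
      have e1 : (fun a => x (Fin.castLEEmb hl a)) = lowBits hl x := rfl
      have e2 : (fun a => shiftBy l ((d : ℤ) * -1 + b * 1) y (Fin.castLEEmb hl a)) = lowBits hl y :=
        lowBits_shiftBy hl _ y
      rw [e1, e2]
      show unroll b B _ _ = _
      have e3 : ((d : ℤ) - b) * 2 ^ l + binVal (lowBits hl y) - binVal (lowBits hl x) = δ d := rfl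
      unfold unroll
      rw [e3]
      by_cases hδb : |δ d| < b
      · rw [if_pos hδb, if_pos ⟨hδb, hA⟩]
        symm
        refine hloc _ _ _ _ (δ d) hδb ?_ hA ?_
        · rw [← Int.natCast_modEq_iff]
          exact (hlow x).trans ((residue_modEq _).of_dvd hkn').symm
        · refine (residue_modEq _).trans (Int.ModEq.trans ?_ ((residue_modEq _).add_right _).symm)
          simp only [hδ]
          ring_nf
          rfl
      · rw [if_neg hδb, if_neg fun h => hδb h.1]
    · rw [if_neg fun h => hA (hact.1 h), if_neg fun h => hA h.2]
  rw [Finset.sum_congr rfl fun d _ => hterm d]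
  by_cases hex : ∃ d ∈ Finset.range (2 * b + 1),
      |δ d| < b ∧ (binVal y : ℤ) ≡ binVal x + δ d [ZMOD (2 ^ n : ℕ)]
  · obtain ⟨d, hd, hd1, hd2⟩ := hex
    rw [Finset.sum_eq_single_of_mem d hd, if_pos ⟨hd1, hd2⟩]
    intro d' _ hdd'
    refine if_neg fun h => hdd' ?_
    -- Two offsets in the band that agree modulo `2 ^ n` are equal, so only one term survives.
    have h1 : δ d' ≡ δ d [ZMOD (2 ^ n : ℕ)] := Int.ModEq.add_left_cancel' _ (h.2.symm.trans hd2)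
    have h2 : δ d' = δ d := by
      refine eq_of_modEq_of_abs_lt h1 ?_
      have h3 := h.1
      rw [abs_lt] at h3 hd1 ⊢
      zify at hw
      push_cast
      constructor <;> linarith
    have h3 : ((d' : ℤ) - b) * 2 ^ l + binVal (lowBits hl y) = ((d : ℤ) - b) * 2 ^ l + binVal (lowBits hl y) := by
      simp only [hδ] at h2
      linarith
    have := (eq_of_mul_add_eq h3).1
    omega
  · rw [Finset.sum_eq_zero fun d hd => if_neg fun h => hex ⟨d, hd, h⟩]
    by_contra hne
    obtain ⟨δ', h1, h2⟩ := hb _ _ (Ne.symm hne)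
    apply hex
    obtain ⟨e, t, het⟩ := exists_eq_mul_add l (binVal (lowBits hl x) + δ')
    have ht : t = lowBits hl y := by
      apply binVal_injective
      have h3 : (binVal t : ℤ) ≡ binVal (lowBits hl y) [ZMOD (2 ^ l : ℕ)] := by
        have h4 : (binVal t : ℤ) ≡ e * 2 ^ l + binVal t [ZMOD (2 ^ l : ℕ)] := by
          have : (0 : ℤ) ≡ e * 2 ^ l [ZMOD (2 ^ l : ℕ)] := by
            apply Int.ModEq.symm
            rw [Int.modEq_zero_iff_dvd]
            exact ⟨e, by push_cast; ring⟩
          simpa using this.add_right (binVal t : ℤ)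
        rw [← het] at h4
        refine h4.trans ((((hlow x).symm.add_right δ').trans ?_).trans (hlow y))
        exact (h2.of_dvd hkn).symm
      rw [Int.natCast_modEq_iff] at h3
      exact Nat.ModEq.eq_of_lt_of_lt h3 (binVal_lt _) (binVal_lt _)
    have hr1 := binVal_lt (lowBits hl x)
    have hr2 := binVal_lt t
    zify at hr1 hr2
    have hk : (1 : ℤ) ≤ 2 ^ l := by exact_mod_cast Nat.one_le_two_pow
    have h1' := abs_lt.1 h1
    have he1 : -(b : ℤ) ≤ e := by nlinarith
    have he2 : e ≤ b := by nlinarith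
    have hδe : δ (e + b).toNat = δ' := by
      simp only [hδ]
      rw [Int.toNat_of_nonneg (by omega), ← ht]
      linarith
    refine ⟨(e + b).toNat, by simp; omega, ?_, ?_⟩
    · rwa [hδe]
    · rw [hδe]; exact h2

end blocks

theorem exists_generated_of_locallyIdentical (b l n₀ : ℕ)
    (M : (n : ℕ) → Matrix (Fin (2 ^ n)) (Fin (2 ^ n)) ℂ)
    (h_unitary : ∀ n > n₀, M n ∈ Matrix.unitaryGroup (Fin (2 ^ n)) ℂ)
    (h_width : ∀ n > n₀, 4 * b < 2 ^ n)
    (h_period : ∀ n > n₀, 2 ^ l ∣ 2 ^ n)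
    (h_band : ∀ n > n₀, IsCyclicallyBanded b (M n))
    (h_cyclic : ∀ n > n₀, IsCyclicWithPeriod (2 ^ l) (M n))
    (h_local : ∀ n > n₀, ∀ n' > n₀, LocallyIdentical b (2 ^ l) (M n) (M n')) :
    ∃ L, ∀ n > n₀, Generated n (L * shiftCost n)
      ((M n).submatrix finFunctionFinEquiv finFunctionFinEquiv) := by
  have hle : ∀ n > n₀, l ≤ n := fun n hn => (Nat.pow_dvd_pow_iff_le_right (by norm_num)).1 (h_period n hn)
  set n₁ := n₀ + 1
  have hn₁ : n₁ > n₀ := Nat.lt_succ_self _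
  set B := M n₁
  obtain ⟨L, hL⟩ := exists_generated_of_correlation (l := l) (2 * b)
    (fun d => unrollBlock l b B ((d : ℤ) - b))
    (fun d hd => unrollBlock_eq_zero _ (by rw [lt_abs]; omega))
    (sum_unrollBlock_mul_star (h_unitary _ hn₁) (h_width _ hn₁) (h_band _ hn₁) (h_cyclic _ hn₁))
  -- The `b` compensating shifts are increments for all `2 ^ l ≤ 2 ^ 2 ^ l` low strings.
  refine ⟨L + b * 2 ^ 2 ^ l, fun n hn => ?_⟩
  have hl := hle n hn
  have h1 := hL n hl
  have h2 := Generated.incOn hl Finset.univ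
  have e : incOn hl Finset.univ = shiftBy l 1 := by
    funext x
    simp [incOn]
  rw [e] at h2
  have h3 : ∀ s : ℕ, Generated n (s * (2 ^ 2 ^ l * shiftCost n)) (mapMatrix (shiftBy l 1) ^ s) := by
    intro s
    induction s with
    | zero => simpa using Generated.one
    | succ s ih =>
      rw [pow_succ, add_mul, one_mul]
      refine ih.mul (h2.mono ?_)
      refine Nat.mul_le_mul ?_ (Nat.le_succ _)
      rw [Finset.card_univ, Fintype.card_fun, Fintype.card_fin, Fintype.card_fin]
      exact Nat.pow_le_pow_right (by norm_num) Nat.lt_two_pow_self.le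
  have h4 := h1.mul (h3 b)
  rw [sum_place_unrollBlock hl (hle _ hn₁) (h_width n hn) (h_band n hn) (h_local n hn _ hn₁)] at h4
  refine h4.mono ?_
  rw [add_mul, mul_assoc]

end PolyLocal

end

/-! ### Group commutators of unit quaternions. -/

section

open Quaternion

namespace PolyLocal

section commutator

theorem norm_sub_one_sq_of_norm_eq_one {q : ℍ[ℝ]} (hq : ‖q‖ = 1) : ‖q - 1‖ ^ 2 = 2 - 2 * q.re := by
  have h1 : normSq q = 1 := by rw [normSq_eq_norm_mul_self, hq, one_mul]
  have h2 := normSq_eq_norm_mul_self (q - 1)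
  rw [sq, ← h2, normSq_def']
  rw [normSq_def'] at h1
  simp
  linarith

theorem norm_im_le (q : ℍ[ℝ]) : ‖q.im‖ ≤ ‖q - 1‖ := by
  have h1 := normSq_eq_norm_mul_self (q - 1)
  have h2 := normSq_eq_norm_mul_self q.im
  rw [normSq_def'] at h1 h2
  simp at h1 h2
  refine (sq_le_sq₀ (norm_nonneg _) (norm_nonneg _)).1 ?_
  nlinarith [sq_nonneg (q.re - 1)]

/-- On the unit sphere the real part deviates from `1` only to second order, so `q - 1` is nearly
pure. -/
theorem norm_sub_one_add_im {q : ℍ[ℝ]} (hq : ‖q‖ = 1) : ‖q - 1 - q.im‖ = ‖q - 1‖ ^ 2 / 2 := by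
  have h : q - 1 - q.im = ((q.re - 1 : ℝ) : ℍ[ℝ]) := by
    ext <;> simp
  rw [h, norm_coe, norm_sub_one_sq_of_norm_eq_one hq]
  have : q.re ≤ 1 := by
    have h1 : normSq q = 1 := by rw [normSq_eq_norm_mul_self, hq, one_mul]
    rw [normSq_def'] at h1
    nlinarith [sq_nonneg q.imI, sq_nonneg q.imJ, sq_nonneg q.imK]
  rw [Real.norm_eq_abs, abs_of_nonpos (by linarith)]
  ring

theorem exists_unit_pure_orthogonal (x : ℍ[ℝ]) : ∃ u : ℍ[ℝ], u.re = 0 ∧ ‖u‖ = 1 ∧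
    u.imI * x.imI + u.imJ * x.imJ + u.imK * x.imK = 0 := by
  obtain ⟨c, hc0, hc, hcx⟩ : ∃ c : ℍ[ℝ], c ≠ 0 ∧ c.re = 0 ∧
      c.imI * x.imI + c.imJ * x.imJ + c.imK * x.imK = 0 := by
    by_cases h : x.imI = 0 ∧ x.imJ = 0
    · refine ⟨⟨0, 1, 0, 0⟩, ?_, rfl, by simp [h.1]⟩
      intro h0
      simpa using congrArg QuaternionAlgebra.imI h0
    · refine ⟨⟨0, -x.imJ, x.imI, 0⟩, ?_, rfl, by simp; ring⟩
      intro h0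
      apply h
      have h1 := congrArg QuaternionAlgebra.imI h0
      have h2 := congrArg QuaternionAlgebra.imJ h0
      simp at h1 h2
      exact ⟨h2, h1⟩
  refine ⟨‖c‖⁻¹ • c, by simp [hc], ?_, ?_⟩
  · rw [norm_smul, norm_inv, norm_norm, inv_mul_cancel₀ (norm_ne_zero_iff.2 hc0)]
  · simp only [imI_smul, imJ_smul, imK_smul, smul_eq_mul]
    linear_combination ‖c‖⁻¹ * hcx

/-- A pure quaternion is a commutator of pure quaternions of balanced size. -/
theorem exists_commutator_eq {x : ℍ[ℝ]} (hx : x.re = 0) {δ : ℝ} (hδ : 0 < δ) (hxδ : ‖x‖ ≤ δ ^ 2) :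
    ∃ a b : ℍ[ℝ], a.re = 0 ∧ b.re = 0 ∧ ‖a‖ ≤ δ ∧ ‖b‖ ≤ δ ∧ a * b - b * a = x := by
  obtain ⟨u, hu0, hu1, hux⟩ := exists_unit_pure_orthogonal x
  have huu : u * u = -1 := by
    have h1 : normSq u = 1 := by rw [normSq_eq_norm_mul_self, hu1, one_mul]
    have h2 := self_mul_star u
    have h3 : star u = -u := by
      ext <;> simp [hu0]
    rw [h3, h1, mul_neg] at h2
    rw [← neg_neg (u * u), h2]
    simp
  have hxu : u * x = - (x * u) := by
    ext <;> simp [hx, hu0] <;> linarith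
  -- As `u ^ 2 = -1` and `u` anticommutes with `x`, the commutator of `u` and `u * x` is `-2 x`; the
  -- scalars balance the sizes of the two factors.
  refine ⟨δ • u, (-(1 / (2 * δ))) • (u * x), by simp [hu0], by simp [hx, hu0]; right; linarith, ?_, ?_, ?_⟩
  · rw [norm_smul, hu1, Real.norm_eq_abs, abs_of_pos hδ, mul_one]
  · rw [norm_smul, norm_mul, hu1, one_mul, norm_neg, Real.norm_eq_abs, abs_of_pos (by positivity)]
    rw [div_mul_eq_mul_div, div_le_iff₀ (by positivity)]
    nlinarith [norm_nonneg x]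
  · rw [smul_mul_smul_comm, smul_mul_smul_comm, ← mul_assoc, huu, hxu,
      show -(x * u) * u = x by rw [neg_mul, mul_assoc, huu]; simp]
    have : δ * -(1 / (2 * δ)) = -(1 / 2) := by field_simp
    rw [this, mul_comm (-(1 / (2 * δ))), this]
    simp only [neg_mul, one_mul, mul_neg, mul_one, neg_neg, smul_neg, neg_smul]
    rw [sub_neg_eq_add, ← add_smul]
    norm_num

theorem norm_one_add_of_pure {a : ℍ[ℝ]} (ha : a.re = 0) : ‖1 + a‖ ^ 2 = 1 + ‖a‖ ^ 2 := by
  have h1 := normSq_eq_norm_mul_self (1 + a)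
  have h2 := normSq_eq_norm_mul_self a
  rw [sq, sq, ← h1, ← h2, normSq_def', normSq_def']
  simp [ha]
  ring

theorem one_le_norm_one_add {a : ℍ[ℝ]} (ha : a.re = 0) : 1 ≤ ‖1 + a‖ := by
  have := norm_one_add_of_pure ha
  nlinarith [norm_nonneg (1 + a), sq_nonneg ‖a‖]

theorem norm_normalize_sub_one_le {a : ℍ[ℝ]} (ha : a.re = 0) :
    ‖‖1 + a‖⁻¹ • (1 + a)‖ = 1 ∧ ‖‖1 + a‖⁻¹ • (1 + a) - 1‖ ≤ 2 * ‖a‖ := by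
  have h1 := one_le_norm_one_add ha
  have h0 : (0 : ℝ) < ‖1 + a‖ := by linarith
  constructor
  · rw [norm_smul, norm_inv, norm_norm, inv_mul_cancel₀ h0.ne']
  · have h2 : ‖1 + a‖⁻¹ • (1 + a) - 1 = (‖1 + a‖⁻¹ • (1 + a) - (1 : ℝ) • (1 + a)) + a := by
      rw [one_smul]; abel
    rw [h2, ← sub_smul]
    refine (norm_add_le _ _).trans ?_
    rw [norm_smul, Real.norm_eq_abs, abs_sub_comm, abs_of_nonneg (by
      rw [sub_nonneg]; exact inv_le_one_of_one_le₀ h1), sub_mul, one_mul, inv_mul_cancel₀ h0.ne']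
    have := norm_add_le (1 : ℍ[ℝ]) a
    rw [norm_one] at this
    linarith

theorem commutator_sub_one {V W : ℍ[ℝ]} (hV : V ≠ 0) (hW : W ≠ 0) :
    V * W * V⁻¹ * W⁻¹ - 1 = (V * W - W * V) * (W * V)⁻¹ := by
  rw [sub_mul, mul_inv_cancel₀ (mul_ne_zero hW hV), mul_inv_rev, ← mul_assoc]

/-- A unit quaternion near `1` is nearly a group commutator of unit quaternions near `1`. -/
theorem exists_approx_commutator {q : ℍ[ℝ]} (hq : ‖q‖ = 1) {δ : ℝ} (hδ : 0 < δ) (hδ1 : δ ≤ 1)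
    (hqδ : ‖q - 1‖ ≤ δ ^ 2) : ∃ v w : ℍ[ℝ], ‖v‖ = 1 ∧ ‖w‖ = 1 ∧ ‖v - 1‖ ≤ 2 * δ ∧
      ‖w - 1‖ ≤ 2 * δ ∧ ‖q - v * w * v⁻¹ * w⁻¹‖ ≤ 4 * δ ^ 3 := by
  obtain ⟨a, b, ha, hb, haδ, hbδ, hab⟩ := exists_commutator_eq (x := q.im) (by simp) hδ
    ((norm_im_le q).trans hqδ)
  have ha1 := one_le_norm_one_add ha
  have hb1 := one_le_norm_one_add hb
  have ha0 : (1 + a) ≠ 0 := norm_pos_iff.1 (by linarith)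
  have hb0 : (1 + b) ≠ 0 := norm_pos_iff.1 (by linarith)
  obtain ⟨hv1, hv2⟩ := norm_normalize_sub_one_le ha
  obtain ⟨hw1, hw2⟩ := norm_normalize_sub_one_le hb
  refine ⟨_, _, hv1, hw1, hv2.trans (by linarith), hw2.trans (by linarith), ?_⟩
  -- Real scalars cancel in a group commutator, so normalization is harmless.
  have hcomm : (‖1 + a‖⁻¹ • (1 + a)) * (‖1 + b‖⁻¹ • (1 + b)) * (‖1 + a‖⁻¹ • (1 + a))⁻¹ *
      (‖1 + b‖⁻¹ • (1 + b))⁻¹ = (1 + a) * (1 + b) * (1 + a)⁻¹ * (1 + b)⁻¹ := by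
    have hsa : ‖1 + a‖⁻¹ ≠ 0 := inv_ne_zero (by linarith)
    have hsb : ‖1 + b‖⁻¹ ≠ 0 := inv_ne_zero (by linarith)
    have hinv : ∀ (s : ℝ) (z : ℍ[ℝ]), (s • z)⁻¹ = s⁻¹ • z⁻¹ := by
      intro s z
      exact smul_inv₀ s z
    rw [hinv, hinv, smul_mul_smul_comm, smul_mul_smul_comm, smul_mul_smul_comm]
    have : ‖1 + a‖⁻¹ * ‖1 + b‖⁻¹ * ‖1 + a‖⁻¹⁻¹ * ‖1 + b‖⁻¹⁻¹ = 1 := by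
      field_simp
    rw [this, one_smul]
  rw [hcomm]
  have hx : (1 + a) * (1 + b) * (1 + a)⁻¹ * (1 + b)⁻¹ = 1 + q.im * ((1 + b) * (1 + a))⁻¹ := by
    have := commutator_sub_one ha0 hb0
    rw [sub_eq_iff_eq_add'] at this
    rw [this, ← hab]
    congr 2
    noncomm_ring
  set g := (1 + b) * (1 + a) with hg
  have hg0 : g ≠ 0 := mul_ne_zero hb0 ha0
  have hg1 : 1 ≤ ‖g‖ := by
    rw [hg, norm_mul]
    nlinarith
  have hginv : ‖g⁻¹ - 1‖ ≤ 3 * δ := by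
    have h1 : g⁻¹ - 1 = g⁻¹ * (1 - g) := by rw [mul_sub, mul_one, inv_mul_cancel₀ hg0]
    have h2 : 1 - g = -(a + b + b * a) := by rw [hg]; noncomm_ring
    have h3 : ‖a + b + b * a‖ ≤ 3 * δ := by
      refine (norm_add_le _ _).trans ?_
      have h4 := norm_add_le a b
      rw [norm_mul]
      have h5 : ‖b‖ * ‖a‖ ≤ 1 * δ := mul_le_mul (hbδ.trans hδ1) haδ (norm_nonneg _) (by norm_num)
      linarith
    rw [h1, h2, norm_mul, norm_neg, norm_inv]
    have h6 : ‖g‖⁻¹ ≤ 1 := inv_le_one_of_one_le₀ hg1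
    calc ‖g‖⁻¹ * ‖a + b + b * a‖ ≤ 1 * (3 * δ) :=
          mul_le_mul h6 h3 (norm_nonneg _) (by norm_num)
      _ = 3 * δ := one_mul _
  rw [hx]
  -- The first difference is at most `δ ^ 4 / 2`, the second product at most `δ ^ 2 * 3 δ`.
  have h7 : q - (1 + q.im * g⁻¹) = (q - 1 - q.im) - q.im * (g⁻¹ - 1) := by
    rw [mul_sub, mul_one]; abel
  rw [h7]
  refine (norm_sub_le _ _).trans ?_
  rw [norm_sub_one_add_im hq, norm_mul]
  have h8 : ‖q.im‖ * ‖g⁻¹ - 1‖ ≤ δ ^ 2 * (3 * δ) :=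
    mul_le_mul ((norm_im_le q).trans hqδ) hginv (norm_nonneg _) (by positivity)
  have h9 : ‖q - 1‖ ^ 2 ≤ (δ ^ 2) ^ 2 := pow_le_pow_left₀ (norm_nonneg _) hqδ 2
  have h10 : (δ ^ 2) ^ 2 ≤ δ ^ 3 := by
    rw [← pow_mul]
    exact pow_le_pow_of_le_one hδ.le hδ1 (by norm_num)
  have h11 : (0 : ℝ) < δ ^ 3 := by positivity
  nlinarith

/-- Group commutators of elements near `1` are insensitive to errors. -/
theorem norm_commutator_sub_commutator_le {v w V W : ℍ[ℝ]} (hv : ‖v‖ = 1) (hw : ‖w‖ = 1)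
    (hV : ‖V‖ = 1) (hW : ‖W‖ = 1) {δ : ℝ} (hδ : 0 < δ) (hδ1 : δ ≤ 1) (hv1 : ‖v - 1‖ ≤ 2 * δ)
    (hw1 : ‖w - 1‖ ≤ 2 * δ) (hVv : ‖v - V‖ ≤ δ ^ 2) (hWw : ‖w - W‖ ≤ δ ^ 2) :
    ‖v * w * v⁻¹ * w⁻¹ - V * W * V⁻¹ * W⁻¹‖ ≤ 26 * δ ^ 3 := by
  have ne : ∀ {z : ℍ[ℝ]}, ‖z‖ = 1 → z ≠ 0 := fun h => norm_pos_iff.1 (by rw [h]; norm_num)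
  -- Both commutators are `1` plus an additive commutator times an inverse. The two terms are
  -- bounded by `16 δ ^ 4` and `10 δ ^ 3`.
  have h1 : v * w * v⁻¹ * w⁻¹ - V * W * V⁻¹ * W⁻¹ =
      (v * w - w * v) * ((w * v)⁻¹ - (W * V)⁻¹) +
        ((v * w - w * v) - (V * W - W * V)) * (W * V)⁻¹ := by
    rw [← sub_sub_sub_cancel_right _ _ 1, commutator_sub_one (ne hv) (ne hw),
      commutator_sub_one (ne hV) (ne hW)]
    noncomm_ring
  have hVv' : ‖V - v‖ ≤ δ ^ 2 := by rwa [norm_sub_rev]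
  have hWw' : ‖W - w‖ ≤ δ ^ 2 := by rwa [norm_sub_rev]
  have h2 : ‖v * w - w * v‖ ≤ 8 * δ ^ 2 := by
    have e : v * w - w * v = (v - 1) * (w - 1) - (w - 1) * (v - 1) := by noncomm_ring
    rw [e]
    refine (norm_sub_le _ _).trans ?_
    rw [norm_mul, norm_mul]
    have : ‖v - 1‖ * ‖w - 1‖ ≤ (2 * δ) * (2 * δ) :=
      mul_le_mul hv1 hw1 (norm_nonneg _) (by positivity)
    nlinarith
  have h3 : ‖(w * v)⁻¹ - (W * V)⁻¹‖ ≤ 2 * δ ^ 2 := by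
    have hwv : ‖w * v‖ = 1 := by rw [norm_mul, hv, hw, one_mul]
    have hWV : ‖W * V‖ = 1 := by rw [norm_mul, hV, hW, one_mul]
    have e : (w * v)⁻¹ - (W * V)⁻¹ = (w * v)⁻¹ * ((W - w) * V + w * (V - v)) * (W * V)⁻¹ := by
      have : (W - w) * V + w * (V - v) = W * V - w * v := by noncomm_ring
      rw [this, mul_sub, sub_mul, inv_mul_cancel₀ (ne hwv), one_mul, mul_assoc,
        mul_inv_cancel₀ (ne hWV), mul_one]
    rw [e, norm_mul, norm_mul, norm_inv, norm_inv, hwv, hWV, inv_one, one_mul, mul_one]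
    refine (norm_add_le _ _).trans ?_
    rw [norm_mul, norm_mul, hV, hw]
    linarith
  have h4 : ‖(v * w - w * v) - (V * W - W * V)‖ ≤ 10 * δ ^ 3 := by
    have e : (v * w - w * v) - (V * W - W * V) =
        -(((v - 1) * (W - w) + (V - v) * (w - 1) + (V - v) * (W - w)) -
          ((w - 1) * (V - v) + (W - w) * (v - 1) + (W - w) * (V - v))) := by noncomm_ring
    rw [e, norm_neg]
    have f1 : ‖v - 1‖ * ‖W - w‖ ≤ (2 * δ) * δ ^ 2 := mul_le_mul hv1 hWw' (norm_nonneg _) (by positivity)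
    have f2 : ‖w - 1‖ * ‖V - v‖ ≤ (2 * δ) * δ ^ 2 := mul_le_mul hw1 hVv' (norm_nonneg _) (by positivity)
    have f3 : ‖V - v‖ * ‖W - w‖ ≤ δ ^ 2 * δ ^ 2 := mul_le_mul hVv' hWw' (norm_nonneg _) (by positivity)
    have f4 : δ ^ 2 * δ ^ 2 ≤ δ ^ 3 := by
      rw [← pow_add]
      exact pow_le_pow_of_le_one hδ.le hδ1 (by norm_num)
    have g1 := norm_sub_le ((v - 1) * (W - w) + (V - v) * (w - 1) + (V - v) * (W - w))
      ((w - 1) * (V - v) + (W - w) * (v - 1) + (W - w) * (V - v))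
    have g2 := norm_add₃_le (a := (v - 1) * (W - w)) (b := (V - v) * (w - 1)) (c := (V - v) * (W - w))
    have g3 := norm_add₃_le (a := (w - 1) * (V - v)) (b := (W - w) * (v - 1)) (c := (W - w) * (V - v))
    simp only [norm_mul] at g2 g3
    nlinarith
  have h5 : δ ^ 4 ≤ δ ^ 3 := pow_le_pow_of_le_one hδ.le hδ1 (by norm_num)
  rw [h1]
  refine (norm_add_le _ _).trans ?_
  rw [norm_mul, norm_mul, norm_inv, norm_mul W V, hV, hW, one_mul, inv_one, mul_one]
  have h6 : ‖v * w - w * v‖ * ‖(w * v)⁻¹ - (W * V)⁻¹‖ ≤ (8 * δ ^ 2) * (2 * δ ^ 2) :=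
    mul_le_mul h2 h3 (norm_nonneg _) (by positivity)
  nlinarith

end commutator

/-! ### The Solovay–Kitaev recursion. -/

section solovayKitaev

variable {word : ℕ → ℍ[ℝ] → Prop}

/-- Approximate `q` by `U`, write `q * U⁻¹` as an approximate commutator of `v` and `w`, and
approximate these as well. The word `V W V⁻¹ W⁻¹ U` has five pieces, and `30 = 4 + 26` collects the
two commutator errors. -/
theorem solovayKitaev_step (hnorm : ∀ L a, word L a → ‖a‖ = 1)
    (hmul : ∀ L L' a c, word L a → word L' c → word (L + L') (a * c))
    (hinv : ∀ L a, word L a → word L a⁻¹) {L : ℕ} {δ : ℝ} (hδ : 0 < δ) (hδ1 : δ ≤ 1)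
    (h : ∀ q : ℍ[ℝ], ‖q‖ = 1 → ∃ a, word L a ∧ ‖q - a‖ ≤ δ ^ 2) (q : ℍ[ℝ]) (hq : ‖q‖ = 1) :
    ∃ a, word (5 * L) a ∧ ‖q - a‖ ≤ 30 * δ ^ 3 := by
  obtain ⟨U, hU, hqU⟩ := h q hq
  have hU1 := hnorm _ _ hU
  have hU0 : U ≠ 0 := norm_pos_iff.1 (by rw [hU1]; norm_num)
  have hq' : ‖q * U⁻¹‖ = 1 := by rw [norm_mul, norm_inv, hq, hU1]; norm_num
  have hq'1 : ‖q * U⁻¹ - 1‖ ≤ δ ^ 2 := by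
    have : q * U⁻¹ - 1 = (q - U) * U⁻¹ := by rw [sub_mul, mul_inv_cancel₀ hU0]
    rw [this, norm_mul, norm_inv, hU1, inv_one, mul_one]
    exact hqU
  obtain ⟨v, w, hv, hw, hv1, hw1, hvw⟩ := exists_approx_commutator hq' hδ hδ1 hq'1
  obtain ⟨V, hV, hvV⟩ := h v hv
  obtain ⟨W, hW, hwW⟩ := h w hw
  have hc := norm_commutator_sub_commutator_le hv hw (hnorm _ _ hV) (hnorm _ _ hW) hδ hδ1 hv1 hw1
    hvV hwW
  refine ⟨V * W * V⁻¹ * W⁻¹ * U, ?_, ?_⟩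
  · have := hmul _ _ _ _ (hmul _ _ _ _ (hmul _ _ _ _ (hmul _ _ _ _ hV hW) (hinv _ _ hV))
      (hinv _ _ hW)) hU
    convert this using 1
    ring
  · have e : q - V * W * V⁻¹ * W⁻¹ * U = (q * U⁻¹ - V * W * V⁻¹ * W⁻¹) * U := by
      rw [sub_mul, mul_assoc q, inv_mul_cancel₀ hU0, mul_one]
    rw [e, norm_mul, hU1, mul_one]
    have := norm_sub_le_norm_sub_add_norm_sub (q * U⁻¹) (v * w * v⁻¹ * w⁻¹) (V * W * V⁻¹ * W⁻¹)
    linarith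

/-- In the scale `e = 900 * error` the step `δ ^ 2 ↦ 30 δ ^ 3` becomes `e ↦ e ^ (3 / 2)`, whence the
tower of exponents `(3 / 2) ^ j`. -/
theorem solovayKitaev_iterate (hnorm : ∀ L a, word L a → ‖a‖ = 1)
    (hmul : ∀ L L' a c, word L a → word L' c → word (L + L') (a * c))
    (hinv : ∀ L a, word L a → word L a⁻¹) {L : ℕ}
    (h : ∀ q : ℍ[ℝ], ‖q‖ = 1 → ∃ a, word L a ∧ ‖q - a‖ ≤ Real.exp (-1) / 900) (j : ℕ) :
    ∀ q : ℍ[ℝ], ‖q‖ = 1 → ∃ a, word (5 ^ j * L) a ∧ ‖q - a‖ ≤ Real.exp (-(3 / 2) ^ j) / 900 := by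
  induction j with
  | zero => simpa using h
  | succ j ih =>
    intro q hq
    set δ : ℝ := Real.exp (-(3 / 2) ^ j / 2) / 30 with hδ
    have hδ0 : 0 < δ := by positivity
    have hδ1 : δ ≤ 1 := by
      have : Real.exp (-(3 / 2) ^ j / 2) ≤ 1 := by
        rw [Real.exp_le_one_iff]
        have : (0 : ℝ) < (3 / 2) ^ j := by positivity
        linarith
      rw [hδ]; linarith
    have e1 : Real.exp (-(3 / 2) ^ j) / 900 = δ ^ 2 := by
      rw [hδ, div_pow (Real.exp _), ← Real.exp_nat_mul]
      norm_num
      ring_nf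
    have e2 : 30 * δ ^ 3 = Real.exp (-(3 / 2) ^ (j + 1)) / 900 := by
      rw [hδ, div_pow (Real.exp _), ← Real.exp_nat_mul]
      have : ((3 : ℕ) : ℝ) * (-(3 / 2) ^ j / 2) = -(3 / 2) ^ (j + 1) := by
        push_cast; ring
      rw [this]
      ring
    rw [e1] at ih
    obtain ⟨a, ha, hqa⟩ := solovayKitaev_step hnorm hmul hinv hδ0 hδ1 ih q hq
    refine ⟨a, ?_, e2 ▸ hqa⟩
    rwa [pow_succ, mul_comm (5 ^ j) 5, mul_assoc]

/-- Since `5 ≤ (3 / 2) ^ 4`, a word length `5 ^ j` is at most the fourth power of the logarithmic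
precision gained. -/
theorem exists_pow_ge_log (y : ℝ) : ∃ j : ℕ, y ≤ (3 / 2 : ℝ) ^ j ∧ (5 : ℝ) ^ j ≤ 41 * (1 + y ^ 4) := by
  have h54 : ∀ j : ℕ, (5 : ℝ) ^ j ≤ ((3 / 2 : ℝ) ^ j) ^ 4 := by
    intro j
    rw [← pow_mul, mul_comm, pow_mul]
    exact pow_le_pow_left₀ (by norm_num) (by norm_num) j
  by_cases hy : y ≤ 1
  · exact ⟨0, by simpa using hy, by
      have : 0 ≤ y ^ 4 := by positivity
      rw [pow_zero]; linarith⟩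
  · rw [not_le] at hy
    obtain ⟨j, hj1, hj2⟩ := exists_nat_pow_near hy.le (by norm_num : (1 : ℝ) < 3 / 2)
    refine ⟨j + 1, hj2.le, (h54 _).trans ?_⟩
    have h1 : ((3 / 2 : ℝ) ^ (j + 1)) ≤ 3 / 2 * y := by
      rw [pow_succ]; linarith
    have h2 := pow_le_pow_left₀ (by positivity) h1 4
    have : 0 ≤ y ^ 4 := by positivity
    nlinarith

/-- The Solovay–Kitaev theorem for unit quaternions. -/
theorem solovayKitaev (hnorm : ∀ L a, word L a → ‖a‖ = 1)
    (hmul : ∀ L L' a c, word L a → word L' c → word (L + L') (a * c))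
    (hinv : ∀ L a, word L a → word L a⁻¹) {L : ℕ}
    (h : ∀ q : ℍ[ℝ], ‖q‖ = 1 → ∃ a, word L a ∧ ‖q - a‖ ≤ Real.exp (-1) / 900) :
    ∃ K : ℝ, ∀ q : ℍ[ℝ], ‖q‖ = 1 → ∀ ε : ℝ, 0 < ε →
      ∃ (L' : ℕ) (a : ℍ[ℝ]), word L' a ∧ ‖q - a‖ < ε ∧ (L' : ℝ) ≤ K * (1 + Real.log (1 / ε) ^ 4) := by
  refine ⟨41 * L, fun q hq ε hε => ?_⟩
  obtain ⟨j, hj1, hj2⟩ := exists_pow_ge_log (Real.log (1 / ε))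
  obtain ⟨a, ha, hqa⟩ := solovayKitaev_iterate hnorm hmul hinv h j q hq
  refine ⟨_, a, ha, hqa.trans_lt ?_, ?_⟩
  · have h1 : Real.exp (-(3 / 2) ^ j) ≤ ε := by
      rw [← Real.le_log_iff_exp_le hε]
      rw [one_div, Real.log_inv] at hj1
      linarith
    have h2 := Real.exp_pos (-(3 / 2 : ℝ) ^ j)
    linarith
  · push_cast
    have : (0 : ℝ) ≤ L := Nat.cast_nonneg L
    nlinarith

end solovayKitaev

end PolyLocal

end

/-! ### Density of two explicit rotations in the unit quaternions. -/

section

open Quaternion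

namespace PolyLocal

section density

theorem exists_unit_mul_eq_of_norm_eq {z w : ℂ} (h : ‖w‖ = ‖z‖) : ∃ α : ℂ, ‖α‖ = 1 ∧ w = α * z := by
  by_cases hz : z = 0
  · subst hz
    rw [norm_zero, norm_eq_zero] at h
    exact ⟨1, by simp, by simp [h]⟩
  · refine ⟨w / z, ?_, by field_simp⟩
    rw [norm_div, h, div_self (norm_ne_zero_iff.2 hz)]

theorem exists_unit_sq_eq {α : ℂ} (h : ‖α‖ = 1) : ∃ u : ℂ, ‖u‖ = 1 ∧ u * u = α := by
  refine ⟨Complex.exp ((α.arg / 2 : ℝ) * Complex.I), Complex.norm_exp_ofReal_mul_I _, ?_⟩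
  have h1 := Complex.norm_mul_exp_arg_mul_I α
  rw [h, Complex.ofReal_one, one_mul] at h1
  rw [← Complex.exp_add, ← add_mul, ← Complex.ofReal_add, add_halves, h1]

/-- The quaternion `z + w j`. -/
def ofPair (z w : ℂ) : ℍ[ℝ] := ⟨z.re, z.im, w.re, w.im⟩

@[simp] theorem re_ofPair (z w : ℂ) : (ofPair z w).re = z.re := rfl

@[simp] theorem imI_ofPair (z w : ℂ) : (ofPair z w).imI = z.im := rfl

@[simp] theorem imJ_ofPair (z w : ℂ) : (ofPair z w).imJ = w.re := rfl

@[simp] theorem imK_ofPair (z w : ℂ) : (ofPair z w).imK = w.im := rfl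

theorem ofPair_mul (z w z' w' : ℂ) : ofPair z w * ofPair z' w' =
    ofPair (z * z' - w * starRingEnd ℂ w') (z * w' + w * starRingEnd ℂ z') := by
  ext <;> simp <;> ring

theorem norm_ofPair_sq (z w : ℂ) : ‖ofPair z w‖ ^ 2 = ‖z‖ ^ 2 + ‖w‖ ^ 2 := by
  rw [sq, ← normSq_eq_norm_mul_self, normSq_def', ← Complex.normSq_eq_norm_sq,
    ← Complex.normSq_eq_norm_sq, Complex.normSq_apply, Complex.normSq_apply]
  simp
  ring

theorem eq_ofPair (q : ℍ[ℝ]) : q = ofPair ⟨q.re, q.imI⟩ ⟨q.imJ, q.imK⟩ := by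
  ext <;> simp

variable {S : Submonoid ℍ[ℝ]}

/-- A closed submonoid containing `exp (i θ)` with `cos θ = 1 / 4` contains the unit circle. -/
theorem ofPair_mem_of_cos (hS : IsClosed (S : Set ℍ[ℝ])) (hinv : ∀ a ∈ S, a⁻¹ ∈ S) {θ : ℝ}
    (hθ : Real.cos θ = 1 / 4) (hmem : ofPair (Complex.exp (θ * Complex.I)) 0 ∈ S) {z : ℂ}
    (hz : ‖z‖ = 1) : ofPair z 0 ∈ S := by
  -- Niven's theorem: `1 / 4` is not among the rational cosines of rational multiples of `π`.
  have hirr : Irrational (θ / (2 * Real.pi)) := by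
    rintro ⟨r, hr⟩
    have h1 : θ = ((2 * r : ℚ) : ℝ) * Real.pi := by
      rw [eq_div_iff (by positivity)] at hr
      push_cast
      linarith
    have := niven ⟨2 * r, h1⟩ ⟨1 / 4, by rw [hθ]; norm_num⟩
    rw [hθ] at this
    norm_num at this
  have hdense := dense_addSubgroupClosure_pair_iff.2 hirr
  set f : ℝ → ℍ[ℝ] := fun t => ofPair (Complex.exp (t * Complex.I)) 0 with hf
  have hfadd : ∀ s t, f (s + t) = f s * f t := by
    intro s t
    simp only [hf, ofPair_mul]
    rw [← Complex.exp_add]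
    congr 1
    · push_cast
      simp [add_mul]
    · simp
  have hfc : Continuous f := by
    have : f = fun t : ℝ => ((Complex.exp (t * Complex.I) : ℂ) : ℍ[ℝ]) := by
      funext t
      rw [hf]
      ext <;> simp
    rw [this]
    have h2 : Continuous (fun z : ℂ => (z : ℍ[ℝ])) :=
      (LinearMap.continuous_of_finiteDimensional ofComplex.toLinearMap)
    exact h2.comp (by fun_prop)
  have hf0 : f 0 = 1 := by
    ext <;> simp [hf]
  have hsub : (AddSubgroup.closure {θ, 2 * Real.pi} : Set ℝ) ⊆ f ⁻¹' S := by
    intro t ht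
    refine AddSubgroup.closure_induction (p := fun t _ => f t ∈ S) ?_ ?_ ?_ ?_ ht
    · rintro s (rfl | rfl)
      · exact hmem
      · have : f (2 * Real.pi) = 1 := by
          rw [← hf0]
          simp only [hf]
          push_cast
          rw [Complex.exp_two_pi_mul_I]
          simp
        rw [this]
        exact S.one_mem
    · rw [hf0]; exact S.one_mem
    · intro s t _ _ h1 h2
      rw [hfadd]
      exact S.mul_mem h1 h2
    · intro s _ h1
      have : f (-s) = (f s)⁻¹ := by
        apply eq_inv_of_mul_eq_one_left
        rw [← hfadd, neg_add_cancel, hf0]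
      rw [this]
      exact hinv _ h1
  have hall : ∀ t, f t ∈ S := by
    intro t
    have h1 : closure (AddSubgroup.closure {θ, 2 * Real.pi} : Set ℝ) ⊆ f ⁻¹' S :=
      closure_minimal hsub (hS.preimage hfc)
    exact h1 (hdense t)
  obtain ⟨α, rfl⟩ := exists_exp_eq hz
  exact hall α

/-- Membership in a monoid containing the circle depends only on the moduli. -/
theorem ofPair_mem_of_norm_eq (hT : ∀ z : ℂ, ‖z‖ = 1 → ofPair z 0 ∈ S) {z w z' w' : ℂ}
    (h : ofPair z w ∈ S) (hz : ‖z'‖ = ‖z‖) (hw : ‖w'‖ = ‖w‖) : ofPair z' w' ∈ S := by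
  obtain ⟨α, hα, rfl⟩ := exists_unit_mul_eq_of_norm_eq hz
  obtain ⟨β, hβ, rfl⟩ := exists_unit_mul_eq_of_norm_eq hw
  obtain ⟨u, hu, huu⟩ := exists_unit_sq_eq (α := α * β) (by rw [norm_mul, hα, hβ, one_mul])
  have huc : u * starRingEnd ℂ u = 1 := by
    rw [Complex.mul_conj, Complex.normSq_eq_norm_sq, hu]; simp
  have hac : α * starRingEnd ℂ α = 1 := by
    rw [Complex.mul_conj, Complex.normSq_eq_norm_sq, hα]; simp
  -- Left multiplication by `u` and right multiplication by `α ū` scale the two coordinates by `α`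
  -- and `u ^ 2 ᾱ = β`.
  have h1 := S.mul_mem (S.mul_mem (hT u hu) h) (hT (α * starRingEnd ℂ u) (by simp [hα, hu]))
  rw [ofPair_mul, ofPair_mul] at h1
  convert h1 using 2
  · simp only [map_zero, mul_zero, zero_mul, sub_zero]
    linear_combination (-α * z) * huc
  · simp only [map_mul, Complex.conj_conj, map_zero, mul_zero, zero_mul, add_zero, zero_add]
    linear_combination (-β * w) * hac - (starRingEnd ℂ α * w) * huu

/-- Only moduli matter, by `ofPair_mem_of_norm_eq`. First a balanced element with both squared
moduli `1 / 2` is found; then balanced times `u` times balanced has coordinates of moduli `|Im u|`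
and `|Re u|`, which are arbitrary. -/
theorem mem_of_circle_of_ofPair (hT : ∀ z : ℂ, ‖z‖ = 1 → ofPair z 0 ∈ S) {z w : ℂ}
    (h : ofPair z w ∈ S) (hz : ‖z‖ ^ 2 = 2 / 5) (hw : ‖w‖ ^ 2 = 3 / 5) {q : ℍ[ℝ]} (hq : ‖q‖ = 1) :
    q ∈ S := by
  have sq_cast : ∀ {r : ℝ}, 0 ≤ r → ((√r : ℝ) : ℂ) * ((√r : ℝ) : ℂ) = (r : ℂ) := by
    intro r hr
    rw [← Complex.ofReal_mul, Real.mul_self_sqrt hr]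
  have norm_sqrt : ∀ {r : ℝ} {z : ℂ}, ‖z‖ ^ 2 = r → ‖((√r : ℝ) : ℂ)‖ = ‖z‖ := by
    intro r z h
    rw [Complex.norm_real, Real.norm_eq_abs, abs_of_nonneg (Real.sqrt_nonneg _), ← h,
      Real.sqrt_sq (norm_nonneg _)]
  have norm_of_sq : ∀ {z w : ℂ}, ‖z‖ ^ 2 = ‖w‖ ^ 2 → ‖z‖ = ‖w‖ := fun h => by
    rwa [sq_eq_sq₀ (norm_nonneg _) (norm_nonneg _)] at h
  have ha : ofPair (√(2 / 5) : ℝ) (√(3 / 5) : ℝ) ∈ S :=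
    ofPair_mem_of_norm_eq hT h (norm_sqrt hz) (norm_sqrt hw)
  have hhalf : ofPair (√(1 / 2) : ℝ) (√(1 / 2) : ℝ) ∈ S := by
    -- The first coordinate of the product is `(2 / 5) u - (3 / 5) ū`, of squared modulus `(Re u) ^
    -- 2 / 25 + (Im u) ^ 2`; this `u` makes it `1 / 2`.
    set u : ℂ := ⟨√(25 / 48), √(23 / 48)⟩ with hu
    have hu1 : ‖u‖ = 1 := by
      have : ‖u‖ ^ 2 = 1 := by
        rw [← Complex.normSq_eq_norm_sq, Complex.normSq_apply, hu]
        simp only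
        rw [Real.mul_self_sqrt (by norm_num), Real.mul_self_sqrt (by norm_num)]
        norm_num
      nlinarith [norm_nonneg u]
    have h1 := S.mul_mem (S.mul_mem ha (hT u hu1)) ha
    have hn : ‖ofPair (√(2 / 5) : ℝ) (√(3 / 5) : ℝ) * ofPair u 0 *
        ofPair (√(2 / 5) : ℝ) (√(3 / 5) : ℝ)‖ = 1 := by
      have e1 : ‖ofPair (√(2 / 5) : ℝ) (√(3 / 5) : ℝ)‖ = 1 := by
        have : ‖ofPair (√(2 / 5) : ℝ) (√(3 / 5) : ℝ)‖ ^ 2 = 1 := by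
          rw [norm_ofPair_sq, norm_sqrt hz, norm_sqrt hw, hz, hw]; norm_num
        nlinarith [norm_nonneg (ofPair (√(2 / 5) : ℝ) (√(3 / 5) : ℝ))]
      have e2 : ‖ofPair u 0‖ = 1 := by
        have : ‖ofPair u 0‖ ^ 2 = 1 := by
          rw [norm_ofPair_sq, hu1]; norm_num
        nlinarith [norm_nonneg (ofPair u 0)]
      rw [norm_mul, norm_mul, e1, e2]; norm_num
    rw [ofPair_mul, ofPair_mul] at h1 hn
    set z₁ := ((√(2 / 5) : ℝ) * u - (√(3 / 5) : ℝ) * starRingEnd ℂ 0) * (√(2 / 5) : ℝ) -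
      ((√(2 / 5) : ℝ) * 0 + (√(3 / 5) : ℝ) * starRingEnd ℂ u) * starRingEnd ℂ ((√(3 / 5) : ℝ) : ℂ)
      with hz₁
    have hz₁' : z₁ = (2 / 5) * u - (3 / 5) * starRingEnd ℂ u := by
      have f1 := sq_cast (r := 2 / 5) (by norm_num)
      have f2 := sq_cast (r := 3 / 5) (by norm_num)
      push_cast at f1 f2
      rw [hz₁, Complex.conj_ofReal, map_zero]
      linear_combination u * f1 - starRingEnd ℂ u * f2
    have hz₁n : ‖z₁‖ ^ 2 = 1 / 2 := by
      rw [hz₁', ← Complex.normSq_eq_norm_sq, Complex.normSq_apply]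
      have hre : (2 / 5 * u - 3 / 5 * starRingEnd ℂ u : ℂ).re = -(1 / 5) * √(25 / 48) := by
        simp [hu]
        norm_num
        ring
      have him : (2 / 5 * u - 3 / 5 * starRingEnd ℂ u : ℂ).im = √(23 / 48) := by
        simp [hu]
        norm_num
        ring
      rw [hre, him, Real.mul_self_sqrt (by norm_num)]
      nlinarith [Real.mul_self_sqrt (show (0 : ℝ) ≤ 25 / 48 by norm_num)]
    have hsum := norm_ofPair_sq z₁ (((√(2 / 5) : ℝ) * u - (√(3 / 5) : ℝ) * starRingEnd ℂ 0) *
      (√(3 / 5) : ℝ) + ((√(2 / 5) : ℝ) * 0 + (√(3 / 5) : ℝ) * starRingEnd ℂ u) *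
        starRingEnd ℂ ((√(2 / 5) : ℝ) : ℂ))
    rw [hn, hz₁n] at hsum
    exact ofPair_mem_of_norm_eq hT h1 (norm_sqrt hz₁n) (norm_sqrt (by linarith))
  rw [eq_ofPair q]
  set a : ℂ := ⟨q.re, q.imI⟩
  set c : ℂ := ⟨q.imJ, q.imK⟩
  have hac : ‖a‖ ^ 2 + ‖c‖ ^ 2 = 1 := by
    rw [← norm_ofPair_sq, ← eq_ofPair, hq, one_pow]
  have ha1 : ‖a‖ ≤ 1 := by nlinarith [sq_nonneg ‖c‖, norm_nonneg a]
  set u : ℂ := ⟨‖c‖, ‖a‖⟩ with hu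
  have hu1 : ‖u‖ = 1 := by
    have : ‖u‖ ^ 2 = 1 := by
      rw [← Complex.normSq_eq_norm_sq, Complex.normSq_apply, hu]
      simp only
      linarith
    nlinarith [norm_nonneg u]
  have h1 := S.mul_mem (S.mul_mem hhalf (hT u hu1)) hhalf
  rw [ofPair_mul, ofPair_mul] at h1
  have f1 := sq_cast (r := 1 / 2) (by norm_num)
  push_cast at f1
  refine ofPair_mem_of_norm_eq hT h1 (Eq.symm ?_) (Eq.symm ?_)
  · have : ((√(1 / 2) : ℝ) * u - (√(1 / 2) : ℝ) * starRingEnd ℂ 0) * ((√(1 / 2) : ℝ) : ℂ) -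
        ((√(1 / 2) : ℝ) * 0 + (√(1 / 2) : ℝ) * starRingEnd ℂ u) * starRingEnd ℂ ((√(1 / 2) : ℝ) : ℂ) =
        (‖a‖ : ℂ) * Complex.I := by
      have h2 : u - starRingEnd ℂ u = 2 * (‖a‖ : ℂ) * Complex.I := by
        apply Complex.ext <;> simp [hu]
        ring
      rw [Complex.conj_ofReal, map_zero]
      linear_combination (u - starRingEnd ℂ u) * f1 + (1 / 2 : ℂ) * h2
    rw [this]
    simp
  · have : ((√(1 / 2) : ℝ) * u - (√(1 / 2) : ℝ) * starRingEnd ℂ 0) * ((√(1 / 2) : ℝ) : ℂ) +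
        ((√(1 / 2) : ℝ) * 0 + (√(1 / 2) : ℝ) * starRingEnd ℂ u) * starRingEnd ℂ ((√(1 / 2) : ℝ) : ℂ) =
        (‖c‖ : ℂ) := by
      have h2 : u + starRingEnd ℂ u = 2 * (‖c‖ : ℂ) := by
        apply Complex.ext <;> simp [hu]
        ring
      rw [Complex.conj_ofReal, map_zero]
      linear_combination (u + starRingEnd ℂ u) * f1 + (1 / 2 : ℂ) * h2
    rw [this]
    simp

/-- The element `1 - m i` intertwines `i` and `m`, since both squares are `-1`. It vanishes only for
`m = -i`, where `j` does the job. -/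
theorem exists_conj_eq_of_pure {m : ℍ[ℝ]} (hm : m.re = 0) (hm1 : ‖m‖ = 1) :
    ∃ g : ℍ[ℝ], g ≠ 0 ∧ g * ofPair Complex.I 0 = m * g := by
  have hmm : m * m = -1 := by
    have h1 : normSq m = 1 := by rw [normSq_eq_norm_mul_self, hm1, one_mul]
    have h2 := self_mul_star m
    have h3 : star m = -m := by
      ext <;> simp [hm]
    rw [h3, h1, mul_neg] at h2
    rw [← neg_neg (m * m), h2]
    simp
  have hii : ofPair Complex.I 0 * ofPair Complex.I 0 = -1 := by
    rw [ofPair_mul]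
    ext <;> simp
  by_cases h : m * ofPair Complex.I 0 = 1
  · refine ⟨ofPair 0 1, ?_, ?_⟩
    · intro h0
      simpa using congrArg QuaternionAlgebra.imJ h0
    · have h1 : m = -ofPair Complex.I 0 := by
        calc m = -(m * (ofPair Complex.I 0 * ofPair Complex.I 0)) := by rw [hii]; simp
          _ = _ := by rw [← mul_assoc, h, one_mul]
      rw [h1, neg_mul, ofPair_mul, ofPair_mul]
      ext <;> simp
  · refine ⟨1 - m * ofPair Complex.I 0, sub_ne_zero.2 (Ne.symm h), ?_⟩
    rw [sub_mul, one_mul, mul_assoc, hii, mul_sub, ← mul_assoc, hmm]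
    simp
    abel

theorem re_mul_comm (p q : ℍ[ℝ]) : (p * q).re = (q * p).re := by
  simp
  ring

/-- Two unit quaternions that generate a dense subgroup of the unit quaternions. -/
theorem mem_of_generators_mem (hS : IsClosed (S : Set ℍ[ℝ])) (hinv : ∀ a ∈ S, a⁻¹ ∈ S)
    (hx : (⟨1 / 4, 3 / 4, √3 / 4, -(√3 / 4)⟩ : ℍ[ℝ]) ∈ S)
    (hy : (⟨1 / 4, 3 / 4, -(√3 / 4), -(√3 / 4)⟩ : ℍ[ℝ]) ∈ S) {q : ℍ[ℝ]} (hq : ‖q‖ = 1) :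
    q ∈ S := by
  set x : ℍ[ℝ] := ⟨1 / 4, 3 / 4, √3 / 4, -(√3 / 4)⟩
  set y : ℍ[ℝ] := ⟨1 / 4, 3 / 4, -(√3 / 4), -(√3 / 4)⟩
  have hx0 : x.re = 1 / 4 := rfl
  have hxI : x.imI = 3 / 4 := rfl
  have hxJ : x.imJ = √3 / 4 := rfl
  have hxK : x.imK = -(√3 / 4) := rfl
  have hy0 : y.re = 1 / 4 := rfl
  have hyI : y.imI = 3 / 4 := rfl
  have hyJ : y.imJ = -(√3 / 4) := rfl
  have hyK : y.imK = -(√3 / 4) := rfl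
  clear_value x y
  have h3 : √3 * √3 = 3 := Real.mul_self_sqrt (by norm_num)
  have h15 : √15 * √15 = 15 := Real.mul_self_sqrt (by norm_num)
  have h15p : 0 < √15 := Real.sqrt_pos.2 (by norm_num)
  have hx1 : ‖x‖ = 1 := by
    have := normSq_eq_norm_mul_self x
    rw [normSq_def'] at this
    simp only [hx0, hxI, hxJ, hxK] at this
    nlinarith [norm_nonneg x]
  have hy1 : ‖y‖ = 1 := by
    have := normSq_eq_norm_mul_self y
    rw [normSq_def'] at this
    simp only [hy0, hyI, hyJ, hyK] at this
    nlinarith [norm_nonneg y]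
  set m : ℍ[ℝ] := (4 / √15) • x.im with hm
  have hm1 : ‖m‖ = 1 := by
    have := normSq_eq_norm_mul_self x.im
    rw [normSq_def'] at this
    simp only [re_im, imI_im, imJ_im, imK_im, hxI, hxJ, hxK] at this
    have hxim : ‖x.im‖ = √15 / 4 := by
      have h0 : ‖x.im‖ * ‖x.im‖ = (√15 / 4) * (√15 / 4) := by rw [← this]; nlinarith
      exact (mul_self_inj (norm_nonneg _) (by positivity)).1 h0
    rw [hm, norm_smul, hxim, Real.norm_eq_abs, abs_of_pos (by positivity)]
    field_simp
  obtain ⟨g, hg0, hg⟩ := exists_conj_eq_of_pure (m := m) (by simp [hm]) hm1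
  let S' : Submonoid ℍ[ℝ] :=
    { carrier := {z | g * z * g⁻¹ ∈ S}
      one_mem' := by
        show g * 1 * g⁻¹ ∈ S
        rw [mul_one, mul_inv_cancel₀ hg0]; exact S.one_mem
      mul_mem' := by
        intro a c ha hc
        have := S.mul_mem ha hc
        show g * (a * c) * g⁻¹ ∈ S
        convert this using 1
        rw [mul_assoc (g * a), mul_assoc g c, ← mul_assoc g⁻¹ g, inv_mul_cancel₀ hg0, one_mul]
        simp only [mul_assoc] }
  have hS'mem : ∀ z, z ∈ S' ↔ g * z * g⁻¹ ∈ S := fun z => Iff.rfl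
  have hS' : IsClosed (S' : Set ℍ[ℝ]) := by
    have : Continuous fun z : ℍ[ℝ] => g * z * g⁻¹ := by fun_prop
    exact hS.preimage this
  have hinv' : ∀ a ∈ S', a⁻¹ ∈ S' := by
    intro a ha
    rw [hS'mem] at ha ⊢
    have := hinv _ ha
    rwa [mul_inv_rev, mul_inv_rev, inv_inv, ← mul_assoc] at this
  have back : ∀ z, z ∈ S ↔ g⁻¹ * z * g ∈ S' := by
    intro z
    rw [hS'mem]
    have : g * (g⁻¹ * z * g) * g⁻¹ = z := by
      rw [← mul_assoc, ← mul_assoc, mul_inv_cancel₀ hg0, one_mul, mul_assoc, mul_inv_cancel₀ hg0,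
        mul_one]
    rw [this]
  have hcos : Real.cos (Real.arccos (1 / 4)) = 1 / 4 := Real.cos_arccos (by norm_num) (by norm_num)
  have hsin : Real.sin (Real.arccos (1 / 4)) = √15 / 4 := by
    rw [Real.sin_arccos]
    have : (1 - (1 / 4) ^ 2 : ℝ) = (√15 / 4) ^ 2 := by nlinarith
    rw [this, Real.sqrt_sq (by positivity)]
  have hx' : g⁻¹ * x * g = ofPair (Complex.exp ((Real.arccos (1 / 4) : ℝ) * Complex.I)) 0 := by
    have e1 : x = ((1 / 4 : ℝ) : ℍ[ℝ]) + (√15 / 4) • m := by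
      have : (√15 / 4) • m = x.im := by
        rw [hm, smul_smul]
        have : √15 / 4 * (4 / √15) = 1 := by field_simp
        rw [this, one_smul]
      rw [this]
      rw [← hx0, re_add_im]
    have e2 : g⁻¹ * m * g = ofPair Complex.I 0 := by
      rw [mul_assoc, ← hg, ← mul_assoc, inv_mul_cancel₀ hg0, one_mul]
    rw [e1, mul_add, add_mul, Algebra.mul_smul_comm, Algebra.smul_mul_assoc, e2,
      ← coe_commutes, mul_assoc, inv_mul_cancel₀ hg0, mul_one, Complex.exp_mul_I,
      ← Complex.ofReal_cos, ← Complex.ofReal_sin, hcos, hsin]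
    generalize (1 / 4 : ℝ) = c, √15 / 4 = s
    ext <;> simp
  have hxS : ofPair (Complex.exp ((Real.arccos (1 / 4) : ℝ) * Complex.I)) 0 ∈ S' := by
    rw [← hx']; exact (back x).1 hx
  have hT : ∀ z : ℂ, ‖z‖ = 1 → ofPair z 0 ∈ S' := fun z hz =>
    ofPair_mem_of_cos hS' hinv' hcos hxS hz
  set y' := g⁻¹ * y * g with hy'
  have hyS : y' ∈ S' := (back y).1 hy
  have hy'n : ‖y'‖ = 1 := by
    rw [hy', norm_mul, norm_mul, norm_inv, hy1, mul_one, inv_mul_cancel₀ (norm_ne_zero_iff.2 hg0)]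
  have hy're : y'.re = 1 / 4 := by
    rw [hy', re_mul_comm, ← mul_assoc, mul_inv_cancel₀ hg0, one_mul, hy0]
  -- Real parts are conjugation invariant. This one determines the component of `y'` along the axis
  -- of `x`, and so the moduli `2 / 5` and `3 / 5`.
  have hyx : (y' * (g⁻¹ * x * g)).re = -(1 / 2) := by
    have : y' * (g⁻¹ * x * g) = g⁻¹ * (y * x * g) := by
      rw [hy', mul_assoc (g⁻¹ * y), ← mul_assoc g (g⁻¹ * x), ← mul_assoc g g⁻¹, mul_inv_cancel₀ hg0,
        one_mul]
      simp only [mul_assoc]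
    rw [this, re_mul_comm, mul_assoc, mul_inv_cancel₀ hg0, mul_one]
    rw [re_mul, hx0, hxI, hxJ, hxK, hy0, hyI, hyJ, hyK]
    nlinarith
  have hI : y'.imI * √15 = 9 / 4 := by
    rw [hx', Complex.exp_mul_I, ← Complex.ofReal_cos, ← Complex.ofReal_sin, hcos, hsin] at hyx
    simp [hy're] at hyx
    linarith
  have hfirst : ‖(⟨y'.re, y'.imI⟩ : ℂ)‖ ^ 2 = 2 / 5 := by
    rw [← Complex.normSq_eq_norm_sq, Complex.normSq_apply]
    simp only [hy're]
    have : (y'.imI * √15) * (y'.imI * √15) = (9 / 4) * (9 / 4) := by rw [hI]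
    nlinarith
  have hsecond : ‖(⟨y'.imJ, y'.imK⟩ : ℂ)‖ ^ 2 = 3 / 5 := by
    have := norm_ofPair_sq ⟨y'.re, y'.imI⟩ ⟨y'.imJ, y'.imK⟩
    rw [← eq_ofPair, hy'n, hfirst] at this
    linarith
  rw [back]
  refine mem_of_circle_of_ofPair hT (eq_ofPair y' ▸ hyS) hfirst hsecond ?_
  rw [norm_mul, norm_mul, norm_inv, hq, mul_one, inv_mul_cancel₀ (norm_ne_zero_iff.2 hg0)]

end density

/-- The Solovay–Kitaev theorem for words in two explicit generators. -/
theorem solovayKitaev_of_generators {word : ℕ → ℍ[ℝ] → Prop} (hnorm : ∀ L a, word L a → ‖a‖ = 1)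
    (hmul : ∀ L L' a c, word L a → word L' c → word (L + L') (a * c))
    (hinv : ∀ L a, word L a → word L a⁻¹) (hone : word 0 1)
    (hmono : ∀ L L' a, word L a → L ≤ L' → word L' a) {L : ℕ}
    (hx : word L ⟨1 / 4, 3 / 4, √3 / 4, -(√3 / 4)⟩)
    (hy : word L ⟨1 / 4, 3 / 4, -(√3 / 4), -(√3 / 4)⟩) :
    ∃ K : ℝ, ∀ q : ℍ[ℝ], ‖q‖ = 1 → ∀ ε : ℝ, 0 < ε →
      ∃ (L' : ℕ) (a : ℍ[ℝ]), word L' a ∧ ‖q - a‖ < ε ∧ (L' : ℝ) ≤ K * (1 + Real.log (1 / ε) ^ 4) := by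
  let G : Submonoid ℍ[ℝ] :=
    { carrier := {a | ∃ L, word L a}
      one_mem' := ⟨0, hone⟩
      mul_mem' := by
        rintro a c ⟨L, ha⟩ ⟨L', hc⟩
        exact ⟨_, hmul _ _ _ _ ha hc⟩ }
  have hGn : ∀ a ∈ G.topologicalClosure, ‖a‖ = 1 := by
    intro a ha
    have h1 : closure (G : Set ℍ[ℝ]) ⊆ {a | ‖a‖ = 1} :=
      closure_minimal (fun a ⟨L, ha⟩ => hnorm L a ha) (isClosed_eq continuous_norm continuous_const)
    exact h1 ha
  have hinv' : ∀ a ∈ G.topologicalClosure, a⁻¹ ∈ G.topologicalClosure := by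
    intro a ha
    have hstar : ∀ c : ℍ[ℝ], ‖c‖ = 1 → c⁻¹ = star c := by
      intro c hc
      have h1 : normSq c = 1 := by rw [normSq_eq_norm_mul_self, hc, one_mul]
      rw [inv_def, h1]; simp
    rw [hstar a (hGn a ha)]
    have : closure (G : Set ℍ[ℝ]) ⊆ star ⁻¹' closure (G : Set ℍ[ℝ]) := by
      refine closure_minimal ?_ (isClosed_closure.preimage continuous_star)
      rintro c ⟨L, hc⟩
      refine subset_closure ⟨L, ?_⟩
      rw [← hstar c (hnorm L c hc)]
      exact hinv L c hc
    exact this ha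
  have hdense : ∀ q : ℍ[ℝ], ‖q‖ = 1 → q ∈ closure (G : Set ℍ[ℝ]) := fun q hq =>
    mem_of_generators_mem (S := G.topologicalClosure) G.isClosed_topologicalClosure hinv'
      (G.le_topologicalClosure ⟨L, hx⟩) (G.le_topologicalClosure ⟨L, hy⟩) hq
  set η : ℝ := Real.exp (-1) / 900 with hη
  have hη0 : 0 < η := by positivity
  -- Compactness turns density into a finite net, hence into one word length that serves the whole
  -- sphere at the initial precision.
  have hcompact : IsCompact (Metric.sphere (0 : ℍ[ℝ]) 1) := isCompact_sphere _ _
  obtain ⟨t, htG, htf, htc⟩ := hcompact.elim_finite_subcover_image (b := (G : Set ℍ[ℝ]))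
    (c := fun a => Metric.ball a η) (fun _ _ => Metric.isOpen_ball) (by
      intro q hq
      obtain ⟨a, ha, hqa⟩ := Metric.mem_closure_iff.1 (hdense q (by simpa using hq)) η hη0
      exact Set.mem_biUnion ha hqa)
  choose! len hlen using fun a (ha : a ∈ G) => ha
  set L₀ := ∑ a ∈ htf.toFinset, len a with hL₀
  refine solovayKitaev hnorm hmul hinv (L := L₀) fun q hq => ?_
  obtain ⟨a, ha, hqa⟩ := Set.mem_iUnion₂.1 (htc (by simpa using hq : q ∈ Metric.sphere (0 : ℍ[ℝ]) 1))
  refine ⟨a, hmono _ _ _ (hlen a (htG ha)) ?_, ?_⟩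
  · exact Finset.single_le_sum (f := len) (fun _ _ => Nat.zero_le _) (htf.mem_toFinset.2 ha)
  · rw [← dist_eq_norm]
    exact (Metric.mem_ball.1 hqa).le

end PolyLocal

end

/-! ### Approximation by circuits, up to a global phase. -/

section

open scoped Matrix.Norms.L2Operator
open Matrix

namespace PolyLocal

section approximation
variable {n : ℕ}

/-- `U` is exactly a product of at most `m` elementary gates. -/
def Realizable (m : ℕ) (U : Op n) : Prop :=
  ∃ C : Circuit n, C.length ≤ m ∧ (C.map PlacedGate.matrix).prod = U

theorem Realizable.one : Realizable 0 (1 : Op n) := ⟨[], by simp, by simp⟩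

theorem Realizable.mul {m m' : ℕ} {U V : Op n} (hU : Realizable m U) (hV : Realizable m' V) :
    Realizable (m + m') (U * V) := by
  obtain ⟨C, hC, rfl⟩ := hU
  obtain ⟨C', hC', rfl⟩ := hV
  exact ⟨C ++ C', by rw [List.length_append]; omega, by simp⟩

theorem Realizable.mono {m m' : ℕ} {U : Op n} (hU : Realizable m U) (h : m ≤ m') :
    Realizable m' U := by
  obtain ⟨C, hC, rfl⟩ := hU
  exact ⟨C, hC.trans h, rfl⟩

theorem Realizable.gate (g : PlacedGate n) : Realizable 1 g.matrix := ⟨[g], by simp, by simp⟩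

theorem Realizable.place {k m : ℕ} {U : Op k} (hU : Realizable m U) (w : Fin k ↪ Fin n) :
    Realizable m (place w U) := by
  obtain ⟨C, hC, rfl⟩ := hU
  refine ⟨C.map fun g => ⟨g.arity, g.gate, g.wires.trans w⟩, by simpa using hC, ?_⟩
  rw [List.map_map, map_list_prod, List.map_map]
  congr 2
  funext g
  simp [PlacedGate.matrix_eq, place_place]

theorem Realizable.mem_unitary {m : ℕ} {U : Op n} (hU : Realizable m U) : U ∈ unitary (Op n) := by
  obtain ⟨C, -, rfl⟩ := hU
  refine Submonoid.list_prod_mem _ ?_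
  intro U hU
  obtain ⟨g, -, rfl⟩ := List.mem_map.1 hU
  exact g.matrix_mem_unitary

theorem Realizable.hadamardOn (t : Fin n) : Realizable 1 (hadamardOn t) := by
  have := Realizable.gate (n := n) ⟨1, .hadamard, oneWire t⟩
  rwa [PlacedGate.matrix_eq] at this

theorem Realizable.flip (t : Fin n) : Realizable 1 (mapMatrix (ctrlFlip ∅ t)) := by
  have := Realizable.gate (n := n) ⟨1, .not, oneWire t⟩
  rw [PlacedGate.matrix_eq, not_eq_mapMatrix, place_mapMatrix_ctrlFlip _ (by simp)] at this
  simpa using this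

theorem Realizable.controlledPhase {s t : Fin n} (h : s ≠ t) (k : ℕ) :
    Realizable k (phaseOn {s, t} (k * (Real.pi / 2))) := by
  induction k with
  | zero => simpa [phaseOn_zero] using Realizable.one
  | succ k ih =>
    have := Realizable.gate (n := n) ⟨2, .controlledPhase, twoWires s t h⟩
    rw [PlacedGate.matrix_eq, controlledPhase_eq_phaseOn, place_phaseOn] at this
    rw [Nat.cast_succ, add_mul, one_mul, phaseOn_add]
    refine ih.mul ?_
    simpa using this

theorem norm_le_one_of_mem_unitary {U : Op n} (h : U ∈ unitary (Op n)) : ‖U‖ ≤ 1 := by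
  have h1 : ‖Uᴴ * U‖ = ‖U‖ * ‖U‖ := l2_opNorm_conjTranspose_mul_self U
  rw [← star_eq_conjTranspose, (Unitary.mem_iff.1 h).1, CStarRing.norm_one] at h1
  nlinarith [norm_nonneg U]

/-- Up to a global phase, `U` is within `ε` of a product of at most `m` elementary gates. -/
def Approximable (m : ℕ) (ε : ℝ) (U : Op n) : Prop :=
  ∃ (c : ℂ) (V : Op n), ‖c‖ = 1 ∧ Realizable m V ∧ ‖U - c • V‖ ≤ ε

theorem Realizable.approximable {m : ℕ} {U : Op n} (h : Realizable m U) {ε : ℝ} (hε : 0 ≤ ε) :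
    Approximable m ε U :=
  ⟨1, U, by simp, h, by simpa using hε⟩

theorem Approximable.mul {m m' : ℕ} {ε ε' : ℝ} {U V : Op n} (hU : Approximable m ε U)
    (hV : Approximable m' ε' V) (h : V ∈ unitary (Op n)) :
    Approximable (m + m') (ε + ε') (U * V) := by
  obtain ⟨c, U', hc, hU', h1⟩ := hU
  obtain ⟨c', V', hc', hV', h2⟩ := hV
  refine ⟨c * c', U' * V', by rw [norm_mul, hc, hc', one_mul], hU'.mul hV', ?_⟩
  have e : U * V - (c * c') • (U' * V') = (U - c • U') * V + c • (U' * (V - c' • V')) := by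
    simp only [sub_mul, mul_sub, smul_sub, Matrix.smul_mul, Matrix.mul_smul, smul_smul]
    abel
  rw [e]
  have n1 := norm_le_one_of_mem_unitary h
  have n2 := norm_le_one_of_mem_unitary hU'.mem_unitary
  calc ‖(U - c • U') * V + c • (U' * (V - c' • V'))‖
      ≤ ‖(U - c • U') * V‖ + ‖c • (U' * (V - c' • V'))‖ := norm_add_le _ _
    _ ≤ ‖U - c • U'‖ * ‖V‖ + 1 * (‖U'‖ * ‖V - c' • V'‖) := by
      rw [norm_smul, hc]
      gcongr <;> exact norm_mul_le _ _
    _ ≤ ε * 1 + 1 * (1 * ε') := by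
      have : 0 ≤ ε := (norm_nonneg _).trans h1
      gcongr
    _ = ε + ε' := by ring

theorem Approximable.mono {m m' : ℕ} {ε ε' : ℝ} {U : Op n} (hU : Approximable m ε U) (hm : m ≤ m')
    (hε : ε ≤ ε') : Approximable m' ε' U := by
  obtain ⟨c, V, hc, hV, h⟩ := hU
  exact ⟨c, V, hc, hV.mono hm, h.trans hε⟩

theorem Approximable.place {k m : ℕ} {ε : ℝ} {U : Op k} (hU : Approximable m ε U)
    (w : Fin k ↪ Fin n) : Approximable m ε (place w U) := by
  obtain ⟨c, V, hc, hV, h⟩ := hU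
  refine ⟨c, _, hc, hV.place w, ?_⟩
  rw [← map_smul, ← map_sub]
  exact (norm_place_le _ _).trans h

theorem Approximable.smul {m : ℕ} {ε : ℝ} {U : Op n} (hU : Approximable m ε U) {a : ℂ}
    (ha : ‖a‖ = 1) : Approximable m ε (a • U) := by
  obtain ⟨c, V, hc, hV, h⟩ := hU
  refine ⟨a * c, V, by rw [norm_mul, ha, hc, one_mul], hV, ?_⟩
  rwa [mul_smul, ← smul_sub, norm_smul, ha, one_mul]

/-- The members of a family of operators are approximated, uniformly, with a number of gates that is
polylogarithmic in the inverse precision. -/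
def Efficient {ι : Type*} (F : ι → Op n) : Prop :=
  ∃ K : ℝ, ∀ i, ∀ ε : ℝ, 0 < ε →
    ∃ m : ℕ, (m : ℝ) ≤ K * (1 + Real.log (1 / ε) ^ 4) ∧ Approximable m ε (F i)

variable {ι κ : Type*}

theorem Efficient.comp {F : ι → Op n} (hF : Efficient F) (f : κ → ι) :
    Efficient fun j => F (f j) := by
  obtain ⟨K, hK⟩ := hF
  exact ⟨K, fun j => hK (f j)⟩

theorem Realizable.efficient {m : ℕ} {U : Op n} (hU : Realizable m U) :
    Efficient fun _ : ι => U := by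
  refine ⟨m, fun _ ε hε => ⟨m, ?_, hU.approximable hε.le⟩⟩
  have : 0 ≤ Real.log (1 / ε) ^ 4 := by positivity
  nlinarith [(Nat.cast_nonneg m : (0 : ℝ) ≤ m)]

/-- Used with `a = log 2`: halving the precision costs only a constant factor. -/
theorem one_add_add_pow_four_le {a : ℝ} (ha : 0 ≤ a) (ha1 : a ≤ 1) (y : ℝ) :
    1 + (a + y) ^ 4 ≤ 9 * (1 + y ^ 4) := by
  have h1 : (a + y) ^ 2 ≤ 2 * (1 + y ^ 2) := by nlinarith [sq_nonneg (a - y)]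
  have h2 : ((a + y) ^ 2) ^ 2 ≤ (2 * (1 + y ^ 2)) ^ 2 := by gcongr
  nlinarith [sq_nonneg (y ^ 2 - 1), sq_nonneg (y ^ 2)]

theorem Efficient.mul {F G : ι → Op n} (hF : Efficient F) (hG : Efficient G)
    (hu : ∀ i, G i ∈ unitary (Op n)) : Efficient fun i => F i * G i := by
  obtain ⟨K, hK⟩ := hF
  obtain ⟨K', hK'⟩ := hG
  refine ⟨9 * (|K| + |K'|), fun i ε hε => ?_⟩
  obtain ⟨m, hm, hm'⟩ := hK i (ε / 2) (half_pos hε)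
  obtain ⟨k, hk, hk'⟩ := hK' i (ε / 2) (half_pos hε)
  refine ⟨m + k, ?_, (hm'.mul hk' (hu i)).mono le_rfl (by linarith)⟩
  have e : Real.log (1 / (ε / 2)) = Real.log 2 + Real.log (1 / ε) := by
    rw [← Real.log_mul (by norm_num) (by positivity)]
    congr 1
    field_simp
  have h2 : Real.log 2 ≤ 1 := by linarith [Real.log_two_lt_d9]
  have h3 := one_add_add_pow_four_le (Real.log_pos one_lt_two).le h2 (Real.log (1 / ε))
  rw [e] at hm hk
  set A := 1 + (Real.log 2 + Real.log (1 / ε)) ^ 4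
  have hA : 0 ≤ A := by positivity
  push_cast
  calc (m : ℝ) + k ≤ K * A + K' * A := add_le_add hm hk
    _ ≤ |K| * A + |K'| * A := by gcongr <;> exact le_abs_self _
    _ = (|K| + |K'|) * A := by ring
    _ ≤ (|K| + |K'|) * (9 * (1 + Real.log (1 / ε) ^ 4)) := by gcongr
    _ = _ := by ring

theorem Efficient.smul {F : ι → Op n} (hF : Efficient F) {c : ι → ℂ} (hc : ∀ i, ‖c i‖ = 1) :
    Efficient fun i => c i • F i := by
  obtain ⟨K, hK⟩ := hF
  refine ⟨K, fun i ε hε => ?_⟩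
  obtain ⟨m, hm, h⟩ := hK i ε hε
  exact ⟨m, hm, h.smul (hc i)⟩

end approximation

end PolyLocal

end

/-! ### Special unitary operators on two-dimensional subspaces. -/

section

open scoped Matrix.Norms.L2Operator Quaternion
open Matrix

namespace PolyLocal

section frames

/-- `2 × 2` special unitary matrices. -/
abbrev SU2 := specialUnitaryGroup (Fin 2) ℂ

/-- The operator that acts as `u` on the range of the isometry `J` and trivially on its orthogonal
complement. -/
noncomputable def frameOp {n : ℕ} (J : Matrix (Fin n → Fin 2) (Fin 2) ℂ)
    (u : Matrix (Fin 2) (Fin 2) ℂ) : Op n :=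
  1 + J * (u - 1) * Jᴴ

variable {n : ℕ} {J Q : Matrix (Fin n → Fin 2) (Fin 2) ℂ}

theorem frameOp_mul (hJ : Jᴴ * J = 1) (u v : Matrix (Fin 2) (Fin 2) ℂ) :
    frameOp J u * frameOp J v = frameOp J (u * v) := by
  have h : J * (u - 1) * Jᴴ * (J * (v - 1) * Jᴴ) = J * ((u - 1) * (v - 1)) * Jᴴ := by
    calc J * (u - 1) * Jᴴ * (J * (v - 1) * Jᴴ)
        = J * (u - 1) * (Jᴴ * J) * (v - 1) * Jᴴ := by simp only [Matrix.mul_assoc]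
      _ = _ := by rw [hJ]; simp only [Matrix.mul_assoc, Matrix.mul_one]
  have h2 : u * v - 1 = (u - 1) + (v - 1) + (u - 1) * (v - 1) := by noncomm_ring
  rw [frameOp, frameOp, frameOp, h2, add_mul, mul_add, mul_add, h, mul_one, mul_one, one_mul]
  simp only [Matrix.mul_add, Matrix.add_mul]
  abel

theorem frameOp_one : frameOp J 1 = 1 := by
  simp [frameOp]

theorem star_frameOp (u : Matrix (Fin 2) (Fin 2) ℂ) : star (frameOp J u) = frameOp J (star u) := by
  simp only [frameOp, star_eq_conjTranspose, conjTranspose_add, conjTranspose_one,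
    conjTranspose_mul, conjTranspose_conjTranspose, conjTranspose_sub, Matrix.mul_assoc]

theorem frameOp_mem_unitary (hJ : Jᴴ * J = 1) (u : SU2) : frameOp J u ∈ unitary (Op n) := by
  have hu := Unitary.mem_iff.1 (specialUnitaryGroup_le_unitaryGroup u.2)
  rw [Unitary.mem_iff, star_frameOp, frameOp_mul hJ, frameOp_mul hJ, hu.1, hu.2, frameOp_one]
  exact ⟨rfl, rfl⟩

theorem frameOp_mul_self (hJ : Jᴴ * J = 1) (u : Matrix (Fin 2) (Fin 2) ℂ) :
    frameOp J u * J = J * u := by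
  rw [frameOp, Matrix.add_mul, Matrix.one_mul, Matrix.mul_assoc, hJ, Matrix.mul_one, Matrix.mul_sub,
    Matrix.mul_one]
  abel

theorem norm_le_one_of_isometry (hJ : Jᴴ * J = 1) : ‖J‖ ≤ 1 := by
  have h1 := l2_opNorm_conjTranspose_mul_self J
  rw [hJ, CStarRing.norm_one] at h1
  nlinarith [norm_nonneg J]

theorem norm_frameOp_sub_le (hJ : Jᴴ * J = 1) (u v : Matrix (Fin 2) (Fin 2) ℂ) :
    ‖frameOp J u - frameOp J v‖ ≤ ‖u - v‖ := by
  have e : frameOp J u - frameOp J v = J * (u - v) * Jᴴ := by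
    simp only [frameOp, Matrix.mul_sub, Matrix.sub_mul]
    abel
  have h1 := norm_le_one_of_isometry hJ
  rw [e]
  calc ‖J * (u - v) * Jᴴ‖ ≤ ‖J * (u - v)‖ * ‖Jᴴ‖ := l2_opNorm_mul _ _
    _ ≤ (‖J‖ * ‖u - v‖) * ‖Jᴴ‖ := by gcongr; exact l2_opNorm_mul _ _
    _ ≤ (1 * ‖u - v‖) * 1 := by
      rw [l2_opNorm_conjTranspose]
      gcongr
    _ = _ := by ring

/-- All special unitary operators on the range of `J` are efficiently approximable. -/
structure GoodFrame (J : Matrix (Fin n → Fin 2) (Fin 2) ℂ) : Prop where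
  isometry : Jᴴ * J = 1
  efficient : Efficient fun u : SU2 => frameOp J u

/-- Conjugation by `g` carries operators on the range of `J` to operators on the range of `Q`. The
change of basis `r` inside the plane is harmless because `SU2` is stable under unitary conjugation.
-/
theorem GoodFrame.of_mul_eq (hJ : GoodFrame J) (hQ : Qᴴ * Q = 1) {g : Op n}
    {r : Matrix (Fin 2) (Fin 2) ℂ} (hg : g ∈ unitary (Op n)) (hr : r ∈ unitary (Matrix _ _ ℂ))
    (h1 : Efficient fun _ : SU2 => g) (h2 : Efficient fun _ : SU2 => star g) (h : g * J = Q * r) :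
    GoodFrame Q := by
  refine ⟨hQ, ?_⟩
  have hQJ : Q = g * J * star r := by
    rw [h, Matrix.mul_assoc, (Unitary.mem_iff.1 hr).2, Matrix.mul_one]
  have hconj : ∀ u : SU2, star r * (u : Matrix (Fin 2) (Fin 2) ℂ) * r ∈ SU2 := by
    intro u
    rw [mem_specialUnitaryGroup_iff]
    refine ⟨mul_mem (mul_mem (Unitary.star_mem hr) (specialUnitaryGroup_le_unitaryGroup u.2)) hr,
      ?_⟩
    have hd := (mem_specialUnitaryGroup_iff.1 u.2).2
    rw [det_mul, det_mul, hd, mul_one, ← det_mul, (Unitary.mem_iff.1 hr).1, det_one]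
  have key : ∀ u : SU2, frameOp Q u = g * frameOp J (star r * (u : Matrix (Fin 2) (Fin 2) ℂ) * r) *
      star g := by
    intro u
    have e1 : star r * (u : Matrix (Fin 2) (Fin 2) ℂ) * r - 1 =
        star r * ((u : Matrix (Fin 2) (Fin 2) ℂ) - 1) * r := by
      rw [mul_sub, sub_mul, mul_one, (Unitary.mem_iff.1 hr).1]
    rw [frameOp, frameOp, mul_add, add_mul, mul_one, (Unitary.mem_iff.1 hg).2, e1, hQJ]
    simp only [conjTranspose_mul, star_eq_conjTranspose, conjTranspose_conjTranspose,
      Matrix.mul_assoc]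
  simp only [key]
  refine Efficient.mul (h1.mul (hJ.efficient.comp fun u => ⟨_, hconj u⟩) ?_) h2
    fun _ => Unitary.star_mem hg
  exact fun u => frameOp_mem_unitary hJ.isometry ⟨_, hconj u⟩

/-- If `J = [e, v]` and `J' = [e, c v + s u]` are good frames, then so is `Q = [e, u]`. -/
theorem GoodFrame.orthogonal {J' : Matrix (Fin n → Fin 2) (Fin 2) ℂ} (hJ : GoodFrame J)
    (hJ' : GoodFrame J') (hQ : Qᴴ * Q = 1) (hJQ : Jᴴ * Q = !![1, 0; 0, 0])
    (hE : J * !![(1 : ℂ), 0; 0, 0] = Q * !![(1 : ℂ), 0; 0, 0]) {c s : ℝ}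
    (hJ'eq : J' = J * !![1, 0; 0, (c : ℂ)] + Q * !![0, 0; 0, (s : ℂ)]) (hs : 0 < s)
    (hcs : c ^ 2 + s ^ 2 = 1) (hle : c ^ 2 ≤ s ^ 2) : GoodFrame Q := by
  -- The aim is a rotation in `J'` followed by one in `J` that moves the plane of `J` onto that of
  -- `Q`. With cosine `-p ^ 2` for `w₂`, the compression of the first rotation to `J` is singular
  -- with range spanned by `(p, q)`, and `w₁` turns this vector onto the line of `e`. This needs
  -- `|c| ≤ s`.
  obtain ⟨p, hp⟩ : ∃ p : ℝ, p * s = c := ⟨c / s, by field_simp⟩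
  have hp1 : p ^ 2 ≤ 1 := by
    rw [← hp, mul_pow] at hle
    have : 0 < s ^ 2 := by positivity
    nlinarith
  obtain ⟨q, hq⟩ : ∃ q : ℝ, q ^ 2 = 1 - p ^ 2 := ⟨√(1 - p ^ 2), Real.sq_sqrt (by linarith)⟩
  have hs2 : s ^ 2 * (1 + p ^ 2) = 1 := by
    rw [← hp] at hcs
    linarith
  set t : ℝ := q * s * (1 + p ^ 2) with ht
  have hrot : ∀ a b : ℝ, a ^ 2 + b ^ 2 = 1 →
      !![(a : ℂ), (b : ℂ); -(b : ℂ), (a : ℂ)] ∈ SU2 := by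
    intro a b hab
    have hab' : (a : ℂ) ^ 2 + (b : ℂ) ^ 2 = 1 := by exact_mod_cast hab
    rw [mem_specialUnitaryGroup_iff, mem_unitaryGroup_iff]
    constructor
    · ext i j
      fin_cases i <;> fin_cases j <;> simp [Matrix.mul_apply, Fin.sum_univ_two, star_apply] <;>
        first | linear_combination hab' | ring
    · rw [det_fin_two_of]
      linear_combination hab'
  have ht2 : (-p ^ 2) ^ 2 + t ^ 2 = 1 := by
    have : t ^ 2 = q ^ 2 * (1 + p ^ 2) * (s ^ 2 * (1 + p ^ 2)) := by rw [ht]; ring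
    rw [this, hs2, hq]; ring
  have hts : t * s = q := by
    have : t * s = q * (s ^ 2 * (1 + p ^ 2)) := by rw [ht]; ring
    rw [this, hs2, mul_one]
  let w₁ : SU2 := ⟨_, hrot (-p) (-q) (by rw [neg_sq, neg_sq, hq]; ring)⟩
  let w₂ : SU2 := ⟨_, hrot (-p ^ 2) t ht2⟩
  set r : Matrix (Fin 2) (Fin 2) ℂ := !![(p : ℂ), -(q : ℂ); -(q : ℂ), -(p : ℂ)] with hr
  have hru : r ∈ unitary (Matrix (Fin 2) (Fin 2) ℂ) := by
    have hpq : (p : ℂ) ^ 2 + (q : ℂ) ^ 2 = 1 := by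
      have : p ^ 2 + q ^ 2 = 1 := by rw [hq]; ring
      exact_mod_cast this
    rw [← unitaryGroup, mem_unitaryGroup_iff, hr]
    ext i j
    fin_cases i <;> fin_cases j <;> simp [Matrix.mul_apply, Fin.sum_univ_two, star_apply] <;>
      first | linear_combination hpq | ring
  have hu1 := frameOp_mem_unitary hJ.isometry w₁
  have hu2 := frameOp_mem_unitary hJ'.isometry w₂
  refine hJ.of_mul_eq hQ (g := frameOp J w₁ * frameOp J' w₂) (r := r) (mul_mem hu1 hu2) hru
    ((hJ.efficient.comp fun _ => w₁).mul (hJ'.efficient.comp fun _ => w₂) fun _ => hu2) ?_ ?_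
  · rw [star_mul, star_frameOp, star_frameOp]
    exact (hJ'.efficient.comp fun _ => star w₂).mul (hJ.efficient.comp fun _ => star w₁)
      fun _ => frameOp_mem_unitary hJ.isometry (star w₁)
  · set E : Matrix (Fin 2) (Fin 2) ℂ := !![1, 0; 0, 0] with hEdef
    set D : Matrix (Fin 2) (Fin 2) ℂ := !![1, 0; 0, (c : ℂ)] with hD
    set F : Matrix (Fin 2) (Fin 2) ℂ := !![0, 0; 0, (s : ℂ)] with hF
    have hDh : Dᴴ = D := by
      ext i j
      fin_cases i <;> fin_cases j <;> simp [hD]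
    have hFh : Fᴴ = F := by
      ext i j
      fin_cases i <;> fin_cases j <;> simp [hF]
    have hQJ : Qᴴ * J = E := by
      have := congrArg conjTranspose hJQ
      rw [conjTranspose_mul, conjTranspose_conjTranspose] at this
      rw [this]
      ext i j
      fin_cases i <;> fin_cases j <;> simp [hEdef]
    have hEF : E * F = 0 := by
      ext i j
      fin_cases i <;> fin_cases j <;> simp [hEdef, hF]
    have hFE : F * E = 0 := by
      ext i j
      fin_cases i <;> fin_cases j <;> simp [hEdef, hF]
    have hJ'J : J'ᴴ * J = D := by
      rw [hJ'eq, conjTranspose_add, conjTranspose_mul, conjTranspose_mul, Matrix.add_mul,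
        Matrix.mul_assoc, Matrix.mul_assoc, hJ.isometry, hQJ, hDh, hFh, hFE, Matrix.mul_one,
        add_zero]
    set A : Matrix (Fin 2) (Fin 2) ℂ := (w₁ : Matrix (Fin 2) (Fin 2) ℂ) *
      (1 + D * ((w₂ : Matrix (Fin 2) (Fin 2) ℂ) - 1) * D) with hA
    set B : Matrix (Fin 2) (Fin 2) ℂ := F * ((w₂ : Matrix (Fin 2) (Fin 2) ℂ) - 1) * D with hB
    have e2 : frameOp J' w₂ * J = J + J' * ((w₂ : Matrix (Fin 2) (Fin 2) ℂ) - 1) * D := by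
      rw [frameOp, Matrix.add_mul, Matrix.one_mul, Matrix.mul_assoc, hJ'J]
    have e1 : frameOp J w₁ * Q * F = Q * F := by
      rw [frameOp, Matrix.add_mul, Matrix.one_mul, Matrix.mul_assoc _ Jᴴ Q, hJQ, Matrix.add_mul,
        Matrix.mul_assoc _ E F, hEF, Matrix.mul_zero, add_zero]
    have e3 : frameOp J w₁ * frameOp J' w₂ * J = J * A + Q * B := by
      have e4 : frameOp J w₁ * J' = J * (w₁ : Matrix (Fin 2) (Fin 2) ℂ) * D + Q * F := by
        rw [hJ'eq, Matrix.mul_add, ← Matrix.mul_assoc, ← Matrix.mul_assoc, e1,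
          frameOp_mul_self hJ.isometry]
      rw [Matrix.mul_assoc, e2, Matrix.mul_add, frameOp_mul_self hJ.isometry, ← Matrix.mul_assoc,
        ← Matrix.mul_assoc, e4, hA, hB]
      simp only [Matrix.mul_add, Matrix.add_mul, Matrix.mul_assoc, Matrix.mul_one]
      abel
    have hpc : (p : ℂ) * s = c := by exact_mod_cast hp
    have hqc : (q : ℂ) ^ 2 = 1 - (p : ℂ) ^ 2 := by exact_mod_cast hq
    have htc : (t : ℂ) * s = q := by exact_mod_cast hts
    have hsc : (s : ℂ) ^ 2 * (1 + (p : ℂ) ^ 2) = 1 := by exact_mod_cast hs2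
    have htp : (t : ℂ) * c = p * q := by rw [← hpc, ← htc]; ring
    have hcc : (c : ℂ) ^ 2 * (1 + (p : ℂ) ^ 2) = p ^ 2 := by
      rw [← hpc]; linear_combination (p : ℂ) ^ 2 * hsc
    have hw : (w₂ : Matrix (Fin 2) (Fin 2) ℂ) - 1 =
        !![-(p : ℂ) ^ 2 - 1, (t : ℂ); -(t : ℂ), -(p : ℂ) ^ 2 - 1] := by
      ext i j
      fin_cases i <;> fin_cases j <;> simp [w₂]
    -- The vanishing second row says that the image has no component along `v`, so it lies in the
    -- span of `e` and `u`.
    have hAe : A = !![(p : ℂ), -(q : ℂ); 0, 0] := by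
      have hm : 1 + D * ((w₂ : Matrix (Fin 2) (Fin 2) ℂ) - 1) * D =
          !![-(p : ℂ) ^ 2, p * q; -(p * q), 1 - (p : ℂ) ^ 2] := by
        rw [hw, hD, mul_fin_two, mul_fin_two]
        ext i j
        fin_cases i <;> fin_cases j <;> simp
        · linear_combination htp
        · linear_combination htp
        · linear_combination -hcc
      rw [hA, hm]
      ext i j
      fin_cases i <;> fin_cases j <;> simp [w₁, Matrix.mul_apply, Fin.sum_univ_two]
      · linear_combination (p : ℂ) * hqc
      · ring
      · ring
      · linear_combination (p : ℂ) * hqc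
    have hBe : B = !![0, 0; -(q : ℂ), -(p : ℂ)] := by
      rw [hB, hw, hF, hD, mul_fin_two, mul_fin_two]
      ext i j
      fin_cases i <;> fin_cases j <;> simp
      · linear_combination htc
      · linear_combination ((s : ℂ) * (1 + (p : ℂ) ^ 2)) * hpc - (p : ℂ) * hsc
    have hEA : E * A = A := by
      rw [hAe]
      ext i j
      fin_cases i <;> fin_cases j <;> simp [hEdef]
    rw [e3, ← hEA, ← Matrix.mul_assoc, hE, Matrix.mul_assoc, hEA, ← Matrix.mul_add, hAe, hBe]
    congr 1
    ext i j
    fin_cases i <;> fin_cases j <;> simp [hr]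

end frames

end PolyLocal

end

/-! ### Two-qubit planes through `|11⟩`. -/

section

open scoped Matrix.Norms.L2Operator
open Matrix

namespace PolyLocal

section twoQubits

theorem sum_two_qubits {R : Type*} [AddCommMonoid R] (f : (Fin 2 → Fin 2) → R) :
    ∑ x, f x = f ![0, 0] + f ![0, 1] + (f ![1, 0] + f ![1, 1]) := by
  rw [← (finTwoArrowEquiv (Fin 2)).symm.sum_comp, Fintype.sum_prod_type]
  simp [Fin.sum_univ_two, finTwoArrowEquiv]

theorem two_qubits_cases (x : Fin 2 → Fin 2) :
    x = ![0, 0] ∨ x = ![0, 1] ∨ x = ![1, 0] ∨ x = ![1, 1] := by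
  revert x; decide

/-- The pair of vectors `|11⟩` and `a |00⟩ + b |01⟩ + c |10⟩`. -/
noncomputable def frame (a b c : ℝ) : Matrix (Fin 2 → Fin 2) (Fin 2) ℂ :=
  Matrix.of fun x => if x 0 = 0 then (if x 1 = 0 then ![0, (a : ℂ)] else ![0, (b : ℂ)])
    else if x 1 = 0 then ![0, (c : ℂ)] else ![1, 0]

theorem frame_conjTranspose_mul_frame (a b c a' b' c' : ℝ) :
    (frame a b c)ᴴ * frame a' b' c' = !![1, 0; 0, ((a * a' + b * b' + c * c' : ℝ) : ℂ)] := by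
  ext i j
  rw [Matrix.mul_apply, sum_two_qubits]
  fin_cases i <;> fin_cases j <;> simp [frame]

theorem frame_isometry {a b c : ℝ} (h : a * a + b * b + c * c = 1) :
    (frame a b c)ᴴ * frame a b c = 1 := by
  rw [frame_conjTranspose_mul_frame, h, Complex.ofReal_one, one_fin_two]

theorem GoodFrame.frame_orthogonal {a b c a' b' c' a₂ b₂ c₂ k s : ℝ}
    (h : GoodFrame (frame a b c)) (h' : GoodFrame (frame a' b' c')) (hs : 0 < s)
    (hks : k ^ 2 + s ^ 2 = 1) (hle : k ^ 2 ≤ s ^ 2) (h₂ : a₂ * a₂ + b₂ * b₂ + c₂ * c₂ = 1)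
    (ho : a * a₂ + b * b₂ + c * c₂ = 0) (ha : a' = k * a + s * a₂) (hb : b' = k * b + s * b₂)
    (hc : c' = k * c + s * c₂) : GoodFrame (frame a₂ b₂ c₂) := by
  refine h.orthogonal h' (frame_isometry h₂) ?_ ?_ ?_ hs hks hle
  · rw [frame_conjTranspose_mul_frame, ho, Complex.ofReal_zero]
  · ext x i
    rcases two_qubits_cases x with rfl | rfl | rfl | rfl <;> fin_cases i <;>
      simp [frame, Matrix.mul_apply, Fin.sum_univ_two]
  · ext x i
    rcases two_qubits_cases x with rfl | rfl | rfl | rfl <;> fin_cases i <;>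
      simp [frame, Matrix.mul_apply, Fin.sum_univ_two, ha, hb, hc] <;> ring

/-- The square of the controlled phase is a sign on `|11⟩`; conjugation by NOT on `t` moves the sign
to `|01⟩` or `|10⟩`. -/
theorem GoodFrame.frame_neg (t : Fin 2) {a b c : ℝ} (h : GoodFrame (frame a b c)) :
    GoodFrame (frame a (if t = 0 then -b else b) (if t = 0 then c else -c)) := by
  set g : Op 2 := mapMatrix (ctrlFlip ∅ t) * phaseOn {0, 1} ((2 : ℕ) * (Real.pi / 2)) *
    mapMatrix (ctrlFlip ∅ t) with hg
  have hgr : Realizable (1 + 2 + 1) g := ((Realizable.flip t).mul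
    (Realizable.controlledPhase (by decide) 2)).mul (Realizable.flip t)
  have hπ : Complex.exp (((2 : ℕ) * (Real.pi / 2) : ℝ) * Complex.I) = -1 := by
    rw [← Complex.exp_pi_mul_I]
    congr 1
    push_cast
    ring
  have hgd : g = diagonal fun x => if ∀ i ∈ ({0, 1} : Finset (Fin 2)), ctrlFlip ∅ t x i = 1 then
      (-1 : ℂ) else 1 := by
    rw [hg, phaseOn, hπ, mapMatrix_conj_diagonal _ _ (ctrlFlip_ctrlFlip (by simp))]
  have hstar : star g = g := by
    rw [hgd, star_eq_conjTranspose, diagonal_conjTranspose]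
    congr 1
    funext x
    simp only [Pi.star_apply]
    split_ifs <;> simp
  have hiso : (frame a (if t = 0 then -b else b) (if t = 0 then c else -c))ᴴ *
      frame a (if t = 0 then -b else b) (if t = 0 then c else -c) = 1 := by
    have := h.isometry
    rw [frame_conjTranspose_mul_frame] at this ⊢
    rw [← this]
    split_ifs <;> simp
  refine h.of_mul_eq hiso (g := g) (r := 1) hgr.mem_unitary (one_mem _) hgr.efficient
    (hstar.symm ▸ hgr.efficient) ?_
  rw [Matrix.mul_one, hgd]
  ext x i
  rw [diagonal_mul]
  rcases fin_two_cases t with rfl | rfl <;>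
    rcases two_qubits_cases x with rfl | rfl | rfl | rfl <;> fin_cases i <;>
    simp [frame, ctrlFlip]

/-- Up to a global phase, a phase on two qubits is a product of three operators on mutually orthogonal
frames. -/
theorem phaseOn_eq_smul_mul {a₁ b₁ c₁ a₂ b₂ c₂ a₃ b₃ c₃ : ℝ} (haa : a₁ * a₁ + a₂ * a₂ + a₃ * a₃ = 1)
    (hbb : b₁ * b₁ + b₂ * b₂ + b₃ * b₃ = 1) (hcc : c₁ * c₁ + c₂ * c₂ + c₃ * c₃ = 1)
    (hab : a₁ * b₁ + a₂ * b₂ + a₃ * b₃ = 0) (hac : a₁ * c₁ + a₂ * c₂ + a₃ * c₃ = 0)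
    (hbc : b₁ * c₁ + b₂ * c₂ + b₃ * c₃ = 0) (h12 : a₁ * a₂ + b₁ * b₂ + c₁ * c₂ = 0)
    (h13 : a₁ * a₃ + b₁ * b₃ + c₁ * c₃ = 0) (h23 : a₂ * a₃ + b₂ * b₃ + c₂ * c₃ = 0)
    {z w : ℂ} (hzw : z * w = 1) {α : ℝ} (hz : z ^ 4 = Complex.exp (α * Complex.I)) :
    phaseOn {0, 1} α = z • (frameOp (frame a₁ b₁ c₁) !![z, 0; 0, w] *
      frameOp (frame a₂ b₂ c₂) !![z, 0; 0, w] * frameOp (frame a₃ b₃ c₃) !![z, 0; 0, w]) := by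
  set N : Matrix (Fin 2) (Fin 2) ℂ := !![0, 0; 0, 1] with hN
  set P : Matrix (Fin 2 → Fin 2) (Fin 2) ℂ → Op 2 := fun J => J * N * Jᴴ with hP
  set E : Op 2 := diagonal fun x => if ∀ i ∈ ({0, 1} : Finset (Fin 2)), x i = 1 then 1 else 0 with hE
  have hframe : ∀ a b c, frameOp (frame a b c) !![z, 0; 0, w] =
      1 + (z - 1) • E + (w - 1) • P (frame a b c) := by
    intro a b c
    rw [frameOp, add_assoc]
    congr 1
    ext x y
    rcases two_qubits_cases x with rfl | rfl | rfl | rfl <;>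
    rcases two_qubits_cases y with rfl | rfl | rfl | rfl <;>
      simp [frame, Matrix.mul_apply, Fin.sum_univ_two, hE, hP, hN, Matrix.one_apply, diagonal_apply] <;> ring
  have hPP : ∀ {a b c a' b' c' : ℝ}, a * a' + b * b' + c * c' = 0 →
      P (frame a b c) * P (frame a' b' c') = 0 := by
    intro a b c a' b' c' h
    have h1 : N * !![1, 0; 0, 0] = 0 := by
      ext i j
      fin_cases i <;> fin_cases j <;> simp [hN]
    calc P (frame a b c) * P (frame a' b' c') =
        frame a b c * (N * ((frame a b c)ᴴ * frame a' b' c')) * N * (frame a' b' c')ᴴ := by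
          simp only [hP, Matrix.mul_assoc]
      _ = 0 := by
        rw [frame_conjTranspose_mul_frame, h, Complex.ofReal_zero, h1]
        simp
  have hEE : E * E = E := by
    rw [hE, diagonal_mul_diagonal]
    congr 1
    funext x
    split_ifs <;> simp
  have hEP : ∀ a b c, E * P (frame a b c) = 0 := by
    intro a b c
    ext x y
    rw [hE, diagonal_mul]
    rcases two_qubits_cases x with rfl | rfl | rfl | rfl <;>
      simp [frame, Matrix.mul_apply, Fin.sum_univ_two, hP, hN]
  have hPE : ∀ a b c, P (frame a b c) * E = 0 := by
    intro a b c
    ext x y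
    rw [hE, mul_diagonal]
    rcases two_qubits_cases y with rfl | rfl | rfl | rfl <;>
      simp [frame, Matrix.mul_apply, Fin.sum_univ_two, hP, hN]
  -- With four orthogonal projections summing to `1`, the product is `z ^ 3` on `|11⟩` and `w` on
  -- the complement; the scalar `z` makes these `z ^ 4` and `1`.
  have hsum : E + P (frame a₁ b₁ c₁) + P (frame a₂ b₂ c₂) + P (frame a₃ b₃ c₃) = 1 := by
    have real : ∀ {r s : ℝ}, r = s → (r : ℂ) = s := fun h => by rw [h]
    have haa' := real haa
    have hbb' := real hbb
    have hcc' := real hcc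
    have hab' := real hab
    have hac' := real hac
    have hbc' := real hbc
    push_cast at haa' hbb' hcc' hab' hac' hbc'
    ext x y
    rcases two_qubits_cases x with rfl | rfl | rfl | rfl <;>
    rcases two_qubits_cases y with rfl | rfl | rfl | rfl <;>
      simp [frame, Matrix.mul_apply, Fin.sum_univ_two, hE, hP, hN, Matrix.one_apply, diagonal_apply]
    · exact haa'
    · exact hab'
    · exact hac'
    · linear_combination hab'
    · exact hbb'
    · exact hbc'
    · linear_combination hac'
    · linear_combination hbc'
    · exact hcc'
  have hphase : phaseOn {0, 1} α = 1 + (z ^ 4 - 1) • E := by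
    rw [hz, phaseOn]
    ext x y
    simp only [hE, diagonal_apply, Matrix.add_apply, Matrix.smul_apply, Matrix.one_apply]
    split_ifs <;> simp
  have hsum' : P (frame a₁ b₁ c₁) = 1 - E - P (frame a₂ b₂ c₂) - P (frame a₃ b₃ c₃) := by
    rw [← hsum]; abel
  rw [hphase, hframe, hframe, hframe]
  have e1 : (1 + (z - 1) • E + (w - 1) • P (frame a₁ b₁ c₁)) *
      (1 + (z - 1) • E + (w - 1) • P (frame a₂ b₂ c₂)) =
      1 + (z ^ 2 - 1) • E + (w - 1) • (P (frame a₁ b₁ c₁) + P (frame a₂ b₂ c₂)) := by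
    simp only [add_mul, mul_add, one_mul, mul_one, Matrix.smul_mul, Matrix.mul_smul, hEE, hEP, hPE,
      hPP h12, smul_zero, add_zero, zero_add, smul_smul, smul_add]
    module
  have e2 : (1 + (z ^ 2 - 1) • E + (w - 1) • (P (frame a₁ b₁ c₁) + P (frame a₂ b₂ c₂))) *
      (1 + (z - 1) • E + (w - 1) • P (frame a₃ b₃ c₃)) =
      1 + (z ^ 3 - 1) • E +
        (w - 1) • (P (frame a₁ b₁ c₁) + P (frame a₂ b₂ c₂) + P (frame a₃ b₃ c₃)) := by
    simp only [add_mul, mul_add, one_mul, mul_one, Matrix.smul_mul, Matrix.mul_smul, hEE, hEP, hPE,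
      hPP h13, hPP h23, smul_zero, add_zero, zero_add, smul_smul, smul_add]
    module
  rw [e1, e2, hsum']
  have e3 : z • (1 + (z ^ 3 - 1) • E + (w - 1) • (1 - E - P (frame a₂ b₂ c₂) - P (frame a₃ b₃ c₃) +
      P (frame a₂ b₂ c₂) + P (frame a₃ b₃ c₃))) = z ^ 4 • E + (z * w) • (1 - E) := by
    module
  rw [e3, hzw]
  module

end twoQubits

end PolyLocal

end

/-! ### Unit quaternions as `SU(2)`, and the first good plane. -/

section

open scoped Matrix.Norms.L2Operator
open Matrix Quaternion

namespace PolyLocal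

section quaternions

/-- The complex matrix of a quaternion. -/
noncomputable def ofQuaternion (q : ℍ[ℝ]) : Matrix (Fin 2) (Fin 2) ℂ :=
  !![⟨q.re, q.imI⟩, ⟨q.imJ, q.imK⟩; ⟨-q.imJ, q.imK⟩, ⟨q.re, -q.imI⟩]

theorem ofQuaternion_mul (p q : ℍ[ℝ]) :
    ofQuaternion (p * q) = ofQuaternion p * ofQuaternion q := by
  ext i j
  fin_cases i <;> fin_cases j <;> apply Complex.ext <;>
    simp [ofQuaternion, Matrix.mul_apply, Fin.sum_univ_two] <;> ring

theorem ofQuaternion_sub (p q : ℍ[ℝ]) :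
    ofQuaternion (p - q) = ofQuaternion p - ofQuaternion q := by
  ext i j
  fin_cases i <;> fin_cases j <;> apply Complex.ext <;> simp [ofQuaternion] <;> ring

theorem ofQuaternion_star (q : ℍ[ℝ]) : ofQuaternion (star q) = star (ofQuaternion q) := by
  ext i j
  fin_cases i <;> fin_cases j <;> apply Complex.ext <;> simp [ofQuaternion, star_apply]

theorem ofQuaternion_coe (r : ℝ) : ofQuaternion (r : ℍ[ℝ]) = (r : ℂ) • 1 := by
  ext i j
  fin_cases i <;> fin_cases j <;> apply Complex.ext <;> simp [ofQuaternion]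

theorem ofQuaternion_one : ofQuaternion 1 = 1 := by
  have := ofQuaternion_coe 1
  simpa using this

theorem norm_ofQuaternion (q : ℍ[ℝ]) : ‖ofQuaternion q‖ = ‖q‖ := by
  have h1 : ‖(ofQuaternion q)ᴴ * ofQuaternion q‖ = ‖ofQuaternion q‖ * ‖ofQuaternion q‖ :=
    l2_opNorm_conjTranspose_mul_self _
  rw [← star_eq_conjTranspose, ← ofQuaternion_star, ← ofQuaternion_mul, star_mul_self,
    normSq_eq_norm_mul_self, ofQuaternion_coe, norm_smul, CStarRing.norm_one, mul_one,
    Complex.norm_real, Real.norm_eq_abs, abs_of_nonneg (by positivity)] at h1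
  exact ((mul_self_inj (norm_nonneg _) (norm_nonneg _)).1 h1).symm

theorem ofQuaternion_ofPair (a b c d : ℝ) : ofQuaternion (ofPair ⟨a, b⟩ ⟨c, d⟩) =
    !![⟨a, b⟩, ⟨c, d⟩; ⟨-c, d⟩, ⟨a, -b⟩] := rfl

theorem norm_ofPair_eq_one {a b c d : ℝ} (h : a ^ 2 + b ^ 2 + c ^ 2 + d ^ 2 = 1) :
    ‖ofPair ⟨a, b⟩ ⟨c, d⟩‖ = 1 := by
  have h1 := norm_ofPair_sq ⟨a, b⟩ ⟨c, d⟩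
  rw [Complex.sq_norm, Complex.sq_norm, Complex.normSq_apply, Complex.normSq_apply] at h1
  have h2 : ‖ofPair ⟨a, b⟩ ⟨c, d⟩‖ ^ 2 = 1 := by
    rw [h1]
    simp only
    linarith
  nlinarith [norm_nonneg (ofPair ⟨a, b⟩ ⟨c, d⟩)]

theorem exists_ofQuaternion_eq (u : SU2) :
    ∃ q : ℍ[ℝ], ‖q‖ = 1 ∧ ofQuaternion q = (u : Matrix (Fin 2) (Fin 2) ℂ) := by
  obtain ⟨u, hu⟩ := u
  obtain ⟨h1, h2⟩ := mem_specialUnitaryGroup_iff.1 hu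
  have hs : star u = adjugate u := by
    have h3 := mul_adjugate u
    rw [h2, one_smul] at h3
    calc star u = star u * (u * adjugate u) := by rw [h3, mul_one]
      _ = adjugate u := by rw [← mul_assoc, mem_unitaryGroup_iff'.1 h1, one_mul]
  have h00 := congrFun (congrFun hs 0) 0
  have h10 := congrFun (congrFun hs 1) 0
  rw [adjugate_fin_two] at h00 h10
  simp [star_apply] at h00 h10
  have key : ofQuaternion (ofPair (u 0 0) (u 0 1)) = u := by
    ext i j
    fin_cases i <;> fin_cases j
    · rfl
    · rfl
    · have : u 1 0 = - starRingEnd ℂ (u 0 1) := by rw [h10, neg_neg]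
      simp only [ofQuaternion]
      apply Complex.ext <;> simp [this]
    · simp only [ofQuaternion]
      apply Complex.ext <;> simp [← h00]
  refine ⟨ofPair (u 0 0) (u 0 1), ?_, key⟩
  rw [← norm_ofQuaternion, key]
  have h3 : ‖uᴴ * u‖ = ‖u‖ * ‖u‖ := l2_opNorm_conjTranspose_mul_self u
  rw [← star_eq_conjTranspose, mem_unitaryGroup_iff'.1 h1, CStarRing.norm_one] at h3
  nlinarith [norm_nonneg u]

end quaternions

section baseFrame

theorem phaseOn_eq_frameOp (a b c α : ℝ) :
    phaseOn {0, 1} α = frameOp (frame a b c) !![Complex.exp (α * Complex.I), 0; 0, 1] := by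
  rw [phaseOn, frameOp]
  ext x y
  rcases two_qubits_cases x with rfl | rfl | rfl | rfl <;>
  rcases two_qubits_cases y with rfl | rfl | rfl | rfl <;>
    simp [frame, Matrix.mul_apply, Fin.sum_univ_two, Matrix.one_apply, diagonal_apply]

/-- Two Hadamards send `|11⟩` to `(|00⟩ - |01⟩ - |10⟩ + |11⟩) / 2`, which has coordinates `1 / 2`
and `3 κ / 2` in this frame. The conjugated phase therefore acts inside the same plane, and the
matrix shown is the projection onto that vector. -/
theorem hadamard_conj_phaseOn {κ : ℝ} (hκ : κ * κ = 1 / 3) (α : ℝ) :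
    hadamardOn 0 * hadamardOn 1 * phaseOn {0, 1} α * (hadamardOn 1 * hadamardOn 0) =
      frameOp (frame κ (-κ) (-κ)) (1 + (Complex.exp (α * Complex.I) - 1) •
        !![1 / 4, 3 * (κ : ℂ) / 4; 3 * (κ : ℂ) / 4, 3 / 4]) := by
  set J := frame κ (-κ) (-κ) with hJ
  set H : Op 2 := hadamardOn 0 * hadamardOn 1 with hH
  set E : Matrix (Fin 2) (Fin 2) ℂ := !![1, 0; 0, 0] with hE
  set k : Matrix (Fin 2) (Fin 2) ℂ := !![1 / 2, 0; 3 * (κ : ℂ) / 2, 0] with hk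
  have hκ' : (κ : ℂ) * κ = 1 / 3 := by rw [← Complex.ofReal_mul, hκ]; simp
  have hstar : Hᴴ = hadamardOn 1 * hadamardOn 0 := by
    rw [hH, ← star_eq_conjTranspose, star_mul, star_hadamardOn, star_hadamardOn]
  have hHH : H * Hᴴ = 1 := by
    rw [hstar, hH, mul_assoc, ← mul_assoc (hadamardOn 1), hadamardOn_mul_self, one_mul,
      hadamardOn_mul_self]
  have h2 : ((√2 : ℝ) : ℂ)⁻¹ * ((√2 : ℝ) : ℂ)⁻¹ = 1 / 2 := by
    rw [← mul_inv, ← Complex.ofReal_mul, Real.mul_self_sqrt (by norm_num)]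
    norm_num
  have hcol : H * (J * E) = J * k := by
    ext x i
    rw [hH, Matrix.mul_assoc, Matrix.mul_apply, sum_two_qubits]
    simp only [Matrix.mul_apply, sum_two_qubits, hadamardOn_apply, Fin.forall_fin_two]
    rcases two_qubits_cases x with rfl | rfl | rfl | rfl <;> fin_cases i <;>
      simp [hJ, frame, Fin.sum_univ_two, hE, hk]
    all_goals first | linear_combination h2 | linear_combination h2 - (3 / 2 : ℂ) * hκ'
  have hEE : E * Eᴴ = E := by
    ext i j
    fin_cases i <;> fin_cases j <;> simp [hE, Matrix.mul_apply]
  have hkk : k * kᴴ = !![1 / 4, 3 * (κ : ℂ) / 4; 3 * (κ : ℂ) / 4, 3 / 4] := by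
    ext i j
    fin_cases i <;> fin_cases j <;> simp [hk, Matrix.mul_apply, map_ofNat]
    · norm_num
    · ring
    · ring
    · linear_combination (9 / 4 : ℂ) * hκ'
  have hphase : phaseOn {0, 1} α = 1 + (Complex.exp (α * Complex.I) - 1) • (J * E * (J * E)ᴴ) := by
    have hJE : J * E * (J * E)ᴴ = J * E * Jᴴ := by
      rw [conjTranspose_mul, ← Matrix.mul_assoc, Matrix.mul_assoc J E, hEE]
    rw [phaseOn_eq_frameOp κ (-κ) (-κ), frameOp, hJE, ← Matrix.smul_mul, ← Matrix.mul_smul]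
    congr 3
    ext i j
    fin_cases i <;> fin_cases j <;> simp [hE]
  rw [← hstar, hphase, mul_add, mul_one, add_mul, hHH, Matrix.mul_smul, Matrix.smul_mul,
    ← Matrix.mul_assoc H, hcol, Matrix.mul_assoc (J * k), ← conjTranspose_mul, hcol, frameOp,
    add_sub_cancel_left, ← hkk, Matrix.mul_smul, Matrix.smul_mul, conjTranspose_mul]
  simp only [Matrix.mul_assoc]

/-- A controlled phase `i` times a Hadamard-conjugated controlled phase `-i` has determinant one in
the plane. The two orders of multiplication give the generators of `mem_of_generators_mem`. A `word`
also records a circuit for the adjoint, so that inverses keep the same length. -/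
theorem goodFrame_of_sq_eq {κ : ℝ} (hκ : κ * κ = 1 / 3) (hκ0 : 0 < κ) :
    GoodFrame (frame κ (-κ) (-κ)) := by
  set J := frame κ (-κ) (-κ) with hJ
  have hiso : Jᴴ * J = 1 := frame_isometry (by linarith)
  have h01 : (0 : Fin 2) ≠ 1 := by decide
  have h3κ : √3 = 3 * κ := by
    rw [Real.sqrt_eq_iff_mul_self_eq (by norm_num) (by positivity)]
    linarith
  let word : ℕ → ℍ[ℝ] → Prop := fun L a =>
    ‖a‖ = 1 ∧ Realizable L (frameOp J (ofQuaternion a)) ∧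
      Realizable L (star (frameOp J (ofQuaternion a)))
  set A : ℕ → Op 2 := fun k => phaseOn {0, 1} ((k : ℝ) * (Real.pi / 2)) with hA
  have hAr : ∀ k, Realizable k (A k) := fun k => Realizable.controlledPhase h01 k
  have hA4 : A 4 = 1 := by
    have : Complex.exp (((4 : ℕ) * (Real.pi / 2) : ℝ) * Complex.I) = 1 := by
      rw [← Complex.exp_two_pi_mul_I]
      congr 1
      push_cast
      ring
    simp only [hA, phaseOn, this, ite_self, diagonal_one]
  have hAmul : ∀ j k, A j * A k = A (j + k) := fun j k => by
    simp only [hA]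
    rw [← phaseOn_add]
    push_cast
    rw [add_mul]
  have hAu : ∀ k, A k ∈ unitary (Op 2) := fun k => phaseOn_mem_unitary _ _
  have hAstar : ∀ j k, j + k = 4 → star (A j) = A k := by
    intro j k h
    calc star (A j) = star (A j) * (A j * A k) := by rw [hAmul, h, hA4, mul_one]
      _ = A k := by rw [← mul_assoc, (Unitary.mem_iff.1 (hAu j)).1, one_mul]
  set H : Op 2 := hadamardOn 0 * hadamardOn 1 with hH
  have hHr : Realizable 2 H := (Realizable.hadamardOn 0).mul (Realizable.hadamardOn 1)
  have hHstar : star H = hadamardOn 1 * hadamardOn 0 := by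
    rw [hH, star_mul, star_hadamardOn, star_hadamardOn]
  have hHr' : Realizable 2 (star H) := by
    rw [hHstar]; exact (Realizable.hadamardOn 1).mul (Realizable.hadamardOn 0)
  have e1 : A 1 = frameOp J !![Complex.I, 0; 0, 1] := by
    simp only [hA]
    rw [phaseOn_eq_frameOp κ (-κ) (-κ)]
    congr
    push_cast
    rw [one_mul, Complex.exp_pi_div_two_mul_I]
  have e3 : H * A 3 * star H = frameOp J (1 + (-Complex.I - 1) •
      !![1 / 4, 3 * (κ : ℂ) / 4; 3 * (κ : ℂ) / 4, 3 / 4]) := by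
    rw [hHstar, hadamard_conj_phaseOn hκ]
    congr
    have : ((3 : ℕ) * (Real.pi / 2) : ℝ) * Complex.I = Real.pi * Complex.I + Real.pi / 2 * Complex.I := by
      push_cast; ring
    rw [this, Complex.exp_add, Complex.exp_pi_mul_I, Complex.exp_pi_div_two_mul_I]
    ring
  clear_value H
  have hconj : ∀ j k, j + k = 4 → star (H * A j * star H) = H * A k * star H := by
    intro j k h
    rw [star_mul, star_mul, star_star, hAstar j k h, mul_assoc]
  have hκ' : (κ : ℂ) * κ = 1 / 3 := by rw [← Complex.ofReal_mul, hκ]; simp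
  have hx : word 8 (ofPair ⟨1 / 4, 3 / 4⟩ ⟨√3 / 4, -(√3 / 4)⟩) := by
    have h : A 1 * (H * A 3 * star H) =
        frameOp J (ofQuaternion (ofPair ⟨1 / 4, 3 / 4⟩ ⟨√3 / 4, -(√3 / 4)⟩)) := by
      rw [e1, e3, frameOp_mul hiso, h3κ]
      rw [ofQuaternion_ofPair]
      congr 1
      ext i j
      fin_cases i <;> fin_cases j <;> apply Complex.ext <;>
        simp [Matrix.mul_apply, Fin.sum_univ_two, Matrix.one_apply]
      all_goals norm_num
    refine ⟨norm_ofPair_eq_one ?_, ?_, ?_⟩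
    · rw [h3κ]
      linear_combination (9 / 8 : ℝ) * hκ
    · rw [← h]
      exact (hAr 1).mul ((hHr.mul (hAr 3)).mul hHr')
    · rw [← h, star_mul, hconj 3 1 rfl, hAstar 1 3 rfl]
      exact ((hHr.mul (hAr 1)).mul hHr').mul (hAr 3)
  have hy : word 8 (ofPair ⟨1 / 4, 3 / 4⟩ ⟨-(√3 / 4), -(√3 / 4)⟩) := by
    have h : (H * A 3 * star H) * A 1 =
        frameOp J (ofQuaternion (ofPair ⟨1 / 4, 3 / 4⟩ ⟨-(√3 / 4), -(√3 / 4)⟩)) := by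
      rw [e1, e3, frameOp_mul hiso, h3κ]
      rw [ofQuaternion_ofPair]
      congr 1
      ext i j
      fin_cases i <;> fin_cases j <;> apply Complex.ext <;>
        simp [Matrix.mul_apply, Fin.sum_univ_two, Matrix.one_apply]
      all_goals norm_num
    refine ⟨norm_ofPair_eq_one ?_, ?_, ?_⟩
    · rw [h3κ]
      linear_combination (9 / 8 : ℝ) * hκ
    · rw [← h]
      exact ((hHr.mul (hAr 3)).mul hHr').mul (hAr 1)
    · rw [← h, star_mul, hconj 3 1 rfl, hAstar 1 3 rfl]
      exact (hAr 3).mul ((hHr.mul (hAr 1)).mul hHr')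
  have hmul : ∀ L L' a c, word L a → word L' c → word (L + L') (a * c) := by
    rintro L L' a c ⟨h1, h2, h3⟩ ⟨h1', h2', h3'⟩
    refine ⟨by rw [norm_mul, h1, h1', one_mul], ?_, ?_⟩
    · rw [ofQuaternion_mul, ← frameOp_mul hiso]
      exact h2.mul h2'
    · rw [ofQuaternion_mul, ← frameOp_mul hiso, star_mul, add_comm]
      exact h3'.mul h3
  have hinv : ∀ L a, word L a → word L a⁻¹ := by
    rintro L a ⟨h1, h2, h3⟩
    have hinv : a⁻¹ = star a := by
      have h4 : normSq a = 1 := by rw [normSq_eq_norm_mul_self, h1, one_mul]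
      rw [Quaternion.inv_def, h4]; simp
    refine ⟨by rw [norm_inv, h1, inv_one], ?_, ?_⟩
    · rwa [hinv, ofQuaternion_star, ← star_frameOp]
    · rwa [hinv, ofQuaternion_star, ← star_frameOp, star_star]
  have hone : word 0 1 := by
    refine ⟨by simp, ?_, ?_⟩
    · rw [ofQuaternion_one, frameOp_one]; exact .one
    · rw [ofQuaternion_one, frameOp_one, star_one]; exact .one
  obtain ⟨K, hK⟩ := solovayKitaev_of_generators (word := word) (fun L a h => h.1) hmul hinv hone
    (fun L L' a h hL => ⟨h.1, h.2.1.mono hL, h.2.2.mono hL⟩) hx hy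
  refine ⟨hiso, K, fun u ε hε => ?_⟩
  obtain ⟨q, hq, hqu⟩ := exists_ofQuaternion_eq u
  obtain ⟨L, a, ha, hqa, hL⟩ := hK q hq ε hε
  refine ⟨L, hL, 1, _, by simp, ha.2.1, ?_⟩
  simp only [one_smul, ← hqu]
  refine (norm_frameOp_sub_le hiso _ _).trans ?_
  rw [← ofQuaternion_sub, norm_ofQuaternion]
  exact hqa.le

end baseFrame

end PolyLocal

end

/-! ### Approximating arbitrary phases on one or two qubits. -/

section

open scoped Matrix.Norms.L2Operator
open Matrix

namespace PolyLocal

section synthesis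

/-- Arbitrary phases on two qubits are efficiently approximable. -/
theorem efficient_phaseOn_two : Efficient fun α : ℝ => (phaseOn {0, 1} α : Op 2) := by
  obtain ⟨κ, hκ0, hκ⟩ : ∃ κ : ℝ, 0 < κ ∧ κ * κ = 1 / 3 :=
    ⟨√(1 / 3), by positivity, Real.mul_self_sqrt (by norm_num)⟩
  obtain ⟨τ, hτ0, hτ⟩ : ∃ τ : ℝ, 0 < τ ∧ τ * τ = 2 :=
    ⟨√2, by positivity, Real.mul_self_sqrt (by norm_num)⟩
  have hκτ : (κ * τ) * (κ * τ) = 2 / 3 := by linear_combination 2 * hκ + (κ * κ) * hτ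
  have g₁ : GoodFrame (frame κ (-κ) (-κ)) := goodFrame_of_sq_eq hκ hκ0
  have g₁' : GoodFrame (frame κ κ (-κ)) := by simpa using g₁.frame_neg 0
  have g₁'' : GoodFrame (frame κ (-κ) κ) := by simpa using g₁.frame_neg 1
  -- The vectors `(1, -1, -1) / √3` and `(1, 1, -1) / √3` have inner product `1 / 3`; this is the
  -- normalized orthogonal part `(1, 2, -1) / √6` of the second.
  have g₂ : GoodFrame (frame (κ * τ / 2) (κ * τ) (-(κ * τ / 2))) := by
    refine g₁.frame_orthogonal g₁' (k := 1 / 3) (s := 2 * τ / 3) (by positivity) ?_ ?_ ?_ ?_ ?_ ?_ ?_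
    · linear_combination (4 / 9 : ℝ) * hτ
    · nlinarith
    · linear_combination (3 / 2 : ℝ) * hκτ
    · ring
    · linear_combination (-κ / 3) * hτ
    · linear_combination (-2 * κ / 3) * hτ
    · linear_combination (κ / 3) * hτ
  have g₂' : GoodFrame (frame (κ * τ / 2) (-(κ * τ / 2)) (κ * τ)) := by
    refine g₁.frame_orthogonal g₁'' (k := 1 / 3) (s := 2 * τ / 3) (by positivity) ?_ ?_ ?_ ?_ ?_ ?_ ?_
    · linear_combination (4 / 9 : ℝ) * hτ
    · nlinarith
    · linear_combination (3 / 2 : ℝ) * hκτ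
    · ring
    · linear_combination (-κ / 3) * hτ
    · linear_combination (κ / 3) * hτ
    · linear_combination (-2 * κ / 3) * hτ
  -- The vectors of `g₂` and `g₂'` have inner product `-1 / 2`; the orthogonal part `(1, 0, 1) / √2`
  -- completes an orthonormal basis with those of `g₁` and `g₂`.
  have g₃ : GoodFrame (frame (τ / 2) 0 (τ / 2)) := by
    refine g₂.frame_orthogonal g₂' (k := -(1 / 2)) (s := 3 * κ / 2) (by positivity) ?_ ?_ ?_ ?_ ?_ ?_ ?_
    · linear_combination (9 / 4 : ℝ) * hκ
    · nlinarith
    · linear_combination (1 / 2 : ℝ) * hτ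
    · ring
    · ring
    · ring
    · ring
  let z : ℝ → ℂ := fun α => Complex.exp ((α / 4 : ℝ) * Complex.I)
  let w : ℝ → ℂ := fun α => Complex.exp ((-(α / 4) : ℝ) * Complex.I)
  have hzw : ∀ α, z α * w α = 1 := fun α => by
    simp only [z, w]
    rw [← Complex.exp_add, ← add_mul, ← Complex.ofReal_add, add_neg_cancel]
    simp
  have hz4 : ∀ α, z α ^ 4 = Complex.exp (α * Complex.I) := fun α => by
    simp only [z]
    rw [← Complex.exp_nat_mul]
    congr 1
    push_cast
    ring
  have hmem : ∀ α, !![z α, 0; 0, w α] ∈ SU2 := fun α => by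
    have hc : starRingEnd ℂ (z α) = w α := by
      simp only [z, w]
      rw [← Complex.exp_conj, map_mul, Complex.conj_ofReal, Complex.conj_I, Complex.ofReal_neg,
        neg_mul, mul_neg]
    have hc' : starRingEnd ℂ (w α) = z α := by rw [← hc, Complex.conj_conj]
    rw [mem_specialUnitaryGroup_iff, mem_unitaryGroup_iff]
    constructor
    · ext i j
      fin_cases i <;> fin_cases j <;>
        simp [Matrix.mul_apply, Fin.sum_univ_two, star_apply, hc, hc', hzw, mul_comm (w α)]
    · rw [det_fin_two_of, hzw]
      ring
  let u : ℝ → SU2 := fun α => ⟨_, hmem α⟩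
  have key : ∀ α, (phaseOn {0, 1} α : Op 2) = z α • (frameOp (frame κ (-κ) (-κ)) (u α) *
      frameOp (frame (κ * τ / 2) (κ * τ) (-(κ * τ / 2))) (u α) *
        frameOp (frame (τ / 2) 0 (τ / 2)) (u α)) := fun α => by
    refine phaseOn_eq_smul_mul ?_ ?_ ?_ ?_ ?_ ?_ ?_ ?_ ?_ (hzw α) (hz4 α)
    · linear_combination hκ + (1 / 4 : ℝ) * hκτ + (1 / 4 : ℝ) * hτ
    · linear_combination hκ + hκτ
    · linear_combination hκ + (1 / 4 : ℝ) * hκτ + (1 / 4 : ℝ) * hτ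
    · linear_combination -hκ + (1 / 2 : ℝ) * hκτ
    · linear_combination -hκ - (1 / 4 : ℝ) * hκτ + (1 / 4 : ℝ) * hτ
    · linear_combination hκ - (1 / 2 : ℝ) * hκτ
    · ring
    · ring
    · ring
  simp only [key]
  refine (((g₁.efficient.comp u).mul (g₂.efficient.comp u) ?_).mul (g₃.efficient.comp u) ?_).smul ?_
  · exact fun α => frameOp_mem_unitary g₂.isometry _
  · exact fun α => frameOp_mem_unitary g₃.isometry _
  · exact fun α => Complex.norm_exp_ofReal_mul_I _

/-- Phases on one or two of at least two qubits are efficiently approximable, uniformly in the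
number of qubits. -/
theorem exists_approximable_phaseOn_pair : ∃ K : ℝ, 0 ≤ K ∧
    ∀ (n : ℕ), 2 ≤ n → ∀ (p q : Fin n) (α ε : ℝ), 0 < ε → ∃ m : ℕ, (m : ℝ) ≤ K * (1 + Real.log (1 / ε) ^ 4) ∧ Approximable m ε (phaseOn {p, q} α) := by
  obtain ⟨K, hK⟩ := efficient_phaseOn_two
  have hpair : ∀ (n : ℕ) (p q : Fin n), p ≠ q → ∀ (α ε : ℝ), 0 < ε → ∃ m : ℕ,
      (m : ℝ) ≤ K * (1 + Real.log (1 / ε) ^ 4) ∧ Approximable m ε (phaseOn {p, q} α) := by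
    intro n p q hpq α ε hε
    obtain ⟨m, hm, h⟩ := hK α ε hε
    refine ⟨m, hm, ?_⟩
    have := h.place (twoWires p q hpq)
    rw [place_phaseOn] at this
    simpa using this
  refine ⟨18 * |K| + 2, by positivity, fun n hn p q α ε hε => ?_⟩
  have hpos : 0 ≤ Real.log (1 / ε) ^ 4 := by positivity
  by_cases hpq : p = q
  · subst hpq
    have : Nontrivial (Fin n) := Fin.nontrivial_iff_two_le.2 hn
    obtain ⟨t, ht⟩ := exists_ne p
    obtain ⟨m, hm, h⟩ := hpair n p t ht.symm α (ε / 2) (half_pos hε)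
    refine ⟨m + (1 + m + 1), ?_, ?_⟩
    · have e : Real.log (1 / (ε / 2)) = Real.log 2 + Real.log (1 / ε) := by
        rw [← Real.log_mul (by norm_num) (by positivity)]
        congr 1
        field_simp
      have h2 : Real.log 2 ≤ 1 := by linarith [Real.log_two_lt_d9]
      have h3 := one_add_add_pow_four_le (Real.log_pos one_lt_two).le h2 (Real.log (1 / ε))
      rw [e] at hm
      have h4 : (m : ℝ) ≤ |K| * (9 * (1 + Real.log (1 / ε) ^ 4)) :=
        hm.trans (mul_le_mul (le_abs_self K) h3 (by positivity) (abs_nonneg K))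
      push_cast
      nlinarith
    · have hX : mapMatrix (ctrlFlip ∅ t) ∈ unitary (Op n) := (Realizable.flip t).mem_unitary
      -- A phase on one qubit is applied once for `t = 1` and once, between two NOTs, for `t = 0`.
      have e : phaseOn {p, p} α = phaseOn {p, t} α *
          (mapMatrix (ctrlFlip ∅ t) * phaseOn {p, t} α * mapMatrix (ctrlFlip ∅ t)) := by
        unfold phaseOn
        rw [mapMatrix_conj_diagonal _ _ (ctrlFlip_ctrlFlip (by simp)), diagonal_mul_diagonal_fun]
        congr 1
        funext x
        simp only [Finset.mem_insert, Finset.mem_singleton, forall_eq_or_imp, forall_eq, or_self,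
          ctrlFlip_of_ne (S := ∅) x ht.symm, ctrlFlip_same]
        rcases fin_two_cases (x p) with hp | hp <;> rcases fin_two_cases (x t) with hq | hq <;>
          simp [hp, hq]
      rw [e]
      have hr := (Realizable.flip t).approximable (le_refl (0 : ℝ))
      have hu := phaseOn_mem_unitary ({p, t} : Finset (Fin n)) α
      exact (h.mul ((hr.mul h hu).mul hr hX) (mul_mem (mul_mem hX hu) hX)).mono le_rfl (by linarith)
  · obtain ⟨m, hm, h⟩ := hpair n p q hpq α ε hε
    refine ⟨m, hm.trans ?_, h⟩
    have : K ≤ 18 * |K| + 2 := by linarith [le_abs_self K, abs_nonneg K]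
    gcongr

/-- A bound for the number of gates in place of each generator is a bound for the approximation of
the whole product. -/
theorem Generated.approximable {n L : ℕ} {U : Op n} (h : Generated n L U) {m : ℕ} (hm : 1 ≤ m) {ε : ℝ}
    (hε : 0 ≤ ε) (hphase : ∀ (p q : Fin n) (α : ℝ), Approximable m ε (PolyLocal.phaseOn {p, q} α)) :
    Approximable (L * m) (L * ε) U := by
  induction h with
  | scalar c hc =>
    exact ((Realizable.one.approximable (le_refl (0 : ℝ))).smul hc).mono (Nat.zero_le _) (by simp)
  | gate g => exact ((Realizable.gate g).mono (by simpa using hm)).approximable (by simpa using hε)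
  | phase p q α => simpa using hphase p q α
  | mul _ h2 h1' h2' =>
    exact (h1'.mul h2' h2.mem_unitary).mono (by rw [add_mul]) (by push_cast; rw [add_mul])
  | mono _ hL h' => exact h'.mono (Nat.mul_le_mul_right _ hL) (by gcongr)

end synthesis

end PolyLocal

end

/-! ### Gate counts and the final bound. -/

section

open scoped Matrix.Norms.L2Operator
open Matrix

namespace PolyLocal

section assembly

theorem exists_circuit_of_approximable {n m : ℕ} {ε : ℝ} {A : Matrix (Fin (2 ^ n)) (Fin (2 ^ n)) ℂ}
    (h : Approximable m ε (A.submatrix finFunctionFinEquiv finFunctionFinEquiv : Op n)) :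
    ∃ (C : Circuit n) (c : ℂ), ‖c‖ = 1 ∧ C.length ≤ m ∧ ‖A - c • C.matrix‖ ≤ ε := by
  obtain ⟨c, V, hc, ⟨C, hC, rfl⟩, hV⟩ := h
  refine ⟨C, c, hc, hC, le_trans (le_trans (le_of_eq ?_) (norm_reindex_le finFunctionFinEquiv _)) hV⟩
  congr 1
  ext i j
  simp [Circuit.matrix]

theorem one_le_of_isCyclicallyBanded {b N : ℕ} {A : Matrix (Fin N) (Fin N) ℂ} (hN : 0 < N)
    (hA : A ∈ unitaryGroup (Fin N) ℂ) (h : IsCyclicallyBanded b A) : 1 ≤ b := by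
  by_contra hb
  have hb0 : b = 0 := by omega
  have hA0 : A = 0 := by
    ext i j
    by_contra hij
    obtain ⟨d, hd, -⟩ := h i j hij
    rw [hb0] at hd
    exact absurd hd (not_lt.2 (by simp))
  rw [hA0, mem_unitaryGroup_iff, zero_mul] at hA
  have : NeZero N := ⟨hN.ne'⟩
  exact zero_ne_one hA

/-- The bound on the number of gates is a polynomial. -/
theorem exists_polynomial_bound (L : ℕ) (K : ℝ) : ∃ p : MvPolynomial (Fin 2) ℝ, ∀ (n : ℕ) (y : ℝ),
    MvPolynomial.eval ![(n : ℝ), y] p = ((L * shiftCost n : ℕ) : ℝ) *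
      (K * (1 + 8 * (((L * shiftCost n : ℕ) : ℝ) ^ 4 + y ^ 4)) + 1) := by
  open MvPolynomial in
  let x : MvPolynomial (Fin 2) ℝ := X 0
  let g : MvPolynomial (Fin 2) ℝ := C (L : ℝ) * (x * (x * (14 * x ^ 4 + 4) + 2) + 2 * x + 1)
  refine ⟨g * (MvPolynomial.C K * (1 + 8 * (g ^ 4 + MvPolynomial.X 1 ^ 4)) + 1), fun n y => ?_⟩
  simp [g, x, shiftCost]

/-- The crude bound `log (G + 1) ≤ G` keeps the estimate polynomial in `G`. -/
theorem log_pow_four_le {G ε : ℝ} (hG : 0 ≤ G) (hε : 0 < ε) :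
    Real.log (1 / (ε / (G + 1))) ^ 4 ≤ 8 * (G ^ 4 + Real.log (1 / ε) ^ 4) := by
  have e : Real.log (1 / (ε / (G + 1))) = Real.log (G + 1) + Real.log (1 / ε) := by
    rw [← Real.log_mul (by positivity) (by positivity)]
    congr 1
    field_simp
  have h0 : 0 ≤ Real.log (G + 1) := Real.log_nonneg (by linarith)
  have h1 : Real.log (G + 1) ≤ G := by
    have := Real.log_le_sub_one_of_pos (show 0 < G + 1 by linarith)
    linarith
  have h2 : Real.log (G + 1) ^ 4 ≤ G ^ 4 := by gcongr
  rw [e]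
  generalize Real.log (G + 1) = a at *
  generalize Real.log (1 / ε) = y
  have h3 : (a + y) ^ 2 ≤ 2 * (a ^ 2 + y ^ 2) := by nlinarith [sq_nonneg (a - y)]
  have h4 : ((a + y) ^ 2) ^ 2 ≤ (2 * (a ^ 2 + y ^ 2)) ^ 2 := by gcongr
  nlinarith [sq_nonneg (a ^ 2 - y ^ 2)]

end assembly

end PolyLocal

end

theorem theorem1 (b l n₀ : ℕ)
    (M : (n : ℕ) → Matrix (Fin (2 ^ n)) (Fin (2 ^ n)) ℂ)
    (h_unitary : ∀ n > n₀, M n ∈ Matrix.unitaryGroup (Fin (2 ^ n)) ℂ)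
    (h_width : ∀ n > n₀, 4 * b < 2 ^ n)
    (h_period : ∀ n > n₀, 2 ^ l ∣ 2 ^ n)
    (h_band : ∀ n > n₀, PolyLocal.IsCyclicallyBanded b (M n))
    (h_cyclic : ∀ n > n₀, PolyLocal.IsCyclicWithPeriod (2 ^ l) (M n))
    (h_local : ∀ n > n₀, ∀ n' > n₀, PolyLocal.LocallyIdentical b (2 ^ l) (M n) (M n'))
    (h_algebraic : ∀ n > n₀, ∀ i j, IsAlgebraic ℚ (M n i j)) :
    ∃ p : MvPolynomial (Fin 2) ℝ, ∀ n > n₀, ∀ ε : ℝ, 0 < ε →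
      ∃ (C : PolyLocal.Circuit n) (c : ℂ), ‖c‖ = 1 ∧
        (C.length : ℝ) ≤ MvPolynomial.eval ![(n : ℝ), Real.log (1 / ε)] p ∧
        ‖M n - c • C.matrix‖ < ε := by
  obtain ⟨L, hL⟩ := PolyLocal.exists_generated_of_locallyIdentical b l n₀ M h_unitary h_width
    h_period h_band h_cyclic h_local
  obtain ⟨K, hK0, hK⟩ := PolyLocal.exists_approximable_phaseOn_pair
  obtain ⟨p, hp⟩ := PolyLocal.exists_polynomial_bound L K
  refine ⟨p, fun n hn ε hε => ?_⟩
  have hn2 : 2 ≤ n := by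
    have hb := PolyLocal.one_le_of_isCyclicallyBanded (by positivity) (h_unitary n hn) (h_band n hn)
    have hw := h_width n hn
    by_contra hlt
    have : 2 ^ n ≤ 2 ^ 1 := Nat.pow_le_pow_right (by norm_num) (by omega)
    omega
  have hgen := hL n hn
  rw [hp]
  generalize hG : L * PolyLocal.shiftCost n = G at hgen
  have hG0 : (0 : ℝ) ≤ G := Nat.cast_nonneg G
  -- The extra `1` avoids division by zero and makes the total error `G * δ` strictly less than `ε`.
  set δ := ε / ((G : ℝ) + 1) with hδ
  have hδ0 : 0 < δ := by positivity
  -- One natural number bounds the cost of every phase; the added `1` ensures that it also covers an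
  -- elementary gate.
  have hfloor : ∀ m : ℕ, (m : ℝ) ≤ K * (1 + Real.log (1 / δ) ^ 4) →
      m ≤ ⌊K * (1 + Real.log (1 / δ) ^ 4)⌋₊ + 1 := fun m hm => (Nat.le_floor hm).trans (Nat.le_succ _)
  have happrox := hgen.approximable (m := ⌊K * (1 + Real.log (1 / δ) ^ 4)⌋₊ + 1)
    (Nat.le_add_left _ _) hδ0.le fun q r α => by
      obtain ⟨m, hm, h⟩ := hK n hn2 q r α δ hδ0
      exact h.mono (hfloor m hm) le_rfl
  obtain ⟨C, c, hc, hlen, hdist⟩ := PolyLocal.exists_circuit_of_approximable happrox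
  refine ⟨C, c, hc, ?_, lt_of_le_of_lt hdist ?_⟩
  · have h1 : (C.length : ℝ) ≤ (G * (⌊K * (1 + Real.log (1 / δ) ^ 4)⌋₊ + 1) : ℕ) :=
      Nat.cast_le.2 hlen
    have h2 : (⌊K * (1 + Real.log (1 / δ) ^ 4)⌋₊ : ℝ) ≤ K * (1 + Real.log (1 / δ) ^ 4) :=
      Nat.floor_le (by positivity)
    have h3 := PolyLocal.log_pow_four_le hG0 hε
    push_cast at h1
    refine h1.trans ?_
    gcongr
    refine h2.trans ?_
    gcongr
  · rw [hδ, mul_div_assoc', div_lt_iff₀ (by positivity)]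
    nlinarith
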